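/- Setting. Let $D$ be a probability distribution on a domain $\mathcal X$ and let $S=(S_1,\dots,S_n)$ be an iid dataset with law $D^{n}$. A linear query is given by a measurable function $q:\mathcal X\to\mathbb R$; its value on a dataset is $q(s)=\frac1n\sum_{j=1}^n q(s_j)$ and its true value is $q(D)=\mathbb E_{S\sim D^n}[q(S)]$. The query is $\Delta$-bounded if $|q(x)-q(y)|\le\Delta$ for all $x,y\in\mathcal X$, and its standard deviation is that of $q(X)$, $X\sim D$. The Gaussian mechanism with parameter $\eta$ answers a query $q$ on $s$ by $q(s)+\xi$ with fresh independent noise $\xi\sim N(0,\eta^2)$. A (possibly randomized) analyst $A$ issues $k$ linear queries adaptively: the $i$-th query $q_i$ is a (measurable) function of the analyst's coin tosses and of the responses $r_1,\dots,r_{i-1}$. The mechanism is $(\alpha,\beta)$-distribution accurate with respect to $A$ if $\Pr\big[\max_{i\le k}|r_i-q_i(D)|>\alpha\big]\le\beta$, the probability being over the dataset, the noise and the coins. A real random variable $Y$ is sub-Gaussian with parameter $\sigma$ if $\mathbb E[e^{\lambda Y}]\le e^{\lambda^2\sigma^2}$ for all $\lambda>0$, and a random vector $Y\in\mathbb R^k$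 is sub-Gaussian with parameter $\sigma$ if $\langle u,Y\rangle$ is so for every unit vector $u$. Statement. Let $\alpha,\Delta,\sigma>0$, $0<\beta\le\frac18$, $k\in\mathbb N$, let $A$ be an analyst issuing $k$ linear queries, and let $M$ be the Gaussian mechanism with noise parameter $$\eta=\frac{\alpha}{3\sqrt{2\ln\frac{(k+1)\sigma}{\min\{\sigma,\alpha\}\beta^2}}},$$ which receives an iid dataset of size $n$. 1. If all queries issued by $A$ (after any history of responses and for any coins) are $\Delta$-bounded and have standard deviation at most $\sigma$, and $$n\ \ge\ 2\sqrt2\,\ln^{3/2}\!\Big(\frac{(k+1)\sigma}{\min\{\sigma,\alpha\}\beta^2}\Big)\sqrt k\cdot\max\Big\{\frac{\Delta}{\alpha},\,12\sqrt6\Big(\frac{\sigma}{\alpha}\Big)^2\Big\},$$ then $M$ is $(\alpha,\beta)$-distribution accurate with respect to $A$. 2. If the queries issued by $A$ define a sub-Gaussian random vector with parameter $\sigma$, i.e. for all coins and all sequences of responses the vector $(q_1(X),\dots,q_k(X))\in\mathbb R^k$ of the queries issued along them, $X\sim D$, is sub-Gaussian with parameter $\sigma$, and $$n\ \ge\ 696\,\ln^{3/2}\!\Big(\frac{k\sigma}{\min\{\sigma,\alpha\}\beta^2}\Big)\sqrt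 k\,\Big(\frac{\sigma}{\alpha}\Big)^2$$ (for $k=0$ the right-hand side is read as $0$), then $M$ is $(\alpha,\beta)$-distribution accurate with respect to $A$. -/

import Mathlib

open MeasureTheory ProbabilityTheory

noncomputable section

namespace AdaptiveData

/-- The linear query `s ↦ (1/n) ∑ⱼ q (sⱼ)` on datasets of size `n` defined by `q : X → ℝ`. -/
def linearQuery {X : Type*} {n : ℕ} (q : X → ℝ) (s : Fin n → X) : ℝ :=
  (1 / (n : ℝ)) * ∑ j, q (s j)

/-- The law of an iid dataset of size `n` whose elements have law `D`. -/
def datasetLaw {X : Type*} [MeasurableSpace X] (D : Measure X) (n : ℕ) : Measure (Fin n → X) :=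
  Measure.pi fun _ => D

/-- The true value `q(D)`: the expectation of the query over the law of the dataset. -/
def trueValue {X : Type*} [MeasurableSpace X] (D : Measure X) (n : ℕ) (q : X → ℝ) : ℝ :=
  ∫ s, linearQuery q s ∂(datasetLaw D n)

/-- `q` is `Δ`-bounded. -/
def IsBoundedQuery {X : Type*} (Δ : ℝ) (q : X → ℝ) : Prop :=
  ∀ x y, |q x - q y| ≤ Δ

/-- The standard deviation of `q x` for `x` of law `D`. -/
def stdDev {X : Type*} [MeasurableSpace X] (D : Measure X) (q : X → ℝ) : ℝ :=
  √(variance q D)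

/-- A real random variable is sub-Gaussian with parameter `σ` if `E exp (t f) ≤ exp (t² σ²)` for
all `t > 0`; finiteness of the expectation is part of the requirement. -/
def IsSubGaussian {X : Type*} [MeasurableSpace X] (D : Measure X) (f : X → ℝ) (σ : ℝ) : Prop :=
  ∀ t : ℝ, 0 < t → Integrable (fun x => Real.exp (t * f x)) D ∧
    ∫ x, Real.exp (t * f x) ∂D ≤ Real.exp (t ^ 2 * σ ^ 2)

/-- A random vector is sub-Gaussian with parameter `σ` if its inner product with every unit vector
is. -/
def IsSubGaussianVector {X : Type*} [MeasurableSpace X] {k : ℕ} (D : Measure X)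
    (f : X → EuclideanSpace ℝ (Fin k)) (σ : ℝ) : Prop :=
  ∀ u : EuclideanSpace ℝ (Fin k), ‖u‖ = 1 → IsSubGaussian D (fun x => inner ℝ u (f x)) σ

/-- A mechanism: a randomized function that answers a query on a dataset. Its randomness in one
call is a sample of `noise`. -/
structure Mechanism (X Ω : Type*) [MeasurableSpace Ω] (n : ℕ) where
  noise : Measure Ω
  isProbabilityMeasure_noise : IsProbabilityMeasure noise
  respond : (Fin n → X) → ((Fin n → X) → ℝ) → Ω → ℝ

/-- The Gaussian mechanism with noise parameter `η`: it answers `q s + ξ`, where `ξ` is a centred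
Gaussian variable with standard deviation `η`. -/
def gaussianMechanism (X : Type*) (n : ℕ) (η : ℝ) : Mechanism X ℝ n where
  noise := gaussianReal 0 (η ^ 2).toNNReal
  isProbabilityMeasure_noise := inferInstance
  respond s q ξ := q s + ξ

/-- An analyst issuing linear queries (given by the functions `X → ℝ` that define them).
It may toss coins, of law `coins`, once and for all; the query with index `i` (counting from `0`)
is then a function of the coins and of the `i` responses received so far. -/
structure Analyst (X C : Type*) [MeasurableSpace X] [MeasurableSpace C] where
  coins : Measure C
  isProbabilityMeasure_coins : IsProbabilityMeasure coins
  query : (i : ℕ) → C → (Fin i → ℝ) → X → ℝ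
  measurable_query : ∀ i, Measurable fun p : C × (Fin i → ℝ) × X => query i p.1 p.2.1 p.2.2

/-- The query with index `i` that the analyst issues in the interaction with coins `c` and
responses `v`. It depends only on `c` and on the responses before `i`. -/
def Analyst.queryAt {X C : Type*} [MeasurableSpace X] [MeasurableSpace C] (A : Analyst X C)
    {k : ℕ} (c : C) (v : Fin k → ℝ) (i : Fin k) : X → ℝ :=
  A.query i c fun j => v (Fin.castLE i.isLt.le j)

/-- The responses in the `k`-round interaction of `M`, holding the dataset `s`, with `A`, where `c`
are the coins of the analyst and `ω i` is the randomness of the mechanism in round `i`. -/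
def responses {X Ω C : Type*} [MeasurableSpace X] [MeasurableSpace Ω] [MeasurableSpace C] {n : ℕ}
    (M : Mechanism X Ω n) (A : Analyst X C) (s : Fin n → X) (c : C) :
    (k : ℕ) → (Fin k → Ω) → (Fin k → ℝ)
  | 0, _ => Fin.elim0
  | k + 1, ω =>
    Fin.snoc (α := fun _ => ℝ) (responses M A s c k (fun j => ω j.castSucc))
      (M.respond s
        (linearQuery (A.query k c (responses M A s c k (fun j => ω j.castSucc))))
        (ω (Fin.last k)))

/-- The distribution error `maxᵢ |rᵢ - qᵢ(D)|` of the view with coins `c` and responses `v`. -/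
def distributionError {X C : Type*} [MeasurableSpace X] [MeasurableSpace C] (D : Measure X)
    (n : ℕ) (A : Analyst X C) {k : ℕ} (c : C) (v : Fin k → ℝ) : ℝ :=
  ⨆ i : Fin k, |v i - trueValue D n (A.queryAt c v i)|

/-- The law of all the randomness of a `k`-round interaction: an iid dataset, the coins of the
analyst, and fresh randomness of the mechanism for each round, all independent. -/
def interactionLaw {X Ω C : Type*} [MeasurableSpace X] [MeasurableSpace Ω] [MeasurableSpace C]
    {n : ℕ} (D : Measure X) (M : Mechanism X Ω n) (A : Analyst X C) (k : ℕ) :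
    Measure ((Fin n → X) × C × (Fin k → Ω)) :=
  (datasetLaw D n).prod (A.coins.prod (Measure.pi fun _ => M.noise))

/-- `(α, β)`-distribution accuracy of `M` with respect to the analyst `A` issuing `k` queries, on an
iid dataset of law `D`: the distribution error exceeds `α` with probability at most `β`. -/
def IsDistributionAccurate {X Ω C : Type*} [MeasurableSpace X] [MeasurableSpace Ω]
    [MeasurableSpace C] {n : ℕ} (D : Measure X) (M : Mechanism X Ω n) (A : Analyst X C) (k : ℕ)
    (α β : ℝ) : Prop :=
  interactionLaw D M A k
    {p | α < distributionError D n A p.2.1 (responses M A p.1 p.2.1 k p.2.2)} ≤ ENNReal.ofReal β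

end AdaptiveData

end

/-! Suppose that some response deviates by more than `α` with probability `p > β`. Let the selected
query be the first one whose response deviates, centred and multiplied by the sign of the deviation;
it is zero if there is none. On the bad event the selected deviation is at least `α`, so its mean is
at least `α * p`. It also equals the average over `j` of the selected query at the data point `s j`,
plus the noise of the selected round. The noise contributes at most `α * p / 3`, by an exponential
moment and a union bound over the rounds. So it suffices to bound the mean of the selected query at
a single data point by `c₁ * p + c₂`, with `c₁` below `2 * α / 3` and `c₂` a small multiple of `α *
β`; see `isDistributionAccurate_of_integral_selectedQuery_le`.

For this, the coins and all the data but the point `x = s j` are frozen, and `x` is resampled. The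
responses then form an adaptive Gaussian channel whose drift is a base drift, free of `x`, plus a
centred increment of order `1 / n` depending on `x`. By Girsanov (`lintegral_adaptiveRun_add`) the
joint law of `x` and the responses has the density `likelihood` with respect to a law under which
they are independent. Under the latter the selected query has mean zero, so only the fluctuation of
the likelihood about its mean matters.

For bounded queries, Young's inequality reduces the mean to the variance of the query and the second
moment of `likelihood - 1` on the bad event. The latter is governed by the squared `L²(D)` norm of
the stochastic integral of the increments, which has an exponential moment by a supermartingale
argument (`lintegral_exp_sqNorm_le`). Finally `measure_base_le` returns from the base channel to the
true probability.

For sub-Gaussian queries the density is unbounded, and the Gibbs variational principle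
(`integral_tilted_le`) is applied to the law of `x` given the responses. Its relative entropy is
controlled by the squared length of the noise vector, which is again integrated over the bad event
by means of an exponential moment. -/

noncomputable section

open scoped ENNReal NNReal

namespace AdaptiveData

/-! ### Gaussian integrals of exponentials of quadratics; Cameron–Martin. -/

section Gaussian

/-- Completing the square: a quadratic exponential tilt of a centred Gaussian is again Gaussian up
to a constant. Having `d` in `ℝ≥0` and nonzero encodes the integrability condition `2 * t * v < 1`.
-/
lemma gaussianPDFReal_mul_exp_quadratic {v : ℝ≥0} (hv : v ≠ 0) {t : ℝ} (b : ℝ) {d : ℝ≥0}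
    (hd : (d : ℝ) = 1 - 2 * t * v) (hd0 : d ≠ 0) (y : ℝ) :
    gaussianPDFReal 0 v y * Real.exp (t * y ^ 2 + b * y) =
      (√(d : ℝ))⁻¹ * Real.exp (b ^ 2 * v / (2 * d)) * gaussianPDFReal (b * v / d) (v / d) y := by
  have hv' : (v : ℝ) ≠ 0 := by exact_mod_cast hv
  have hd' : (d : ℝ) ≠ 0 := by exact_mod_cast hd0
  have hdpos : (0 : ℝ) < d := by positivity
  simp only [gaussianPDFReal]
  have h1 : (√(2 * Real.pi * ((v / d : ℝ≥0) : ℝ)))⁻¹ = (√(2 * Real.pi * v))⁻¹ * √(d : ℝ) := by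
    rw [NNReal.coe_div, ← mul_div_assoc, Real.sqrt_div (by positivity), inv_div, div_eq_mul_inv,
      mul_comm]
  rw [h1]
  have h2 : Real.exp (-(y - 0) ^ 2 / (2 * v)) * Real.exp (t * y ^ 2 + b * y) =
      Real.exp (b ^ 2 * v / (2 * d)) *
        Real.exp (-(y - b * v / d) ^ 2 / (2 * ((v / d : ℝ≥0) : ℝ))) := by
    rw [← Real.exp_add, ← Real.exp_add]
    congr 1
    have ht : t = (1 - d) / (2 * v) := by
      rw [hd]; field_simp; ring
    rw [NNReal.coe_div, ht]
    field_simp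
    ring
  have h3 : (√(d : ℝ))⁻¹ * √(d : ℝ) = 1 := inv_mul_cancel₀ (by positivity)
  calc _ = (√(2 * Real.pi * v))⁻¹ *
        (Real.exp (-(y - 0) ^ 2 / (2 * v)) * Real.exp (t * y ^ 2 + b * y)) := by ring
    _ = (√(2 * Real.pi * v))⁻¹ * (Real.exp (b ^ 2 * v / (2 * d)) *
        Real.exp (-(y - b * v / d) ^ 2 / (2 * ((v / d : ℝ≥0) : ℝ)))) *
          ((√(d : ℝ))⁻¹ * √(d : ℝ)) := by rw [h2, h3, mul_one]
    _ = _ := by ring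

lemma lintegral_mul_exp_quadratic_gaussianReal {v : ℝ≥0} (hv : v ≠ 0) {t : ℝ} (b : ℝ) {d : ℝ≥0}
    (hd : (d : ℝ) = 1 - 2 * t * v) (hd0 : d ≠ 0) {F : ℝ → ℝ≥0∞} (hF : Measurable F) :
    ∫⁻ y, F y * ENNReal.ofReal (Real.exp (t * y ^ 2 + b * y)) ∂gaussianReal 0 v =
      ENNReal.ofReal ((√(d : ℝ))⁻¹ * Real.exp (b ^ 2 * v / (2 * d))) *
        ∫⁻ y, F y ∂gaussianReal (b * v / d) (v / d) := by
  have hvd : v / d ≠ 0 := div_ne_zero hv hd0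
  rw [gaussianReal_of_var_ne_zero _ hv, gaussianReal_of_var_ne_zero _ hvd,
    lintegral_withDensity_eq_lintegral_mul _ (by fun_prop) (by fun_prop),
    lintegral_withDensity_eq_lintegral_mul _ (by fun_prop) hF,
    ← lintegral_const_mul _ (by fun_prop)]
  refine lintegral_congr fun y => ?_
  simp only [Pi.mul_apply, gaussianPDF]
  rw [mul_comm (F y), ← mul_assoc, ← ENNReal.ofReal_mul (gaussianPDFReal_nonneg _ _ _),
    gaussianPDFReal_mul_exp_quadratic hv b hd hd0, ENNReal.ofReal_mul (by positivity), mul_assoc]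

lemma lintegral_exp_quadratic_gaussianReal {v : ℝ≥0} (hv : v ≠ 0) {t : ℝ} (b : ℝ) {d : ℝ≥0}
    (hd : (d : ℝ) = 1 - 2 * t * v) (hd0 : d ≠ 0) :
    ∫⁻ y, ENNReal.ofReal (Real.exp (t * y ^ 2 + b * y)) ∂gaussianReal 0 v =
      ENNReal.ofReal ((√(d : ℝ))⁻¹ * Real.exp (b ^ 2 * v / (2 * d))) := by
  simpa using lintegral_mul_exp_quadratic_gaussianReal hv b hd hd0 (F := fun _ => 1) (by fun_prop)

lemma lintegral_exp_linear_gaussianReal {v : ℝ≥0} (hv : v ≠ 0) (b : ℝ) :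
    ∫⁻ y, ENNReal.ofReal (Real.exp (b * y)) ∂gaussianReal 0 v =
      ENNReal.ofReal (Real.exp (b ^ 2 * v / 2)) := by
  simpa using lintegral_exp_quadratic_gaussianReal hv (t := 0) b (d := 1) (by simp) one_ne_zero

/-- Cameron–Martin formula for a one-dimensional Gaussian. -/
lemma lintegral_gaussianReal_shift {v : ℝ≥0} (hv : v ≠ 0) (a : ℝ) {F : ℝ → ℝ≥0∞}
    (hF : Measurable F) :
    ∫⁻ y, F (a + y) ∂gaussianReal 0 v =
      ∫⁻ y, F y * ENNReal.ofReal (Real.exp ((y * a - a ^ 2 / 2) / v)) ∂gaussianReal 0 v := by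
  have hv' : (v : ℝ) ≠ 0 := by exact_mod_cast hv
  -- The purely linear tilt of slope `a / v` moves the mean to `a` and keeps the variance.
  have h := lintegral_mul_exp_quadratic_gaussianReal hv (t := 0) (a / v) (d := 1) (by simp)
    one_ne_zero hF
  have h1 : a / v * v = a := by field_simp
  simp only [zero_mul, zero_add, NNReal.coe_one, Real.sqrt_one, inv_one, one_mul, div_one, mul_one,
    h1] at h
  have h2 : ∫⁻ y, F (a + y) ∂gaussianReal 0 v = ∫⁻ y, F y ∂gaussianReal a v := by
    rw [← lintegral_map hF (measurable_const_add a), gaussianReal_map_const_add, zero_add]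
  rw [h2]
  have h3 : ∀ y, F y * ENNReal.ofReal (Real.exp ((y * a - a ^ 2 / 2) / v)) =
      ENNReal.ofReal (Real.exp (-(a ^ 2 / (2 * v)))) *
        (F y * ENNReal.ofReal (Real.exp (a / v * y))) := by
    intro y
    rw [mul_left_comm, ← ENNReal.ofReal_mul (by positivity), ← Real.exp_add]
    congr 3
    field_simp
    ring
  simp_rw [h3]
  rw [lintegral_const_mul _ (by fun_prop), h, ← mul_assoc, ← ENNReal.ofReal_mul (by positivity),
    ← Real.exp_add]
  have h4 : -(a ^ 2 / (2 * (v : ℝ))) + (a / v) ^ 2 * v / 2 = 0 := by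
    field_simp
    ring
  rw [h4]
  simp

end Gaussian

/-! ### Splitting off the last noise variable; supermartingales. -/

section Snoc

lemma measurable_snoc (k : ℕ) :
    Measurable fun p : (Fin k → ℝ) × ℝ => (Fin.snoc (α := fun _ => ℝ) p.1 p.2 : Fin (k + 1) → ℝ) := by
  refine measurable_pi_iff.2 fun i => ?_
  refine Fin.lastCases ?_ (fun i => ?_) i
  · simpa using measurable_snd
  · simpa [Function.comp_def] using (measurable_pi_apply i).comp measurable_fst

lemma measurable_comp_castSucc (k : ℕ) :
    Measurable fun (ω : Fin (k + 1) → ℝ) (j : Fin k) => ω j.castSucc :=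
  measurable_pi_iff.2 fun _ => measurable_pi_apply _

lemma lintegral_pi_snoc (ν : Measure ℝ) [IsProbabilityMeasure ν] (k : ℕ)
    {F : (Fin (k + 1) → ℝ) → ℝ≥0∞} (hF : Measurable F) :
    ∫⁻ ω, F ω ∂(Measure.pi fun _ : Fin (k + 1) => ν) =
      ∫⁻ ω, ∫⁻ y, F (Fin.snoc (α := fun _ => ℝ) ω y) ∂ν ∂(Measure.pi fun _ : Fin k => ν) := by
  have h := (measurePreserving_piFinSuccAbove (fun _ : Fin (k + 1) => ν) (Fin.last k)).symm
  rw [← h.lintegral_comp hF, lintegral_prod_symm' (fun p => F _) (hF.comp h.measurable)]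
  refine lintegral_congr fun ω => lintegral_congr fun y => ?_
  congr 1
  ext i
  refine Fin.lastCases ?_ (fun i => ?_) i <;>
    simp [MeasurableEquiv.piFinSuccAbove, MeasurableEquiv.symm, Fin.snocEquiv]

/-- If `Z` is a supermartingale in the noise variables, its final mean is at most its initial
value. -/
lemma lintegral_le_of_supermartingale (ν : Measure ℝ) [IsProbabilityMeasure ν] (k : ℕ)
    (Z : (l : ℕ) → (Fin l → ℝ) → ℝ≥0∞) (hZ : ∀ l, Measurable (Z l))
    (hstep : ∀ l < k, ∀ ω : Fin l → ℝ,
      ∫⁻ y, Z (l + 1) (Fin.snoc (α := fun _ => ℝ) ω y) ∂ν ≤ Z l ω) :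
    ∫⁻ ω, Z k ω ∂(Measure.pi fun _ : Fin k => ν) ≤ Z 0 Fin.elim0 := by
  induction k with
  | zero =>
    rw [Measure.pi_of_empty _ Fin.elim0]
    simp [lintegral_dirac' _ (hZ 0)]
  | succ k ih =>
    rw [lintegral_pi_snoc ν k (hZ _)]
    exact (lintegral_mono fun ω => hstep k k.lt_succ_self ω).trans
      (ih fun l hl => hstep l (hl.trans k.lt_succ_self))

end Snoc

/-! ### Adaptive Gaussian channels and Girsanov's theorem. -/

section Channel

/-- The responses of an adaptive channel with drift `m`: response `l` is the drift `m l`, evaluated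
at the previous responses, plus the noise `ω l`. -/
def adaptiveRun (m : (l : ℕ) → (Fin l → ℝ) → ℝ) : (k : ℕ) → (Fin k → ℝ) → (Fin k → ℝ)
  | 0, _ => Fin.elim0
  | k + 1, ω =>
    Fin.snoc (α := fun _ => ℝ) (adaptiveRun m k fun j => ω j.castSucc)
      (m k (adaptiveRun m k fun j => ω j.castSucc) + ω (Fin.last k))

/-- The stochastic integral `∑ ω l * a l` along the channel with drift `b`. -/
def noiseSum (b a : (l : ℕ) → (Fin l → ℝ) → ℝ) : (k : ℕ) → (Fin k → ℝ) → ℝ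
  | 0, _ => 0
  | k + 1, ω => noiseSum b a k (fun j => ω j.castSucc) +
      ω (Fin.last k) * a k (adaptiveRun b k fun j => ω j.castSucc)

/-- The quadratic variation `∑ (a l) ^ 2` along the channel with drift `b`. -/
def energy (b a : (l : ℕ) → (Fin l → ℝ) → ℝ) : (k : ℕ) → (Fin k → ℝ) → ℝ
  | 0, _ => 0
  | k + 1, ω => energy b a k (fun j => ω j.castSucc) +
      a k (adaptiveRun b k fun j => ω j.castSucc) ^ 2

/-- The likelihood ratio of the channel with drift `b + a` against the one with drift `b`. -/
def likelihood (v : ℝ≥0) (b a : (l : ℕ) → (Fin l → ℝ) → ℝ) (k : ℕ) (ω : Fin k → ℝ) : ℝ :=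
  Real.exp ((noiseSum b a k ω - energy b a k ω / 2) / v)

variable (m b a : (l : ℕ) → (Fin l → ℝ) → ℝ)

@[simp]
lemma adaptiveRun_snoc (k : ℕ) (ω : Fin k → ℝ) (y : ℝ) :
    adaptiveRun m (k + 1) (Fin.snoc (α := fun _ => ℝ) ω y) =
      Fin.snoc (α := fun _ => ℝ) (adaptiveRun m k ω) (m k (adaptiveRun m k ω) + y) := by
  simp [adaptiveRun]

@[simp]
lemma noiseSum_snoc (k : ℕ) (ω : Fin k → ℝ) (y : ℝ) :
    noiseSum b a (k + 1) (Fin.snoc (α := fun _ => ℝ) ω y) =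
      noiseSum b a k ω + y * a k (adaptiveRun b k ω) := by
  simp [noiseSum]

@[simp]
lemma energy_snoc (k : ℕ) (ω : Fin k → ℝ) (y : ℝ) :
    energy b a (k + 1) (Fin.snoc (α := fun _ => ℝ) ω y) =
      energy b a k ω + a k (adaptiveRun b k ω) ^ 2 := by
  simp [energy]

lemma energy_nonneg (k : ℕ) (ω : Fin k → ℝ) : 0 ≤ energy b a k ω := by
  induction k with
  | zero => simp [energy]
  | succ k ih => exact add_nonneg (ih _) (sq_nonneg _)

/-- Causality: the first `l` responses depend on the first `l` noise variables only. -/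
lemma adaptiveRun_castLE {k l : ℕ} (h : l ≤ k) (ω : Fin k → ℝ) :
    (fun j : Fin l => adaptiveRun m k ω (Fin.castLE h j)) =
      adaptiveRun m l fun j => ω (Fin.castLE h j) := by
  induction k, h using Nat.le_induction with
  | base => rfl
  | succ k hk ih =>
    rw [← Fin.snoc_init_self ω, adaptiveRun_snoc]
    have h1 : ∀ j : Fin l, Fin.castLE (hk.trans k.le_succ) j = (Fin.castLE hk j).castSucc :=
      fun j => rfl
    simp only [h1, Fin.snoc_castSucc]
    exact ih _

lemma adaptiveRun_apply {k : ℕ} (ω : Fin k → ℝ) (i : Fin k) :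
    adaptiveRun m k ω i =
      m i (fun j => adaptiveRun m k ω (Fin.castLE i.isLt.le j)) + ω i := by
  have h := congrFun (adaptiveRun_castLE m (Nat.succ_le_of_lt i.isLt) ω) (Fin.last i)
  have h2 := adaptiveRun_castLE m i.isLt.le ω
  rw [h2]
  have h3 : Fin.castLE (Nat.succ_le_of_lt i.isLt) (Fin.last (i : ℕ)) = i := by ext; rfl
  rw [h3] at h
  rw [h]
  simp only [adaptiveRun, Fin.snoc_last, h3]
  rfl

lemma noiseSum_eq_sum (k : ℕ) (ω : Fin k → ℝ) :
    noiseSum b a k ω =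
      ∑ i : Fin k, ω i * a i (fun j => adaptiveRun b k ω (Fin.castLE i.isLt.le j)) := by
  induction k with
  | zero => simp [noiseSum]
  | succ k ih =>
    rw [Fin.sum_univ_castSucc, noiseSum, ih]
    simp_rw [adaptiveRun_castLE]
    rfl

lemma energy_eq_sum (k : ℕ) (ω : Fin k → ℝ) :
    energy b a k ω =
      ∑ i : Fin k, a i (fun j => adaptiveRun b k ω (Fin.castLE i.isLt.le j)) ^ 2 := by
  induction k with
  | zero => simp [energy]
  | succ k ih =>
    rw [Fin.sum_univ_castSucc, energy, ih]
    simp_rw [adaptiveRun_castLE]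
    rfl

section Measurability

variable {Y : Type*} [MeasurableSpace Y] {m b a : (l : ℕ) → Y → (Fin l → ℝ) → ℝ}

lemma measurable_adaptiveRun (hm : ∀ l, Measurable fun p : Y × (Fin l → ℝ) => m l p.1 p.2) (k : ℕ) :
    Measurable fun p : Y × (Fin k → ℝ) => adaptiveRun (fun l => m l p.1) k p.2 := by
  induction k with
  | zero => exact measurable_const
  | succ k ih =>
    have h1 : Measurable fun p : Y × (Fin (k + 1) → ℝ) =>
        adaptiveRun (fun l => m l p.1) k fun j => p.2 j.castSucc :=
      ih.comp (measurable_fst.prodMk ((measurable_comp_castSucc k).comp measurable_snd))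
    exact (measurable_snoc k).comp (h1.prodMk (((hm k).comp (measurable_fst.prodMk h1)).add
      ((measurable_pi_apply _).comp measurable_snd)))

lemma measurable_noiseSum (hb : ∀ l, Measurable fun p : Y × (Fin l → ℝ) => b l p.1 p.2)
    (ha : ∀ l, Measurable fun p : Y × (Fin l → ℝ) => a l p.1 p.2) (k : ℕ) :
    Measurable fun p : Y × (Fin k → ℝ) => noiseSum (fun l => b l p.1) (fun l => a l p.1) k p.2 := by
  induction k with
  | zero => exact measurable_const
  | succ k ih =>
    have h0 : Measurable fun p : Y × (Fin (k + 1) → ℝ) => (p.1, fun j : Fin k => p.2 j.castSucc) :=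
      measurable_fst.prodMk ((measurable_comp_castSucc k).comp measurable_snd)
    exact (ih.comp h0).add (((measurable_pi_apply _).comp measurable_snd).mul
      ((ha k).comp (measurable_fst.prodMk ((measurable_adaptiveRun hb k).comp h0))))

lemma measurable_energy (hb : ∀ l, Measurable fun p : Y × (Fin l → ℝ) => b l p.1 p.2)
    (ha : ∀ l, Measurable fun p : Y × (Fin l → ℝ) => a l p.1 p.2) (k : ℕ) :
    Measurable fun p : Y × (Fin k → ℝ) => energy (fun l => b l p.1) (fun l => a l p.1) k p.2 := by
  induction k with
  | zero => exact measurable_const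
  | succ k ih =>
    have h0 : Measurable fun p : Y × (Fin (k + 1) → ℝ) => (p.1, fun j : Fin k => p.2 j.castSucc) :=
      measurable_fst.prodMk ((measurable_comp_castSucc k).comp measurable_snd)
    exact (ih.comp h0).add
      (((ha k).comp (measurable_fst.prodMk ((measurable_adaptiveRun hb k).comp h0))).pow_const 2)

lemma measurable_likelihood (v : ℝ≥0)
    (hb : ∀ l, Measurable fun p : Y × (Fin l → ℝ) => b l p.1 p.2)
    (ha : ∀ l, Measurable fun p : Y × (Fin l → ℝ) => a l p.1 p.2) (k : ℕ) :
    Measurable fun p : Y × (Fin k → ℝ) =>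
      likelihood v (fun l => b l p.1) (fun l => a l p.1) k p.2 :=
  Real.measurable_exp.comp
    (((measurable_noiseSum hb ha k).sub ((measurable_energy hb ha k).div_const 2)).div_const _)

end Measurability

section Girsanov

variable {m b a}

lemma measurable_adaptiveRun' (hm : ∀ l, Measurable (m l)) (k : ℕ) :
    Measurable (adaptiveRun m k) :=
  (measurable_adaptiveRun (Y := Unit) (m := fun l _ => m l)
    (fun l => (hm l).comp measurable_snd) k).comp (measurable_prodMk_left (x := ()))

lemma measurable_noiseSum' (hb : ∀ l, Measurable (b l)) (ha : ∀ l, Measurable (a l)) (k : ℕ) :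
    Measurable (noiseSum b a k) :=
  (measurable_noiseSum (Y := Unit) (b := fun l _ => b l) (a := fun l _ => a l)
    (fun l => (hb l).comp measurable_snd) (fun l => (ha l).comp measurable_snd) k).comp
      (measurable_prodMk_left (x := ()))

lemma measurable_energy' (hb : ∀ l, Measurable (b l)) (ha : ∀ l, Measurable (a l)) (k : ℕ) :
    Measurable (energy b a k) :=
  (measurable_energy (Y := Unit) (b := fun l _ => b l) (a := fun l _ => a l)
    (fun l => (hb l).comp measurable_snd) (fun l => (ha l).comp measurable_snd) k).comp
      (measurable_prodMk_left (x := ()))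

lemma measurable_likelihood' (v : ℝ≥0) (hb : ∀ l, Measurable (b l)) (ha : ∀ l, Measurable (a l))
    (k : ℕ) : Measurable (likelihood v b a k) :=
  Real.measurable_exp.comp
    (((measurable_noiseSum' hb ha k).sub ((measurable_energy' hb ha k).div_const 2)).div_const _)

/-- Girsanov's theorem for adaptive Gaussian channels. -/
theorem lintegral_adaptiveRun_add {v : ℝ≥0} (hv : v ≠ 0) (hb : ∀ l, Measurable (b l))
    (ha : ∀ l, Measurable (a l)) (k : ℕ) {F : (Fin k → ℝ) → ℝ≥0∞} (hF : Measurable F) :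
    ∫⁻ ω, F (adaptiveRun (fun l u => b l u + a l u) k ω)
        ∂(Measure.pi fun _ : Fin k => gaussianReal 0 v) =
      ∫⁻ ω, F (adaptiveRun b k ω) * ENNReal.ofReal (likelihood v b a k ω)
        ∂(Measure.pi fun _ : Fin k => gaussianReal 0 v) := by
  induction k with
  | zero => simp [adaptiveRun, likelihood, noiseSum, energy]
  | succ k ih =>
    have hrun : Measurable (adaptiveRun (fun l u => b l u + a l u) (k + 1)) :=
      measurable_adaptiveRun' (fun l => (hb l).add (ha l)) (k + 1)
    have hrunb := measurable_adaptiveRun' hb (k + 1)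
    have hlik := measurable_likelihood' v hb ha (k + 1)
    rw [lintegral_pi_snoc (F := fun ω => F (adaptiveRun _ _ ω)) _ _ (hF.comp hrun),
      lintegral_pi_snoc (F := fun ω => F (adaptiveRun _ _ ω) * _) _ _
        ((hF.comp hrunb).mul hlik.ennreal_ofReal)]
    -- The last round is integrated out, so that the induction hypothesis applies to a function of
    -- the first `k` responses. Cameron–Martin in the last variable then supplies the last factor of
    -- the likelihood.
    let H : (Fin k → ℝ) → ℝ≥0∞ := fun u =>
      ∫⁻ y, F (Fin.snoc (α := fun _ => ℝ) u (b k u + a k u + y)) ∂gaussianReal 0 v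
    have hH : Measurable H := by
      refine Measurable.lintegral_prod_right' (f := fun p : (Fin k → ℝ) × ℝ =>
        F (Fin.snoc (α := fun _ => ℝ) p.1 (b k p.1 + a k p.1 + p.2))) ?_
      exact hF.comp ((measurable_snoc k).comp (measurable_fst.prodMk
        ((((hb k).comp measurable_fst).add ((ha k).comp measurable_fst)).add measurable_snd)))
    have h1 := ih hH
    simp only [adaptiveRun_snoc]
    refine h1.trans (lintegral_congr fun ω => ?_)
    set u := adaptiveRun b k ω
    have h2 : H u = ∫⁻ y, F (Fin.snoc (α := fun _ => ℝ) u (b k u + y)) *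
        ENNReal.ofReal (Real.exp ((y * a k u - a k u ^ 2 / 2) / v)) ∂gaussianReal 0 v := by
      have hG : Measurable fun y => F (Fin.snoc (α := fun _ => ℝ) u (b k u + y)) :=
        hF.comp ((measurable_snoc k).comp (measurable_const.prodMk (measurable_const_add _)))
      rw [← lintegral_gaussianReal_shift hv (a k u) hG]
      simp only [H, add_assoc]
    rw [h2, ← lintegral_mul_const']
    · refine lintegral_congr fun y => ?_
      rw [mul_assoc, ← ENNReal.ofReal_mul (by positivity)]
      simp only [likelihood, noiseSum_snoc, energy_snoc]
      rw [← Real.exp_add]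
      congr 3
      ring
    · exact ENNReal.ofReal_ne_top

lemma likelihood_pos (v : ℝ≥0) (k : ℕ) (ω : Fin k → ℝ) : 0 < likelihood v b a k ω :=
  Real.exp_pos _

lemma lintegral_likelihood {v : ℝ≥0} (hv : v ≠ 0) (hb : ∀ l, Measurable (b l))
    (ha : ∀ l, Measurable (a l)) (k : ℕ) :
    ∫⁻ ω, ENNReal.ofReal (likelihood v b a k ω) ∂(Measure.pi fun _ : Fin k => gaussianReal 0 v) =
      1 := by
  simpa using (lintegral_adaptiveRun_add hv hb ha k (F := fun _ => 1) measurable_const).symm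

end Girsanov

end Channel

/-! ### Exponential moments of the noise and of stochastic integrals. -/

section ExponentialMoments

lemma noiseSum_const_mul (b a : (l : ℕ) → (Fin l → ℝ) → ℝ) (m : ℝ) (k : ℕ) (ω : Fin k → ℝ) :
    noiseSum b (fun l u => m * a l u) k ω = m * noiseSum b a k ω := by
  simp only [noiseSum_eq_sum, Finset.mul_sum]
  exact Finset.sum_congr rfl fun i _ => by ring

lemma energy_const_mul (b a : (l : ℕ) → (Fin l → ℝ) → ℝ) (m : ℝ) (k : ℕ) (ω : Fin k → ℝ) :
    energy b (fun l u => m * a l u) k ω = m ^ 2 * energy b a k ω := by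
  simp only [energy_eq_sum, Finset.mul_sum]
  exact Finset.sum_congr rfl fun i _ => by ring

/-- The integrand is the likelihood ratio for the increments `m * a`, of mean one, times the
exponential of `m ^ 2 / 2` times the normalised energy. -/
lemma lintegral_exp_noiseSum_le {v : ℝ≥0} (hv : v ≠ 0) {b a : (l : ℕ) → (Fin l → ℝ) → ℝ}
    (hb : ∀ l, Measurable (b l)) (ha : ∀ l, Measurable (a l)) (k : ℕ) {E : ℝ}
    (hE : ∀ ω, energy b a k ω / v ≤ E) (m : ℝ) :
    ∫⁻ ω, ENNReal.ofReal (Real.exp (m * (noiseSum b a k ω / v)))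
        ∂(Measure.pi fun _ : Fin k => gaussianReal 0 v) ≤
      ENNReal.ofReal (Real.exp (m ^ 2 * E / 2)) := by
  have h := lintegral_likelihood hv hb (a := fun l u => m * a l u)
    (fun l => (ha l).const_mul m) k
  calc _ ≤ ∫⁻ ω, ENNReal.ofReal (Real.exp (m ^ 2 * E / 2)) *
        ENNReal.ofReal (likelihood v b (fun l u => m * a l u) k ω)
        ∂(Measure.pi fun _ : Fin k => gaussianReal 0 v) := by
        refine lintegral_mono fun ω => ?_
        rw [← ENNReal.ofReal_mul (by positivity)]
        refine ENNReal.ofReal_le_ofReal ?_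
        rw [likelihood, ← Real.exp_add, Real.exp_le_exp, noiseSum_const_mul, energy_const_mul]
        have h1 := mul_le_mul_of_nonneg_left (hE ω) (sq_nonneg m)
        have h2 : (m * noiseSum b a k ω - m ^ 2 * energy b a k ω / 2) / (v : ℝ) =
          m * (noiseSum b a k ω / v) - m ^ 2 * (energy b a k ω / v) / 2 := by ring
        rw [h2]
        linarith
    _ = _ := by rw [lintegral_const_mul' _ _ ENNReal.ofReal_ne_top, h, mul_one]

/-- Each round contributes a factor `d ^ (-1/2)`; multiplying the partial exponential by the factors
of the remaining rounds makes it a martingale. -/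
lemma lintegral_exp_sum_sq {v : ℝ≥0} (hv : v ≠ 0) {s : ℝ} {d : ℝ≥0}
    (hd : (d : ℝ) = 1 - 2 * s * v) (hd0 : d ≠ 0) (k : ℕ) :
    ∫⁻ ω, ENNReal.ofReal (Real.exp (s * ∑ i, ω i ^ 2))
        ∂(Measure.pi fun _ : Fin k => gaussianReal 0 v) ≤
      ENNReal.ofReal ((√(d : ℝ))⁻¹ ^ k) := by
  have h := lintegral_le_of_supermartingale (gaussianReal 0 v) k
    (fun l ω => ENNReal.ofReal (Real.exp (s * ∑ i, ω i ^ 2) * (√(d : ℝ))⁻¹ ^ (k - l)))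
    (fun l => by fun_prop) ?_
  · simpa using h
  · intro l hl ω
    obtain ⟨j, rfl⟩ : ∃ j, k = l + 1 + j := ⟨k - (l + 1), by omega⟩
    have e1 : l + 1 + j - (l + 1) = j := by omega
    have e2 : l + 1 + j - l = j + 1 := by omega
    simp only [Fin.sum_univ_castSucc, Fin.snoc_castSucc, Fin.snoc_last, e1, e2]
    have h1 : ∀ y : ℝ, ENNReal.ofReal (Real.exp (s * (∑ i, ω i ^ 2 + y ^ 2)) * (√(d : ℝ))⁻¹ ^ j) =
        ENNReal.ofReal (Real.exp (s * ∑ i, ω i ^ 2) * (√(d : ℝ))⁻¹ ^ j) *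
          ENNReal.ofReal (Real.exp (s * y ^ 2 + 0 * y)) := by
      intro y
      rw [← ENNReal.ofReal_mul (by positivity), zero_mul, add_zero, mul_add, Real.exp_add]
      congr 1
      ring
    simp_rw [h1]
    rw [lintegral_const_mul' _ _ ENNReal.ofReal_ne_top,
      lintegral_exp_quadratic_gaussianReal hv 0 hd hd0, ← ENNReal.ofReal_mul (by positivity)]
    refine ENNReal.ofReal_le_ofReal (le_of_eq ?_)
    simp [pow_succ]
    ring

lemma lintegral_exp_abs_noise_le {v : ℝ≥0} (hv : v ≠ 0) (s : ℝ) {k : ℕ} (i : Fin k) :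
    ∫⁻ ω, ENNReal.ofReal (Real.exp (s * |ω i|))
        ∂(Measure.pi fun _ : Fin k => gaussianReal 0 v) ≤
      ENNReal.ofReal (2 * Real.exp (s ^ 2 * v / 2)) := by
  have h := (measurePreserving_eval (fun _ : Fin k => gaussianReal 0 v) i).lintegral_comp
    (f := fun y => ENNReal.ofReal (Real.exp (s * |y|))) (by fun_prop)
  refine h.le.trans ?_
  calc _ ≤ ∫⁻ y, (ENNReal.ofReal (Real.exp (s * y)) + ENNReal.ofReal (Real.exp (-s * y)))
        ∂gaussianReal 0 v := by
        refine lintegral_mono fun y => ?_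
        rw [← ENNReal.ofReal_add (by positivity) (by positivity)]
        refine ENNReal.ofReal_le_ofReal ?_
        rcases abs_cases y with ⟨h, _⟩ | ⟨h, _⟩ <;> rw [h]
        · linarith [Real.exp_pos (-s * y)]
        · rw [mul_neg, ← neg_mul]
          linarith [Real.exp_pos (s * y)]
    _ = _ := by
        rw [lintegral_add_left (by fun_prop), lintegral_exp_linear_gaussianReal hv,
          lintegral_exp_linear_gaussianReal hv, ← ENNReal.ofReal_add (by positivity) (by positivity),
          neg_sq, two_mul]

end ExponentialMoments

/-! ### Exponential moment of the `L²(D)` norm of the stochastic integral. -/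

section Hilbert

variable {X : Type*} [MeasurableSpace X] {D : Measure X}
  {b : (l : ℕ) → (Fin l → ℝ) → ℝ} {a : (l : ℕ) → X → (Fin l → ℝ) → ℝ}

lemma memLp_noiseSum (k : ℕ) (hL : ∀ l < k, ∀ u, MemLp (fun x => a l x u) 2 D) (ω : Fin k → ℝ) :
    MemLp (fun x => noiseSum b (fun l => a l x) k ω) 2 D := by
  induction k with
  | zero => exact MemLp.zero
  | succ k ih => exact (ih (fun l hl => hL l (hl.trans k.lt_succ_self)) _).add ((hL k k.lt_succ_self _).const_mul _)

/-- The squared norm in `L²(D)` of the stochastic integral of `a`. -/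
def sqNorm (D : Measure X) (b : (l : ℕ) → (Fin l → ℝ) → ℝ) (a : (l : ℕ) → X → (Fin l → ℝ) → ℝ)
    (k : ℕ) (ω : Fin k → ℝ) : ℝ :=
  ∫ x, noiseSum b (fun l => a l x) k ω ^ 2 ∂D

lemma measurable_sqNorm [SFinite D] (hb : ∀ l, Measurable (b l))
    (ha : ∀ l, Measurable fun p : X × (Fin l → ℝ) => a l p.1 p.2) (k : ℕ) :
    Measurable (sqNorm D b a k) := by
  have h := measurable_noiseSum (Y := X) (b := fun l _ => b l) (a := a)
    (fun l => (hb l).comp measurable_snd) ha k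
  exact (StronglyMeasurable.integral_prod_left' (μ := D)
    (f := fun p : X × (Fin k → ℝ) => noiseSum b (fun l => a l p.1) k p.2 ^ 2)
    (h.pow_const 2).stronglyMeasurable).measurable

lemma sqNorm_nonneg (k : ℕ) (ω : Fin k → ℝ) : 0 ≤ sqNorm D b a k ω :=
  integral_nonneg fun _ => sq_nonneg _

/-- Here `B` is the inner product in `L²(D)` of the stochastic integral so far and the next
increment. Only Cauchy–Schwarz for `B` and the size of `c` enter the one-step estimate. -/
lemma sqNorm_snoc (k : ℕ) (hL : ∀ l < k + 1, ∀ u, MemLp (fun x => a l x u) 2 D)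
    (ω : Fin k → ℝ) :
    ∃ B c : ℝ, c = ∫ x, a k x (adaptiveRun b k ω) ^ 2 ∂D ∧ B ^ 2 ≤ sqNorm D b a k ω * c ∧
      ∀ y, sqNorm D b a (k + 1) (Fin.snoc (α := fun _ => ℝ) ω y) =
        sqNorm D b a k ω + 2 * y * B + y ^ 2 * c := by
  have hG := memLp_noiseSum (D := D) (b := b) k (fun l hl => hL l (hl.trans k.lt_succ_self)) ω
  have hA := hL k k.lt_succ_self (adaptiveRun b k ω)
  have hGA : Integrable
      (fun x => noiseSum b (fun l => a l x) k ω * a k x (adaptiveRun b k ω)) D :=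
    hG.integrable_mul hA
  set B := ∫ x, noiseSum b (fun l => a l x) k ω * a k x (adaptiveRun b k ω) ∂D with hB
  set c := ∫ x, a k x (adaptiveRun b k ω) ^ 2 ∂D with hc
  have hexp : ∀ y, sqNorm D b a (k + 1) (Fin.snoc (α := fun _ => ℝ) ω y) =
        sqNorm D b a k ω + 2 * y * B + y ^ 2 * c := by
    intro y
    simp only [sqNorm, noiseSum_snoc]
    have h1 := integral_add (hG.integrable_sq.add (hGA.const_mul (2 * y)))
      (hA.integrable_sq.const_mul (y ^ 2))
    have h2 := integral_add hG.integrable_sq (hGA.const_mul (2 * y))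
    simp only [Pi.add_apply, integral_const_mul] at h1 h2
    rw [h2] at h1
    rw [hB, hc, ← h1]
    exact integral_congr_ae (.of_forall fun x => by ring)
  refine ⟨B, c, rfl, ?_, hexp⟩
  -- Cauchy–Schwarz, read off from the nonnegativity of the new squared norm for every value `y` of
  -- the noise.
  have hd := discrim_le_zero (a := c) (b := 2 * B) (c := sqNorm D b a k ω) fun y => by
    have := sqNorm_nonneg (D := D) (b := b) (a := a) (k + 1) (Fin.snoc (α := fun _ => ℝ) ω y)
    rw [hexp] at this
    linarith
  rw [discrim] at hd
  linarith

/-- The Gaussian integral is explicit, with `d = 1 - 2 * c * v / u'`. Since `B ^ 2 ≤ Φ * c`, the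
resulting exponent is at most `Φ / (u' * d)`, and `u' * d ≥ u` because `u'` exceeds `u` by `2 * c₀ *
v`. Thus raising the scale by that amount in every round pays for the growth of the norm. -/
lemma lintegral_exp_sqNorm_step {v : ℝ≥0} (hv : v ≠ 0) {Φ B c c₀ u u' : ℝ} (hΦ : 0 ≤ Φ)
    (hc : 0 ≤ c) (hB : B ^ 2 ≤ Φ * c) (hcc : c ≤ c₀) (hu : 0 < u) (hu' : u' = u + 2 * c₀ * v) :
    ∫⁻ y, ENNReal.ofReal (Real.exp ((Φ + 2 * y * B + y ^ 2 * c) / u')) ∂gaussianReal 0 v ≤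
      ENNReal.ofReal (√(u' / u) * Real.exp (Φ / u)) := by
  have hv' : (0 : ℝ) < v := by positivity
  have hc0 : 0 ≤ c₀ := hc.trans hcc
  have hu'0 : 0 < u' := by rw [hu']; positivity
  have hd1 : u / u' ≤ 1 - 2 * (c / u') * v := by
    have h1 : 1 - 2 * (c / u') * v = (u' - 2 * c * v) / u' := by field_simp
    rw [h1]
    gcongr
    rw [hu']
    nlinarith [mul_le_mul_of_nonneg_right hcc hv'.le]
  have hd0 : 0 < 1 - 2 * (c / u') * v := (div_pos hu hu'0).trans_le hd1
  set d : ℝ≥0 := ⟨1 - 2 * (c / u') * v, hd0.le⟩ with hd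
  have hdv : (d : ℝ) = 1 - 2 * (c / u') * v := rfl
  have h1 : ∀ y : ℝ, ENNReal.ofReal (Real.exp ((Φ + 2 * y * B + y ^ 2 * c) / u')) =
      ENNReal.ofReal (Real.exp (Φ / u')) *
        ENNReal.ofReal (Real.exp (c / u' * y ^ 2 + 2 * B / u' * y)) := by
    intro y
    rw [← ENNReal.ofReal_mul (by positivity), ← Real.exp_add]
    congr 2
    ring
  simp_rw [h1]
  rw [lintegral_const_mul' _ _ ENNReal.ofReal_ne_top,
    lintegral_exp_quadratic_gaussianReal hv _ hdv (by intro h; rw [h] at hdv; simp at hdv; linarith),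
    ← ENNReal.ofReal_mul (by positivity)]
  refine ENNReal.ofReal_le_ofReal ?_
  rw [mul_left_comm, ← Real.exp_add]
  rw [← hdv] at hd0 hd1
  refine mul_le_mul ?_ (Real.exp_le_exp.2 ?_) (by positivity) (by positivity)
  · rw [← Real.sqrt_inv]
    refine Real.sqrt_le_sqrt ?_
    rw [← inv_div]
    exact inv_anti₀ (by positivity) hd1
  · have h2 : (2 * B / u') ^ 2 * v / (2 * d) ≤ 2 * (Φ * c) * v / (u' ^ 2 * d) := by
      have : (2 * B / u') ^ 2 * v / (2 * d) = 2 * B ^ 2 * v / (u' ^ 2 * d) := by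
        field_simp
      rw [this]
      gcongr
    have h3 : Φ / u' + 2 * (Φ * c) * v / (u' ^ 2 * d) = Φ / (u' * d) := by
      have h4 : 2 * c * v = u' * (1 - d) := by rw [hdv]; field_simp; ring
      have h5 : 2 * (Φ * c) * v = Φ * (u' * (1 - d)) := by rw [← h4]; ring
      rw [h5]
      field_simp
      ring
    have h6 : Φ / (u' * d) ≤ Φ / u := by
      gcongr
      rw [div_le_iff₀ hu'0] at hd1
      linarith
    linarith

/-- With the scale `U l = 2 * c₀ * v * (k + l)`, the exponential of the norm over `U l`, times `√(U
k / U l)`, is a supermartingale. The scale only doubles during the `k` rounds, whence the bound `√2`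
independent of `k`. -/
theorem lintegral_exp_sqNorm_le [SFinite D] {v : ℝ≥0} (hv : v ≠ 0) (hb : ∀ l, Measurable (b l))
    (ha : ∀ l, Measurable fun p : X × (Fin l → ℝ) => a l p.1 p.2)
    {k : ℕ} (hL : ∀ l < k, ∀ u, MemLp (fun x => a l x u) 2 D) (hk : 0 < k) {c₀ : ℝ} (hc₀ : 0 < c₀)
    (hc : ∀ l < k, ∀ u, ∫ x, a l x u ^ 2 ∂D ≤ c₀) :
    ∫⁻ ω, ENNReal.ofReal (Real.exp (sqNorm D b a k ω / (4 * c₀ * v * k)))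
        ∂(Measure.pi fun _ : Fin k => gaussianReal 0 v) ≤ ENNReal.ofReal √2 := by
  have hv' : (0 : ℝ) < v := by positivity
  have hk' : (0 : ℝ) < k := by exact_mod_cast hk
  set U : ℕ → ℝ := fun l => 2 * c₀ * v * (k + l) with hU
  have hUpos : ∀ l, 0 < U l := fun l => by positivity
  have hUk : U k = 4 * c₀ * v * k := by simp only [hU]; ring
  have h := lintegral_le_of_supermartingale (gaussianReal 0 v) k
    (fun l ω => ENNReal.ofReal (√(U k / U l) * Real.exp (sqNorm D b a l ω / U l)))
    (fun l => by
      have := measurable_sqNorm (D := D) hb ha l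
      fun_prop) ?_
  · have h0 : U k / U 0 = 2 := by
      rw [hUk]; simp only [hU]; field_simp; norm_num
    have h1 : U k / U k = 1 := div_self (hUpos k).ne'
    have h2 : sqNorm D b a 0 Fin.elim0 = 0 := by simp [sqNorm, noiseSum]
    rw [← hUk]
    simpa only [h0, h1, h2, Real.sqrt_one, one_mul, zero_div, Real.exp_zero, mul_one] using h
  · intro l hl ω
    obtain ⟨B, c, hcdef, hBc, hexp⟩ := sqNorm_snoc (D := D) (b := b) l
      (fun j hj => hL j (by omega)) ω
    have hc0 : 0 ≤ c := hcdef ▸ integral_nonneg fun _ => sq_nonneg _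
    simp only [hexp]
    simp_rw [ENNReal.ofReal_mul (Real.sqrt_nonneg _)]
    rw [lintegral_const_mul' _ _ ENNReal.ofReal_ne_top]
    refine (mul_le_mul_right (lintegral_exp_sqNorm_step hv (sqNorm_nonneg l ω) hc0 hBc
      (hcdef ▸ hc l hl _) (hUpos l) ?_) _).trans (le_of_eq ?_)
    · simp only [hU]; push_cast; ring
    · rw [ENNReal.ofReal_mul (Real.sqrt_nonneg _), ← mul_assoc,
        ← ENNReal.ofReal_mul (Real.sqrt_nonneg _), ← Real.sqrt_mul (by have := hUpos k; have := hUpos (l+1); positivity)]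
      congr 3
      have := (hUpos (l + 1)).ne'
      field_simp

end Hilbert

/-! ### Girsanov for the joint law of a data point and the responses. -/

section JointGirsanov

variable {X : Type*} [MeasurableSpace X] {D : Measure X}
  {b : (l : ℕ) → (Fin l → ℝ) → ℝ} {a : (l : ℕ) → X → (Fin l → ℝ) → ℝ}

/-- The law of the noise in a `k`-round interaction. -/
abbrev noiseLaw (v : ℝ≥0) (k : ℕ) : Measure (Fin k → ℝ) :=
  Measure.pi fun _ : Fin k => gaussianReal 0 v

lemma measurable_run_joint (hb : ∀ l, Measurable (b l))
    (ha : ∀ l, Measurable fun p : X × (Fin l → ℝ) => a l p.1 p.2) (k : ℕ) :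
    Measurable fun p : X × (Fin k → ℝ) => (p.1, adaptiveRun (fun l u => b l u + a l p.1 u) k p.2) :=
  measurable_fst.prodMk (measurable_adaptiveRun (m := fun l x u => b l u + a l x u)
    (fun l => ((hb l).comp measurable_snd).add (ha l)) k)

lemma measurable_run_base (hb : ∀ l, Measurable (b l)) (k : ℕ) :
    Measurable fun p : X × (Fin k → ℝ) => (p.1, adaptiveRun b k p.2) :=
  measurable_fst.prodMk ((measurable_adaptiveRun' hb k).comp measurable_snd)

lemma measurable_noiseSum_joint (hb : ∀ l, Measurable (b l))
    (ha : ∀ l, Measurable fun p : X × (Fin l → ℝ) => a l p.1 p.2) (k : ℕ) :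
    Measurable fun p : X × (Fin k → ℝ) => noiseSum b (fun l => a l p.1) k p.2 :=
  measurable_noiseSum (b := fun l _ => b l) (fun l => (hb l).comp measurable_snd) ha k

lemma measurable_energy_joint (hb : ∀ l, Measurable (b l))
    (ha : ∀ l, Measurable fun p : X × (Fin l → ℝ) => a l p.1 p.2) (k : ℕ) :
    Measurable fun p : X × (Fin k → ℝ) => energy b (fun l => a l p.1) k p.2 :=
  measurable_energy (b := fun l _ => b l) (fun l => (hb l).comp measurable_snd) ha k

lemma measurable_likelihood_joint (v : ℝ≥0) (hb : ∀ l, Measurable (b l))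
    (ha : ∀ l, Measurable fun p : X × (Fin l → ℝ) => a l p.1 p.2) (k : ℕ) :
    Measurable fun p : X × (Fin k → ℝ) => likelihood v b (fun l => a l p.1) k p.2 :=
  measurable_likelihood v (b := fun l _ => b l) (fun l => (hb l).comp measurable_snd) ha k

lemma lintegral_run_joint [SFinite D] {v : ℝ≥0} (hv : v ≠ 0) (hb : ∀ l, Measurable (b l))
    (ha : ∀ l, Measurable fun p : X × (Fin l → ℝ) => a l p.1 p.2) (k : ℕ)
    {F : X × (Fin k → ℝ) → ℝ≥0∞} (hF : Measurable F) :
    ∫⁻ p, F (p.1, adaptiveRun (fun l u => b l u + a l p.1 u) k p.2) ∂(D.prod (noiseLaw v k)) =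
      ∫⁻ p, F (p.1, adaptiveRun b k p.2) *
        ENNReal.ofReal (likelihood v b (fun l => a l p.1) k p.2) ∂(D.prod (noiseLaw v k)) := by
  rw [lintegral_prod (fun p => F (p.1, adaptiveRun _ k p.2))
      (hF.comp (measurable_run_joint hb ha k)).aemeasurable,
    lintegral_prod (fun p => F (p.1, adaptiveRun b k p.2) * _) ((hF.comp (measurable_run_base hb k)).mul
      (measurable_likelihood_joint v hb ha k).ennreal_ofReal).aemeasurable]
  exact lintegral_congr fun x => lintegral_adaptiveRun_add hv hb
    (fun l => (ha l).comp measurable_prodMk_left) k (hF.comp measurable_prodMk_left)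

/-- As an equality of laws, the change of measure transfers Bochner integrals with no integrability
assumption on the integrand. -/
lemma map_run_joint [IsProbabilityMeasure D] {v : ℝ≥0} (hv : v ≠ 0) (hb : ∀ l, Measurable (b l))
    (ha : ∀ l, Measurable fun p : X × (Fin l → ℝ) => a l p.1 p.2) (k : ℕ) :
    (D.prod (noiseLaw v k)).map
        (fun p => (p.1, adaptiveRun (fun l u => b l u + a l p.1 u) k p.2)) =
      ((D.prod (noiseLaw v k)).withDensity fun p =>
        ENNReal.ofReal (likelihood v b (fun l => a l p.1) k p.2)).map
          (fun p => (p.1, adaptiveRun b k p.2)) := by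
  have hlik := (measurable_likelihood_joint v hb ha k).ennreal_ofReal
  refine Measure.ext_of_lintegral _ fun f hf => ?_
  rw [lintegral_map hf (measurable_run_joint hb ha k), lintegral_map hf (measurable_run_base hb k),
    lintegral_withDensity_eq_lintegral_mul
      (g := fun p : X × (Fin k → ℝ) => f (p.1, adaptiveRun b k p.2)) _ hlik
      (hf.comp (measurable_run_base hb k)), lintegral_run_joint hv hb ha k hf]
  exact lintegral_congr fun ω => mul_comm _ _

lemma integral_run_joint [IsProbabilityMeasure D] {v : ℝ≥0} (hv : v ≠ 0) (hb : ∀ l, Measurable (b l))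
    (ha : ∀ l, Measurable fun p : X × (Fin l → ℝ) => a l p.1 p.2) (k : ℕ)
    {F : X × (Fin k → ℝ) → ℝ} (hF : Measurable F) :
    ∫ p, F (p.1, adaptiveRun (fun l u => b l u + a l p.1 u) k p.2) ∂(D.prod (noiseLaw v k)) =
      ∫ p, likelihood v b (fun l => a l p.1) k p.2 * F (p.1, adaptiveRun b k p.2)
        ∂(D.prod (noiseLaw v k)) := by
  have hlik := (measurable_likelihood_joint v hb ha k).ennreal_ofReal
  rw [← integral_map (φ := fun p : X × (Fin k → ℝ) =>
      (p.1, adaptiveRun (fun l u => b l u + a l p.1 u) k p.2))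
      (measurable_run_joint hb ha k).aemeasurable hF.aestronglyMeasurable,
    map_run_joint hv hb ha k,
    integral_map (measurable_run_base hb k).aemeasurable hF.aestronglyMeasurable,
    integral_withDensity_eq_integral_toReal_smul hlik (by simp)]
  simp [ENNReal.toReal_ofReal (likelihood_pos v k _).le]

lemma lintegral_likelihood_joint [IsProbabilityMeasure D] {v : ℝ≥0} (hv : v ≠ 0) (hb : ∀ l, Measurable (b l))
    (ha : ∀ l, Measurable fun p : X × (Fin l → ℝ) => a l p.1 p.2) (k : ℕ) :
    ∫⁻ p, ENNReal.ofReal (likelihood v b (fun l => a l p.1) k p.2) ∂(D.prod (noiseLaw v k)) =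
      1 := by
  simpa using (lintegral_run_joint (D := D) hv hb ha k (F := fun _ => 1) measurable_const).symm

lemma integrable_likelihood_joint [IsProbabilityMeasure D] {v : ℝ≥0} (hv : v ≠ 0) (hb : ∀ l, Measurable (b l))
    (ha : ∀ l, Measurable fun p : X × (Fin l → ℝ) => a l p.1 p.2) (k : ℕ) :
    Integrable (fun p : X × (Fin k → ℝ) => likelihood v b (fun l => a l p.1) k p.2)
      (D.prod (noiseLaw v k)) := by
  refine ⟨(measurable_likelihood_joint v hb ha k).aestronglyMeasurable, ?_⟩
  rw [hasFiniteIntegral_iff_ofReal (.of_forall fun p => (likelihood_pos v k _).le),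
    lintegral_likelihood_joint hv hb ha k]
  exact ENNReal.one_lt_top

/-- The probability of an event of the responses, as an integral over the base channel. -/
lemma measure_run_joint [IsProbabilityMeasure D] {v : ℝ≥0} (hv : v ≠ 0) (hb : ∀ l, Measurable (b l))
    (ha : ∀ l, Measurable fun p : X × (Fin l → ℝ) => a l p.1 p.2) (k : ℕ)
    {E : Set (Fin k → ℝ)} (hE : MeasurableSet E) :
    (D.prod (noiseLaw v k)) {p | adaptiveRun (fun l u => b l u + a l p.1 u) k p.2 ∈ E} =
      ∫⁻ ω in adaptiveRun b k ⁻¹' E, ∫⁻ x,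
        ENNReal.ofReal (likelihood v b (fun l => a l x) k ω) ∂D ∂(noiseLaw v k) := by
  have hrun := measurable_run_joint hb ha k
  have hS : MeasurableSet {p : X × (Fin k → ℝ) |
      adaptiveRun (fun l u => b l u + a l p.1 u) k p.2 ∈ E} := (measurable_snd.comp hrun) hE
  have hS' : MeasurableSet (adaptiveRun b k ⁻¹' E) := measurable_adaptiveRun' hb k hE
  have hlik := (measurable_likelihood_joint v hb ha k).ennreal_ofReal
  have h := lintegral_run_joint (D := D) hv hb ha k
    (F := fun q => E.indicator 1 q.2) ((measurable_one.indicator hE).comp measurable_snd)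
  have hmeas : Measurable fun p : X × (Fin k → ℝ) => E.indicator 1 (adaptiveRun b k p.2) *
        ENNReal.ofReal (likelihood v b (fun l => a l p.1) k p.2) :=
    ((measurable_one.indicator hE).comp (measurable_snd.comp (measurable_run_base hb k))).mul hlik
  rw [lintegral_prod_symm' _ hmeas] at h
  rw [← lintegral_indicator_one hS, ← lintegral_indicator hS']
  refine Eq.trans ?_ (h.trans (lintegral_congr fun ω => ?_))
  · rfl
  · by_cases hω : adaptiveRun b k ω ∈ E
    · simp [Set.indicator, hω]
    · simp [Set.indicator, hω]

end JointGirsanov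

/-! ### Two scalar inequalities. -/

section Elementary

/-- The device that localises moments: integrated over an event `S`, it bounds the integral of `y`
by `A` times the probability of `S` plus an exponential moment damped by `exp (-A - 1)`. With `A`
near `log (1 / β)` the last term is of order `β`. -/
lemma le_add_exp_sub (y A : ℝ) : y ≤ A + Real.exp (-A - 1) * Real.exp y := by
  rw [← Real.exp_add]
  have := Real.add_one_le_exp (-A - 1 + y)
  linarith

/-- For `g ≤ 2` the left side is quadratic in `g` and `w`: by the tangent line at `0`, and for
positive `g` by the chord of `exp` over `[0, 2]`. For `g > 2` the exponential term takes over, as `q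
* (g - 2) ≥ 0`. A large `q` makes the mean of that term negligible. -/
lemma exp_sub_one_sq_le (g : ℝ) {w : ℝ} (hw : 0 ≤ w) {q : ℝ} (hq : 0 ≤ q) :
    (Real.exp (g - w / 2) - 1) ^ 2 ≤
      31 * g ^ 2 + w ^ 2 + 3 * Real.exp ((q + 2) * g - 2 * q) := by
  set z := Real.exp (g - w / 2) with hz
  have hz0 : 0 < z := Real.exp_pos _
  have hzg : z ≤ Real.exp g := Real.exp_le_exp.2 (by linarith)
  have hlow : g - w / 2 ≤ z - 1 := by linarith [Real.add_one_le_exp (g - w / 2)]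
  have hpos := Real.exp_pos ((q + 2) * g - 2 * q)
  rcases le_or_gt g 2 with hg | hg
  · rcases le_or_gt g 0 with hg0 | hg0
    · have hz1 : z ≤ 1 := hzg.trans (Real.exp_le_one_iff.2 hg0)
      nlinarith [sq_nonneg (g + w / 2), sq_nonneg g]
    · have he : Real.exp 2 ≤ 7.4 := by
        have h1 := Real.exp_one_lt_d9
        have h2 : Real.exp 2 = Real.exp 1 ^ 2 := by rw [← Real.exp_nat_mul]; norm_num
        rw [h2]
        nlinarith [Real.exp_pos 1]
      have hconv : Real.exp g ≤ 1 + g / 2 * (Real.exp 2 - 1) := by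
        have h := convexOn_exp.2 (Set.mem_univ 0) (Set.mem_univ 2)
          (show 0 ≤ 1 - g / 2 by linarith) (show 0 ≤ g / 2 by linarith) (by ring)
        simp only [smul_eq_mul, mul_zero, zero_add, Real.exp_zero, mul_one] at h
        have h2 : g / 2 * 2 = g := by ring
        rw [h2] at h
        linarith
      have hup : z - 1 ≤ 3.2 * g := by nlinarith
      have hlow2 : -(w / 2) ≤ z - 1 := by linarith
      have h1 : (z - 1) ^ 2 ≤ (3.2 * g) ^ 2 + (w / 2) ^ 2 := by
        rcases le_or_gt 0 (z - 1) with h | h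
        · nlinarith [sq_nonneg w]
        · nlinarith [sq_nonneg g]
      nlinarith [sq_nonneg w, sq_nonneg g]
  · have h1 : z ^ 2 ≤ Real.exp ((q + 2) * g - 2 * q) := by
      calc z ^ 2 ≤ Real.exp g ^ 2 := pow_le_pow_left₀ hz0.le hzg 2
        _ = Real.exp (2 * g) := by rw [← Real.exp_nat_mul]; norm_num
        _ ≤ _ := Real.exp_le_exp.2 (by nlinarith)
    nlinarith [sq_nonneg w]

end Elementary

/-! ### Means over the data point; comparison of the base and true channels. -/

section Moments

variable {X : Type*} [MeasurableSpace X] {D : Measure X}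
  {b : (l : ℕ) → (Fin l → ℝ) → ℝ} {a : (l : ℕ) → X → (Fin l → ℝ) → ℝ}

lemma integral_noiseSum_eq_zero [IsProbabilityMeasure D] {k : ℕ} (hL : ∀ l < k, ∀ u, MemLp (fun x => a l x u) 2 D)
    (h0 : ∀ l < k, ∀ u, ∫ x, a l x u ∂D = 0) (ω : Fin k → ℝ) :
    ∫ x, noiseSum b (fun l => a l x) k ω ∂D = 0 := by
  simp only [noiseSum_eq_sum]
  rw [integral_finsetSum _ fun (i : Fin k) _ => ((hL i i.isLt _).integrable one_le_two).const_mul _]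
  refine Finset.sum_eq_zero fun i _ => ?_
  rw [integral_const_mul, h0 i i.isLt, mul_zero]

lemma integrable_energy {k : ℕ} (hL : ∀ l < k, ∀ u, MemLp (fun x => a l x u) 2 D)
    (ω : Fin k → ℝ) : Integrable (fun x => energy b (fun l => a l x) k ω) D := by
  simp only [energy_eq_sum]
  exact integrable_finsetSum _ fun i _ => (hL i i.isLt _).integrable_sq

lemma integral_energy_le {k : ℕ} (hL : ∀ l < k, ∀ u, MemLp (fun x => a l x u) 2 D) {c₀ : ℝ}
    (hc : ∀ l < k, ∀ u, ∫ x, a l x u ^ 2 ∂D ≤ c₀) (ω : Fin k → ℝ) :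
    ∫ x, energy b (fun l => a l x) k ω ∂D ≤ k * c₀ := by
  simp only [energy_eq_sum]
  rw [integral_finsetSum _ fun (i : Fin k) _ => (hL i i.isLt _).integrable_sq]
  refine (Finset.sum_le_sum fun (i : Fin k) _ => hc i i.isLt _).trans ?_
  simp

lemma energy_le_of_abs_le {k : ℕ} {Δ₀ : ℝ} {a : (l : ℕ) → (Fin l → ℝ) → ℝ}
    (hΔ : ∀ l < k, ∀ u, |a l u| ≤ Δ₀) (ω : Fin k → ℝ) : energy b a k ω ≤ k * Δ₀ ^ 2 := by
  rw [energy_eq_sum]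
  refine (Finset.sum_le_sum fun (i : Fin k) _ => sq_le_sq' (neg_le_of_abs_le (hΔ i i.isLt _))
    (le_of_abs_le (hΔ i i.isLt _))).trans ?_
  simp

lemma likelihood_eq (v : ℝ≥0) (b a : (l : ℕ) → (Fin l → ℝ) → ℝ) (k : ℕ) (ω : Fin k → ℝ) :
    likelihood v b a k ω =
      Real.exp (noiseSum b a k ω / v - energy b a k ω / v / 2) := by
  rw [likelihood]
  congr 1
  ring

/-- The mean likelihood over an independent sample is bounded below. -/
lemma le_lintegral_likelihood [IsProbabilityMeasure D] {v : ℝ≥0} (hb : ∀ l, Measurable (b l))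
    (ha : ∀ l, Measurable fun p : X × (Fin l → ℝ) => a l p.1 p.2) {k : ℕ}
    (hL : ∀ l < k, ∀ u, MemLp (fun x => a l x u) 2 D)
    (h0 : ∀ l < k, ∀ u, ∫ x, a l x u ∂D = 0) {c₀ : ℝ}
    (hc : ∀ l < k, ∀ u, ∫ x, a l x u ^ 2 ∂D ≤ c₀) (ω : Fin k → ℝ) :
    ENNReal.ofReal (Real.exp (-(k * c₀ / v) / 2)) ≤
      ∫⁻ x, ENNReal.ofReal (likelihood v b (fun l => a l x) k ω) ∂D := by
  by_cases hfin : ∫⁻ x, ENNReal.ofReal (likelihood v b (fun l => a l x) k ω) ∂D = ∞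
  · rw [hfin]; exact le_top
  have hW : Integrable (fun x => likelihood v b (fun l => a l x) k ω) D := by
    refine ⟨((measurable_likelihood_joint v hb ha k).comp
      measurable_prodMk_right).aestronglyMeasurable, ?_⟩
    rw [hasFiniteIntegral_iff_ofReal (.of_forall fun x => (likelihood_pos v k _).le)]
    exact lt_top_iff_ne_top.2 hfin
  rw [← ofReal_integral_eq_lintegral_ofReal hW (.of_forall fun x => (likelihood_pos v k _).le)]
  refine ENNReal.ofReal_le_ofReal ?_
  set S := k * c₀ / (v : ℝ) with hS
  have hG : Integrable (fun x => noiseSum b (fun l => a l x) k ω) D :=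
    (memLp_noiseSum k hL ω).integrable one_le_two
  have hV := integrable_energy (b := b) hL ω
  have hint : ∫ x, (1 + S / 2 + noiseSum b (fun l => a l x) k ω / v -
      energy b (fun l => a l x) k ω / v / 2) ∂D =
      1 + S / 2 - (∫ x, energy b (fun l => a l x) k ω ∂D) / v / 2 := by
    have e1 := integral_sub (((integrable_const (1 + S / 2)).add (hG.div_const v)))
      ((hV.div_const v).div_const 2)
    have e2 := integral_add (integrable_const (1 + S / 2)) (hG.div_const v)
    simp only [Pi.add_apply] at e1 e2
    rw [e1, e2, integral_div, integral_div, integral_div, integral_noiseSum_eq_zero hL h0]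
    simp
  have hle : (∫ x, energy b (fun l => a l x) k ω ∂D) / v ≤ S :=
    div_le_div_of_nonneg_right (integral_energy_le hL hc ω) v.coe_nonneg
  -- Jensen by hand: the tangent line of `exp` at `-S / 2` is integrated; the stochastic integral
  -- has mean zero and the normalised energy has mean at most `S`.
  calc Real.exp (-S / 2) = Real.exp (-S / 2) * 1 := (mul_one _).symm
    _ ≤ Real.exp (-S / 2) * ∫ x, (1 + S / 2 + noiseSum b (fun l => a l x) k ω / v -
          energy b (fun l => a l x) k ω / v / 2) ∂D := by
        gcongr
        rw [hint]
        linarith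
    _ ≤ ∫ x, likelihood v b (fun l => a l x) k ω ∂D := by
        rw [← integral_const_mul]
        refine integral_mono ((((integrable_const _).add (hG.div_const _)).sub
          ((hV.div_const _).div_const _)).const_mul _) hW fun x => ?_
        simp only
        rw [likelihood_eq]
        have h1 := Real.add_one_le_exp (noiseSum b (fun l => a l x) k ω / v -
          energy b (fun l => a l x) k ω / v / 2 + S / 2)
        calc _ ≤ Real.exp (-S / 2) * Real.exp (noiseSum b (fun l => a l x) k ω / v -
              energy b (fun l => a l x) k ω / v / 2 + S / 2) := by
              gcongr
              linarith
          _ = _ := by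
              rw [← Real.exp_add]
              congr 1
              ring

/-- Averaging the lower bound on the mean likelihood over the responses: an event that is likely in
the auxiliary base channel is likely in the real interaction. -/
lemma measure_base_le [IsProbabilityMeasure D] {v : ℝ≥0} (hv : v ≠ 0) (hb : ∀ l, Measurable (b l))
    (ha : ∀ l, Measurable fun p : X × (Fin l → ℝ) => a l p.1 p.2) {k : ℕ}
    (hL : ∀ l < k, ∀ u, MemLp (fun x => a l x u) 2 D)
    (h0 : ∀ l < k, ∀ u, ∫ x, a l x u ∂D = 0) {c₀ : ℝ}
    (hc : ∀ l < k, ∀ u, ∫ x, a l x u ^ 2 ∂D ≤ c₀) {E : Set (Fin k → ℝ)} (hE : MeasurableSet E) :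
    ENNReal.ofReal (Real.exp (-(k * c₀ / v) / 2)) * noiseLaw v k (adaptiveRun b k ⁻¹' E) ≤
      (D.prod (noiseLaw v k)) {p | adaptiveRun (fun l u => b l u + a l p.1 u) k p.2 ∈ E} := by
  rw [measure_run_joint hv hb ha k hE, ← setLIntegral_const]
  exact lintegral_mono fun ω => le_lintegral_likelihood hb ha hL h0 hc ω

end Moments

/-! ### Bounded queries: second moment of the likelihood and mean of a later query. -/

section Bounded

variable {X : Type*} [MeasurableSpace X] {D : Measure X} [IsProbabilityMeasure D]
  {b : (l : ℕ) → (Fin l → ℝ) → ℝ} {a : (l : ℕ) → X → (Fin l → ℝ) → ℝ}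

/-- `le_add_exp_sub` applied to the squared norm on the scale on which its exponential moment is at
most `√2`. -/
lemma setLIntegral_sqNorm_le {v : ℝ≥0} (hv : v ≠ 0) (hb : ∀ l, Measurable (b l))
    (ha : ∀ l, Measurable fun p : X × (Fin l → ℝ) => a l p.1 p.2) {k : ℕ} (hk : 0 < k)
    (hL : ∀ l < k, ∀ u, MemLp (fun x => a l x u) 2 D) {c₀ : ℝ} (hc₀ : 0 < c₀)
    (hc : ∀ l < k, ∀ u, ∫ x, a l x u ^ 2 ∂D ≤ c₀) (S : Set (Fin k → ℝ)) {A : ℝ} (hA : 0 ≤ A) :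
    ∫⁻ ω in S, ENNReal.ofReal (sqNorm D b a k ω / v ^ 2) ∂(noiseLaw v k) ≤
      ENNReal.ofReal (4 * (k * c₀ / v) * A) * noiseLaw v k S +
        ENNReal.ofReal (4 * (k * c₀ / v) * (Real.exp (-A - 1) * √2)) := by
  have hv' : (0 : ℝ) < v := by positivity
  have hk' : (0 : ℝ) < k := by exact_mod_cast hk
  set T := 4 * (k * c₀ / (v : ℝ)) with hT
  have hT0 : 0 ≤ T := by positivity
  have hmeas := measurable_sqNorm (D := D) hb ha k
  have h1 : ∀ ω, ENNReal.ofReal (sqNorm D b a k ω / v ^ 2) ≤ ENNReal.ofReal (T * A) +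
      ENNReal.ofReal (T * Real.exp (-A - 1)) *
        ENNReal.ofReal (Real.exp (sqNorm D b a k ω / (4 * c₀ * v * k))) := by
    intro ω
    rw [← ENNReal.ofReal_mul (by positivity), ← ENNReal.ofReal_add (by positivity) (by positivity)]
    refine ENNReal.ofReal_le_ofReal ?_
    have h2 : sqNorm D b a k ω / v ^ 2 = T * (sqNorm D b a k ω / (4 * c₀ * v * k)) := by
      rw [hT]; field_simp
    rw [h2]
    have := mul_le_mul_of_nonneg_left
      (le_add_exp_sub (sqNorm D b a k ω / (4 * c₀ * v * k)) A) hT0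
    linarith
  calc _ ≤ ∫⁻ ω in S, (ENNReal.ofReal (T * A) + ENNReal.ofReal (T * Real.exp (-A - 1)) *
        ENNReal.ofReal (Real.exp (sqNorm D b a k ω / (4 * c₀ * v * k)))) ∂(noiseLaw v k) :=
        lintegral_mono h1
    _ = ENNReal.ofReal (T * A) * noiseLaw v k S + ENNReal.ofReal (T * Real.exp (-A - 1)) *
        ∫⁻ ω in S, ENNReal.ofReal (Real.exp (sqNorm D b a k ω / (4 * c₀ * v * k)))
          ∂(noiseLaw v k) := by
        rw [lintegral_add_left measurable_const, setLIntegral_const,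
          lintegral_const_mul' _ _ ENNReal.ofReal_ne_top]
    _ ≤ _ := by
        gcongr
        rw [← mul_assoc T, ENNReal.ofReal_mul (p := T * Real.exp (-A - 1)) (by positivity)]
        gcongr
        exact (setLIntegral_le_lintegral _ _).trans
          (lintegral_exp_sqNorm_le hv hb ha hL hk hc₀ hc)

/-- `exp_sub_one_sq_le` is applied with `g` the normalised stochastic integral and `w` the
normalised energy. Integrated over `x`, the term `g ^ 2` becomes the squared `L²(D)` norm. One
factor of `w ^ 2` is bounded through `Δ₀` and the other through the second moment `c₀`. The
exponential term is not localised to `S`, its mean being already small. -/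
lemma setLIntegral_likelihood_sub_one_sq_le {v : ℝ≥0} (hv : v ≠ 0) (hb : ∀ l, Measurable (b l))
    (ha : ∀ l, Measurable fun p : X × (Fin l → ℝ) => a l p.1 p.2) {k : ℕ} (hk : 0 < k)
    {Δ₀ : ℝ} (hΔ : ∀ l < k, ∀ u x, |a l x u| ≤ Δ₀) {c₀ : ℝ} (hc₀ : 0 < c₀)
    (hc : ∀ l < k, ∀ u, ∫ x, a l x u ^ 2 ∂D ≤ c₀) {S : Set (Fin k → ℝ)}
    {A q : ℝ} (hA : 0 ≤ A) (hq : 0 ≤ q) :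
    ∫⁻ ω in S, ∫⁻ x, ENNReal.ofReal ((likelihood v b (fun l => a l x) k ω - 1) ^ 2) ∂D
        ∂(noiseLaw v k) ≤
      ENNReal.ofReal (124 * (k * c₀ / v) * A + k * Δ₀ ^ 2 / v * (k * c₀ / v)) * noiseLaw v k S +
        ENNReal.ofReal (124 * (k * c₀ / v) * (Real.exp (-A - 1) * √2) +
          3 * Real.exp (-2 * q + (q + 2) ^ 2 * (k * Δ₀ ^ 2 / v) / 2)) := by
  have hv' : (0 : ℝ) < v := by positivity
  have hk' : (0 : ℝ) < k := by exact_mod_cast hk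
  set s := k * c₀ / (v : ℝ) with hs
  set Vm := k * Δ₀ ^ 2 / (v : ℝ) with hVm
  have hs0 : 0 ≤ s := by positivity
  have hVm0 : 0 ≤ Vm := by positivity
  have hL : ∀ l < k, ∀ u, MemLp (fun x => a l x u) 2 D := fun l hl u =>
    MemLp.of_bound ((ha l).comp measurable_prodMk_right).aestronglyMeasurable Δ₀
      (.of_forall fun x => hΔ l hl u x)
  have hmN := measurable_noiseSum_joint hb ha k
  have hmE := measurable_energy_joint hb ha k
  have hEn : ∀ x ω, energy b (fun l => a l x) k ω / v ≤ Vm := fun x ω =>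
    div_le_div_of_nonneg_right (energy_le_of_abs_le (fun l hl u => hΔ l hl u x) ω) hv'.le
  have hEn0 : ∀ x ω, 0 ≤ energy b (fun l => a l x) k ω / v := fun x ω =>
    div_nonneg (energy_nonneg _ _ k ω) hv'.le
  -- the tail term
  have htail : ∫⁻ ω, ∫⁻ x, ENNReal.ofReal
      (Real.exp ((q + 2) * (noiseSum b (fun l => a l x) k ω / v) - 2 * q)) ∂D ∂(noiseLaw v k) ≤
      ENNReal.ofReal (Real.exp (-2 * q + (q + 2) ^ 2 * Vm / 2)) := by
    rw [lintegral_lintegral_swap]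
    · calc _ ≤ ∫⁻ _ : X, ENNReal.ofReal (Real.exp (-2 * q + (q + 2) ^ 2 * Vm / 2)) ∂D := by
            refine lintegral_mono fun x => ?_
            have h := lintegral_exp_noiseSum_le hv hb
              (fun l => (ha l).comp (measurable_prodMk_left (x := x))) k (hEn x) (q + 2)
            calc _ = ∫⁻ ω, ENNReal.ofReal (Real.exp (-2 * q)) * ENNReal.ofReal
                  (Real.exp ((q + 2) * (noiseSum b (fun l => a l x) k ω / v)))
                  ∂(noiseLaw v k) := by
                  refine lintegral_congr fun ω => ?_
                  rw [← ENNReal.ofReal_mul (by positivity), ← Real.exp_add]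
                  congr 2
                  ring
              _ ≤ _ := by
                  rw [lintegral_const_mul' _ _ ENNReal.ofReal_ne_top, Real.exp_add,
                    ENNReal.ofReal_mul (by positivity)]
                  gcongr
                  exact h
        _ = _ := by simp
    · refine Measurable.aemeasurable ?_
      refine (Real.measurable_exp.comp (((hmN.comp measurable_swap).div_const _).const_mul _
        |>.sub_const _)).ennreal_ofReal
  -- the inner integral
  have hinner : ∀ ω, ∫⁻ x, ENNReal.ofReal ((likelihood v b (fun l => a l x) k ω - 1) ^ 2) ∂D ≤
      31 * ENNReal.ofReal (sqNorm D b a k ω / v ^ 2) + ENNReal.ofReal (Vm * s) +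
        3 * ∫⁻ x, ENNReal.ofReal
          (Real.exp ((q + 2) * (noiseSum b (fun l => a l x) k ω / v) - 2 * q)) ∂D := by
    intro ω
    have hG2 := (memLp_noiseSum (D := D) (b := b) k hL ω).integrable_sq
    have hV := integrable_energy (D := D) (b := b) hL ω
    have e1 : ∫⁻ x, ENNReal.ofReal ((noiseSum b (fun l => a l x) k ω / v) ^ 2) ∂D =
        ENNReal.ofReal (sqNorm D b a k ω / v ^ 2) := by
      rw [sqNorm, ← integral_div, ofReal_integral_eq_lintegral_ofReal (hG2.div_const _)
        (.of_forall fun x => by positivity)]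
      exact lintegral_congr fun x => by rw [div_pow]
    have e2 : ∫⁻ x, ENNReal.ofReal (Vm * (energy b (fun l => a l x) k ω / v)) ∂D ≤
        ENNReal.ofReal (Vm * s) := by
      rw [← ofReal_integral_eq_lintegral_ofReal ((hV.div_const _).const_mul _)
        (.of_forall fun x => mul_nonneg hVm0 (hEn0 x ω)), integral_const_mul, integral_div]
      refine ENNReal.ofReal_le_ofReal ?_
      exact mul_le_mul_of_nonneg_left
        (div_le_div_of_nonneg_right (integral_energy_le hL hc ω) hv'.le) hVm0
    have hmNω : Measurable fun x => noiseSum b (fun l => a l x) k ω :=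
      hmN.comp measurable_prodMk_right
    have hmEω : Measurable fun x => energy b (fun l => a l x) k ω :=
      hmE.comp measurable_prodMk_right
    calc _ ≤ ∫⁻ x, (31 * ENNReal.ofReal ((noiseSum b (fun l => a l x) k ω / v) ^ 2) +
          ENNReal.ofReal (Vm * (energy b (fun l => a l x) k ω / v)) + 3 * ENNReal.ofReal
          (Real.exp ((q + 2) * (noiseSum b (fun l => a l x) k ω / v) - 2 * q))) ∂D := by
          refine lintegral_mono fun x => ?_
          have h31 : (31 : ℝ≥0∞) = ENNReal.ofReal 31 := by norm_num
          have h3 : (3 : ℝ≥0∞) = ENNReal.ofReal 3 := by norm_num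
          have hw := hEn0 x ω
          rw [h31, h3, ← ENNReal.ofReal_mul (by norm_num), ← ENNReal.ofReal_mul (by norm_num),
            ← ENNReal.ofReal_add (by positivity) (by positivity),
            ← ENNReal.ofReal_add (by positivity) (by positivity)]
          refine ENNReal.ofReal_le_ofReal ?_
          rw [likelihood_eq]
          refine (exp_sub_one_sq_le _ hw hq).trans ?_
          have := mul_le_mul_of_nonneg_right (hEn x ω) hw
          nlinarith
      _ = 31 * ENNReal.ofReal (sqNorm D b a k ω / v ^ 2) +
          ∫⁻ x, ENNReal.ofReal (Vm * (energy b (fun l => a l x) k ω / v)) ∂D +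
          3 * ∫⁻ x, ENNReal.ofReal
            (Real.exp ((q + 2) * (noiseSum b (fun l => a l x) k ω / v) - 2 * q)) ∂D := by
          rw [lintegral_add_left (by fun_prop), lintegral_add_left (by fun_prop),
            lintegral_const_mul' _ _ (by simp), lintegral_const_mul' _ _ (by simp), e1]
      _ ≤ _ := by gcongr
  have hmS := measurable_sqNorm (D := D) hb ha k
  calc _ ≤ ∫⁻ ω in S, (31 * ENNReal.ofReal (sqNorm D b a k ω / v ^ 2) + ENNReal.ofReal (Vm * s) +
        3 * ∫⁻ x, ENNReal.ofReal
          (Real.exp ((q + 2) * (noiseSum b (fun l => a l x) k ω / v) - 2 * q)) ∂D)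
            ∂(noiseLaw v k) := lintegral_mono hinner
    _ = 31 * ∫⁻ ω in S, ENNReal.ofReal (sqNorm D b a k ω / v ^ 2) ∂(noiseLaw v k) +
        ENNReal.ofReal (Vm * s) * noiseLaw v k S +
        3 * ∫⁻ ω in S, ∫⁻ x, ENNReal.ofReal
          (Real.exp ((q + 2) * (noiseSum b (fun l => a l x) k ω / v) - 2 * q)) ∂D
            ∂(noiseLaw v k) := by
        rw [lintegral_add_left (by fun_prop), lintegral_add_left (by fun_prop),
          lintegral_const_mul' _ _ (by simp), lintegral_const_mul' _ _ (by simp),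
          setLIntegral_const]
    _ ≤ 31 * (ENNReal.ofReal (4 * s * A) * noiseLaw v k S +
          ENNReal.ofReal (4 * s * (Real.exp (-A - 1) * √2))) +
        ENNReal.ofReal (Vm * s) * noiseLaw v k S +
        3 * ENNReal.ofReal (Real.exp (-2 * q + (q + 2) ^ 2 * Vm / 2)) := by
        gcongr
        · exact setLIntegral_sqNorm_le hv hb ha hk hL hc₀ hc S hA
        · exact (setLIntegral_le_lintegral _ _).trans htail
    _ = _ := by
        have h31 : (31 : ℝ≥0∞) = ENNReal.ofReal 31 := by norm_num
        have h3 : (3 : ℝ≥0∞) = ENNReal.ofReal 3 := by norm_num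
        rw [h31, h3, mul_add, ← mul_assoc, ← ENNReal.ofReal_mul (by norm_num),
          ← ENNReal.ofReal_mul (by norm_num), ← ENNReal.ofReal_mul (by norm_num),
          ENNReal.ofReal_add (by positivity) (by positivity),
          ENNReal.ofReal_add (by positivity) (by positivity), add_mul]
        have r1 : 31 * (4 * s * A) = 124 * s * A := by ring
        have r2 : 31 * (4 * s * (Real.exp (-A - 1) * √2)) =
          124 * s * (Real.exp (-A - 1) * √2) := by ring
        rw [r1, r2]
        ring

/-- The mean of a centred bounded query issued after an event of the responses, on an element of
the dataset. -/
lemma integral_le_of_bounded {v : ℝ≥0} (hv : v ≠ 0) (hb : ∀ l, Measurable (b l))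
    (ha : ∀ l, Measurable fun p : X × (Fin l → ℝ) => a l p.1 p.2) {k : ℕ} (hk : 0 < k)
    {Δ₀ : ℝ} (hΔ : ∀ l < k, ∀ u x, |a l x u| ≤ Δ₀) {c₀ : ℝ} (hc₀ : 0 < c₀)
    (hc : ∀ l < k, ∀ u, ∫ x, a l x u ^ 2 ∂D ≤ c₀) {E : Set (Fin k → ℝ)} (hE : MeasurableSet E)
    {f : X × (Fin k → ℝ) → ℝ} (hf : Measurable f) {Δ σ : ℝ} (hfΔ : ∀ p, |f p| ≤ Δ)
    (hf0 : ∀ u, ∫ x, f (x, u) ∂D = 0) (hfσ : ∀ u, ∫ x, f (x, u) ^ 2 ∂D ≤ σ ^ 2)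
    (hfE : ∀ u ∉ E, ∀ x, f (x, u) = 0)
    {A q θ : ℝ} (hA : 0 ≤ A) (hq : 0 ≤ q) (hθ : 0 < θ) :
    ∫ p, f (p.1, adaptiveRun (fun l u => b l u + a l p.1 u) k p.2) ∂(D.prod (noiseLaw v k)) ≤
      (θ * σ ^ 2 / 2 + (124 * (k * c₀ / v) * A + k * Δ₀ ^ 2 / v * (k * c₀ / v)) / (2 * θ)) *
          (noiseLaw v k).real (adaptiveRun b k ⁻¹' E) +
        (124 * (k * c₀ / v) * (Real.exp (-A - 1) * √2) +
          3 * Real.exp (-2 * q + (q + 2) ^ 2 * (k * Δ₀ ^ 2 / v) / 2)) / (2 * θ) := by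
  have hv' : (0 : ℝ) < v := by positivity
  set B₁ := 124 * (k * c₀ / (v : ℝ)) * A + k * Δ₀ ^ 2 / v * (k * c₀ / v) with hB₁
  set B₂ := 124 * (k * c₀ / (v : ℝ)) * (Real.exp (-A - 1) * √2) +
          3 * Real.exp (-2 * q + (q + 2) ^ 2 * (k * Δ₀ ^ 2 / v) / 2) with hB₂
  have hB₁0 : 0 ≤ B₁ := by positivity
  have hB₂0 : 0 ≤ B₂ := by positivity
  set S := adaptiveRun b k ⁻¹' E with hS
  have hSm : MeasurableSet S := measurable_adaptiveRun' hb k hE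
  set W : X × (Fin k → ℝ) → ℝ := fun p => likelihood v b (fun l => a l p.1) k p.2 with hW
  have hWm : Measurable W := measurable_likelihood_joint v hb ha k
  set h : X × (Fin k → ℝ) → ℝ := fun p => f (p.1, adaptiveRun b k p.2) with hh
  have hhm : Measurable h := hf.comp (measurable_run_base hb k)
  have hWint : Integrable W (D.prod (noiseLaw v k)) := integrable_likelihood_joint hv hb ha k
  have hhint : Integrable h (D.prod (noiseLaw v k)) :=
    Integrable.of_bound hhm.aestronglyMeasurable Δ (.of_forall fun p => hfΔ _)
  have hWh : Integrable (fun p => W p * h p) (D.prod (noiseLaw v k)) :=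
    hWint.mul_bdd (c := Δ) hhm.aestronglyMeasurable (.of_forall fun p => hfΔ _)
  -- In the base channel the responses are independent of `x`, and `f` is centred in `x` for all
  -- fixed responses.
  have hh0 : ∫ p, h p ∂(D.prod (noiseLaw v k)) = 0 := by
    rw [integral_prod_symm _ hhint]
    simp only [hh, hf0, integral_zero]
  rw [integral_run_joint hv hb ha k hf]
  have hsub : ∫ p, W p * h p ∂(D.prod (noiseLaw v k)) =
      ∫ p, (W p - 1) * h p ∂(D.prod (noiseLaw v k)) := by
    rw [← sub_zero (∫ p, W p * h p ∂(D.prod (noiseLaw v k))), ← hh0, ← integral_sub hWh hhint]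
    exact integral_congr_ae (.of_forall fun p => by ring)
  have hbound : ∫⁻ p, ENNReal.ofReal ‖(W p - 1) * h p‖ ∂(D.prod (noiseLaw v k)) ≤
      ENNReal.ofReal (θ * σ ^ 2 / 2 + B₁ / (2 * θ)) * noiseLaw v k S +
        ENNReal.ofReal (B₂ / (2 * θ)) := by
    rw [lintegral_prod_symm' (fun p => ENNReal.ofReal ‖(W p - 1) * h p‖) (((hWm.sub_const 1).mul
      hhm).norm.ennreal_ofReal)]
    -- The query vanishes when the responses lie outside `E`, so only `S` contributes.
    calc _ = ∫⁻ ω in S, ∫⁻ x, ENNReal.ofReal ‖(W (x, ω) - 1) * h (x, ω)‖ ∂D ∂(noiseLaw v k) := by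
          refine (setLIntegral_eq_of_support_subset fun ω hω => ?_).symm
          by_contra hωS
          refine hω ?_
          have : ∀ x, h (x, ω) = 0 := fun x => hfE _ hωS x
          simp [this]
      _ ≤ ∫⁻ ω in S, (ENNReal.ofReal (θ * σ ^ 2 / 2) + ENNReal.ofReal (1 / (2 * θ)) *
            ∫⁻ x, ENNReal.ofReal ((likelihood v b (fun l => a l x) k ω - 1) ^ 2) ∂D)
              ∂(noiseLaw v k) := by
          refine lintegral_mono fun ω => ?_
          have hhω : Measurable fun x => h (x, ω) := hhm.comp measurable_prodMk_right
          have hh2 : Integrable (fun x => h (x, ω) ^ 2) D :=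
            (MemLp.of_bound (p := 2) hhω.aestronglyMeasurable Δ
              (.of_forall fun x => hfΔ _)).integrable_sq
          calc _ ≤ ∫⁻ x, (ENNReal.ofReal (θ / 2 * h (x, ω) ^ 2) + ENNReal.ofReal (1 / (2 * θ)) *
                ENNReal.ofReal ((likelihood v b (fun l => a l x) k ω - 1) ^ 2)) ∂D := by
                refine lintegral_mono fun x => ?_
                rw [← ENNReal.ofReal_mul (by positivity),
                  ← ENNReal.ofReal_add (by positivity) (by positivity)]
                refine ENNReal.ofReal_le_ofReal ?_
                change ‖(W (x, ω) - 1) * h (x, ω)‖ ≤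
                  θ / 2 * h (x, ω) ^ 2 + 1 / (2 * θ) * (W (x, ω) - 1) ^ 2
                rw [norm_mul, Real.norm_eq_abs, Real.norm_eq_abs, ← sq_abs (h (x, ω)),
                  ← sq_abs (W (x, ω) - 1)]
                set y := |W (x, ω) - 1|
                set z := |h (x, ω)|
                -- Young's inequality with weight `θ`.
                have h1 : 0 ≤ (θ * z - y) ^ 2 / (2 * θ) := by positivity
                have h2 : (θ * z - y) ^ 2 / (2 * θ) =
                    θ / 2 * z ^ 2 + 1 / (2 * θ) * y ^ 2 - y * z := by
                  field_simp
                  ring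
                linarith
            _ ≤ _ := by
                rw [lintegral_add_left (by fun_prop),
                  lintegral_const_mul' _ _ ENNReal.ofReal_ne_top,
                  ← ofReal_integral_eq_lintegral_ofReal (hh2.const_mul _)
                    (.of_forall fun x => by positivity), integral_const_mul]
                gcongr
                have := mul_le_mul_of_nonneg_left (hfσ (adaptiveRun b k ω))
                  (show 0 ≤ θ / 2 by positivity)
                calc _ ≤ _ := this
                  _ = _ := by ring
      _ = ENNReal.ofReal (θ * σ ^ 2 / 2) * noiseLaw v k S + ENNReal.ofReal (1 / (2 * θ)) *
            ∫⁻ ω in S, ∫⁻ x, ENNReal.ofReal ((likelihood v b (fun l => a l x) k ω - 1) ^ 2) ∂D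
              ∂(noiseLaw v k) := by
          rw [lintegral_add_left measurable_const, setLIntegral_const,
            lintegral_const_mul' _ _ ENNReal.ofReal_ne_top]
      _ ≤ ENNReal.ofReal (θ * σ ^ 2 / 2) * noiseLaw v k S + ENNReal.ofReal (1 / (2 * θ)) *
            (ENNReal.ofReal B₁ * noiseLaw v k S + ENNReal.ofReal B₂) := by
          gcongr
          exact setLIntegral_likelihood_sub_one_sq_le hv hb ha hk hΔ hc₀ hc hA hq
      _ = _ := by
          rw [mul_add, ← mul_assoc, ← ENNReal.ofReal_mul (by positivity),
            ← ENNReal.ofReal_mul (by positivity), ENNReal.ofReal_add (by positivity)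
              (by positivity), add_mul]
          have r1 : 1 / (2 * θ) * B₁ = B₁ / (2 * θ) := by ring
          have r2 : 1 / (2 * θ) * B₂ = B₂ / (2 * θ) := by ring
          rw [r1, r2]
          ring
  calc _ = ∫ p, (W p - 1) * h p ∂(D.prod (noiseLaw v k)) := hsub
    _ ≤ ‖∫ p, (W p - 1) * h p ∂(D.prod (noiseLaw v k))‖ := Real.le_norm_self _
    _ ≤ ENNReal.toReal (∫⁻ p, ENNReal.ofReal ‖(W p - 1) * h p‖ ∂(D.prod (noiseLaw v k))) :=
        norm_integral_le_lintegral_norm _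
    _ ≤ ENNReal.toReal (ENNReal.ofReal (θ * σ ^ 2 / 2 + B₁ / (2 * θ)) * noiseLaw v k S +
        ENNReal.ofReal (B₂ / (2 * θ))) := by
        refine ENNReal.toReal_mono ?_ hbound
        exact ENNReal.add_ne_top.2 ⟨ENNReal.mul_ne_top ENNReal.ofReal_ne_top
          (measure_ne_top _ _), ENNReal.ofReal_ne_top⟩
    _ = _ := by
        rw [ENNReal.toReal_add (ENNReal.mul_ne_top ENNReal.ofReal_ne_top
          (measure_ne_top _ _)) ENNReal.ofReal_ne_top, ENNReal.toReal_mul,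
          ENNReal.toReal_ofReal (by positivity), ENNReal.toReal_ofReal (by positivity),
          Measure.real]

end Bounded

/-! ### The Gibbs variational principle for an unnormalised density. -/

section ExponentialTilting

variable {X : Type*} [MeasurableSpace X] {D : Measure X}

/-- The inequality `1 + x ≤ exp x` at `x = y - log z + log Z`: the pointwise Fenchel–Young
inequality behind the variational formula for the relative entropy of `z / Z`. -/
lemma mul_sub_le_exp {z Z g S y : ℝ} (hz : 0 < z) (hZ : 0 < Z) (hg : Real.log z ≤ g)
    (hS : -S ≤ Real.log Z) : z * (y - g - S + 1) ≤ Z * Real.exp y := by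
  have h1 := Real.add_one_le_exp (y - Real.log z + Real.log Z)
  have h2 : Real.exp (y - Real.log z + Real.log Z) = Real.exp y / z * Z := by
    rw [Real.exp_add, Real.exp_sub, Real.exp_log hz, Real.exp_log hZ]
  rw [h2] at h1
  calc z * (y - g - S + 1) ≤ z * (Real.exp y / z * Z) := by
        refine mul_le_mul_of_nonneg_left ?_ hz.le
        linarith
    _ = Z * Real.exp y := by field_simp

/-- The mean of `f` under the tilting of `D` by `z`, bounded by means of the Gibbs variational
principle. -/
lemma integral_tilted_le {z g f : X → ℝ} {S Γ K r : ℝ} (hzpos : ∀ x, 0 < z x)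
    (hzg : ∀ x, Real.log (z x) ≤ g x) (hz : Integrable z D)
    (hZ : Real.exp (-S) ≤ ∫ x, z x ∂D)
    (hzgi : Integrable (fun x => z x * g x) D) (hzf : Integrable (fun x => z x * f x) D)
    (hgi : Integrable (fun x => Real.exp (2 * g x)) D)
    (hg : ∫ x, Real.exp (2 * g x) ∂D ≤ Real.exp Γ)
    (hfi : Integrable (fun x => Real.exp (r * f x)) D)
    (hf : ∫ x, Real.exp (r * f x) ∂D ≤ Real.exp K) :
    r * ∫ x, z x * f x ∂D ≤ (K + Γ + 2 * S) * ∫ x, z x ∂D := by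
  set Z := ∫ x, z x ∂D
  have hZpos : 0 < Z := (Real.exp_pos _).trans_le hZ
  have hlogZ : -S ≤ Real.log Z := by rwa [Real.le_log_iff_exp_le hZpos]
  -- Test function `2 * g - Γ`. The factor `2` leaves one copy of `g` after subtracting the entropy,
  -- so the tilted mean of `g` is at most `Γ + S`.
  have h1 : ∫ x, (z x * g x + (-Γ - S + 1) * z x) ∂D ≤
      ∫ x, Z * Real.exp (-Γ) * Real.exp (2 * g x) ∂D := by
    refine integral_mono (hzgi.add (hz.const_mul _)) (hgi.const_mul _) fun x => ?_
    have := mul_sub_le_exp (y := 2 * g x - Γ) (hzpos x) hZpos (hzg x) hlogZ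
    rw [Real.exp_sub, div_eq_mul_inv, ← Real.exp_neg] at this
    simp only
    linarith
  -- Test function `r * f - K`. The entropy of the tilting is at most the tilted mean of `g` plus
  -- `S`, hence at most `Γ + 2 * S`.
  have h2 : ∫ x, (r * (z x * f x) - z x * g x + (-K - S + 1) * z x) ∂D ≤
      ∫ x, Z * Real.exp (-K) * Real.exp (r * f x) ∂D := by
    refine integral_mono (((hzf.const_mul r).sub hzgi).add (hz.const_mul _)) (hfi.const_mul _)
      fun x => ?_
    have := mul_sub_le_exp (y := r * f x - K) (hzpos x) hZpos (hzg x) hlogZ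
    rw [Real.exp_sub, div_eq_mul_inv, ← Real.exp_neg] at this
    simp only
    linarith
  have e1 := integral_add hzgi (hz.const_mul (-Γ - S + 1))
  have e2 := integral_add ((hzf.const_mul r).sub hzgi) (hz.const_mul (-K - S + 1))
  have e3 := integral_sub (hzf.const_mul r) hzgi
  simp only [Pi.sub_apply, integral_const_mul] at e1 e2 e3
  rw [e1, integral_const_mul] at h1
  rw [e2, e3, integral_const_mul] at h2
  have h3 : Z * Real.exp (-Γ) * ∫ x, Real.exp (2 * g x) ∂D ≤ Z := by
    calc _ ≤ Z * Real.exp (-Γ) * Real.exp Γ := by gcongr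
      _ = Z := by rw [mul_assoc, ← Real.exp_add]; simp
  have h4 : Z * Real.exp (-K) * ∫ x, Real.exp (r * f x) ∂D ≤ Z := by
    calc _ ≤ Z * Real.exp (-K) * Real.exp K := by gcongr
      _ = Z := by rw [mul_assoc, ← Real.exp_add]; simp
  change _ + (-Γ - S + 1) * Z ≤ _ at h1
  change _ + (-K - S + 1) * Z ≤ _ at h2
  linarith

lemma abs_le_exp_add_exp_neg (y : ℝ) : |y| ≤ Real.exp y + Real.exp (-y) := by
  have h1 := Real.add_one_le_exp y
  have h2 := Real.add_one_le_exp (-y)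
  have h3 := Real.exp_pos y
  have h4 := Real.exp_pos (-y)
  rcases abs_cases y with ⟨h, _⟩ | ⟨h, _⟩ <;> rw [h] <;> linarith

/-- The right side is `4 * sinh (y / 2) ^ 2`. -/
lemma sq_le_exp_add_exp_neg (y : ℝ) : y ^ 2 ≤ Real.exp y + Real.exp (-y) - 2 := by
  have h1 : ∀ x : ℝ, x ^ 2 ≤ Real.sinh x ^ 2 := fun x => by
    rcases le_total 0 x with h | h
    · exact pow_le_pow_left₀ h (Real.self_le_sinh_iff.2 h) 2
    · have := pow_le_pow_left₀ (neg_nonneg.2 h) (Real.self_le_sinh_iff.2 (neg_nonneg.2 h)) 2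
      rwa [Real.sinh_neg, neg_sq, neg_sq] at this
  have h2 : Real.exp y + Real.exp (-y) = 2 * Real.cosh (2 * (y / 2)) := by
    rw [Real.cosh_eq]
    ring_nf
  rw [h2, Real.cosh_two_mul, Real.cosh_sq]
  linarith [h1 (y / 2)]

end ExponentialTilting

/-! ### Moments and exponential moments from the sub-Gaussian condition. -/

section SubGaussian

variable {X : Type*} [MeasurableSpace X] {D : Measure X}

lemma memLp_of_integrable_exp {f : X → ℝ} (hf : Measurable f)
    (hexp : ∀ t : ℝ, Integrable (fun x => Real.exp (t * f x)) D) : MemLp f 2 D := by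
  rw [memLp_two_iff_integrable_sq hf.aestronglyMeasurable]
  refine Integrable.mono' ((hexp 1).add (hexp (-1))) (hf.pow_const 2).aestronglyMeasurable
    (.of_forall fun x => ?_)
  have := sq_le_exp_add_exp_neg (f x)
  simp only [Pi.add_apply, one_mul, neg_mul, Real.norm_eq_abs, abs_sq]
  linarith

/-- The bound on the exponential moment has no linear term in `t`, while the moment is at least one
plus `t` times the mean; a small positive `t` rules out a positive mean. With the same argument for
`-f`, sub-Gaussian queries turn out to be centred. -/
lemma integral_le_zero_of_exp_le [IsProbabilityMeasure D] {f : X → ℝ} (hf : Integrable f D) {τ : ℝ}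
    (hexp : ∀ t : ℝ, Integrable (fun x => Real.exp (t * f x)) D ∧
      ∫ x, Real.exp (t * f x) ∂D ≤ Real.exp (t ^ 2 * τ ^ 2)) : ∫ x, f x ∂D ≤ 0 := by
  by_contra! hpos
  set m := ∫ x, f x ∂D
  have key : ∀ t : ℝ, 1 + t * m ≤ Real.exp (t ^ 2 * τ ^ 2) := by
    intro t
    refine le_trans ?_ (hexp t).2
    have h1 : ∫ x, (1 + t * f x) ∂D = 1 + t * m := by
      rw [integral_add (integrable_const _) (hf.const_mul _), integral_const_mul]
      simp [m]
    rw [← h1]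
    refine integral_mono ((integrable_const _).add (hf.const_mul _)) (hexp t).1 fun x => ?_
    have := Real.add_one_le_exp (t * f x)
    simp only
    linarith
  -- The first bound keeps `t ^ 2 * τ ^ 2 ≤ 1`, where `exp` is at most `1 + 2 * x`; the second makes
  -- the quadratic term smaller than the linear one.
  set t := min (1 / (|τ| + 1)) (m / (4 * (τ ^ 2 + 1))) with ht
  have ht0 : 0 < t := by rw [ht]; positivity
  have h1 : t ^ 2 * τ ^ 2 ≤ 1 := by
    have h2 : t * |τ| ≤ 1 := by
      calc t * |τ| ≤ 1 / (|τ| + 1) * |τ| := by gcongr; exact min_le_left _ _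
        _ ≤ 1 := by
          rw [div_mul_eq_mul_div, one_mul, div_le_one (by positivity)]
          linarith
    rw [← sq_abs τ, ← mul_pow]
    exact pow_le_one₀ (by positivity) h2
  have h3 : Real.exp (t ^ 2 * τ ^ 2) ≤ 1 + 2 * (t ^ 2 * τ ^ 2) := by
    have h := Real.abs_exp_sub_one_le (x := t ^ 2 * τ ^ 2)
      (by rw [abs_of_nonneg (by positivity)]; exact h1)
    rw [abs_of_nonneg (a := t ^ 2 * τ ^ 2) (by positivity)] at h
    linarith [le_abs_self (Real.exp (t ^ 2 * τ ^ 2) - 1)]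
  have h4 : t * m ≤ t * (2 * (t * τ ^ 2)) := by nlinarith [key t]
  have h5 : m ≤ 2 * (t * τ ^ 2) := le_of_mul_le_mul_left h4 ht0
  have h6 : t * (4 * (τ ^ 2 + 1)) ≤ m := by
    rw [← le_div_iff₀ (by positivity)]; exact min_le_right _ _
  nlinarith [sq_nonneg τ]

lemma integral_eq_zero_of_exp_le [IsProbabilityMeasure D] {f : X → ℝ} (hf : Integrable f D) {τ : ℝ}
    (hexp : ∀ t : ℝ, Integrable (fun x => Real.exp (t * f x)) D ∧
      ∫ x, Real.exp (t * f x) ∂D ≤ Real.exp (t ^ 2 * τ ^ 2)) : ∫ x, f x ∂D = 0 := by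
  refine le_antisymm (integral_le_zero_of_exp_le hf hexp) ?_
  have h := integral_le_zero_of_exp_le (f := fun x => -f x) hf.neg (τ := τ) fun t => by
    have := hexp (-t)
    simpa using this
  rw [integral_neg] at h
  linarith

/-- The square is dominated by the exponentials at `t = 1 / τ` and `t = -1 / τ`, each of mean at
most `e`; finally `2 * e - 2 ≤ 4`. -/
lemma integral_sq_le_of_exp_le [IsProbabilityMeasure D] {f : X → ℝ} (hf : MemLp f 2 D) {τ : ℝ} (hτ : 0 < τ)
    (hexp : ∀ t : ℝ, Integrable (fun x => Real.exp (t * f x)) D ∧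
      ∫ x, Real.exp (t * f x) ∂D ≤ Real.exp (t ^ 2 * τ ^ 2)) : ∫ x, f x ^ 2 ∂D ≤ 4 * τ ^ 2 := by
  have h1 := hexp τ⁻¹
  have h2 := hexp (-τ⁻¹)
  have e1 : τ⁻¹ ^ 2 * τ ^ 2 = 1 := by field_simp
  rw [neg_sq, e1] at h2
  rw [e1] at h1
  have h3 : ∫ x, f x ^ 2 ∂D ≤ ∫ x, τ ^ 2 * (Real.exp (τ⁻¹ * f x) + Real.exp (-τ⁻¹ * f x) - 2) ∂D := by
    refine integral_mono hf.integrable_sq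
      (((h1.1.add h2.1).sub (integrable_const 2)).const_mul _) fun x => ?_
    have h := sq_le_exp_add_exp_neg (τ⁻¹ * f x)
    rw [neg_mul]
    calc f x ^ 2 = τ ^ 2 * (τ⁻¹ * f x) ^ 2 := by field_simp
      _ ≤ _ := by gcongr
  have e2 := integral_sub (h1.1.add h2.1) (integrable_const (2 : ℝ))
  have e3 := integral_add h1.1 h2.1
  simp only [Pi.add_apply] at e2 e3
  rw [integral_const_mul, e2, e3] at h3
  simp only [integral_const, probReal_univ, smul_eq_mul, one_mul] at h3
  have he := Real.exp_one_lt_d9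
  refine h3.trans ?_
  rw [mul_comm]
  gcongr
  linarith [h1.2, h2.2]

variable {b : (l : ℕ) → (Fin l → ℝ) → ℝ} {a : (l : ℕ) → X → (Fin l → ℝ) → ℝ}

/-- The linear combinations of the increments `a` issued along any sequence of responses have
sub-Gaussian exponential moments. -/
def HasSubGaussianIncrements (D : Measure X) (a : (l : ℕ) → X → (Fin l → ℝ) → ℝ) (k : ℕ)
    (τ : ℝ) : Prop :=
  ∀ u w : Fin k → ℝ,
    Integrable (fun x => Real.exp (∑ i, w i * a i x fun j => u (Fin.castLE i.isLt.le j))) D ∧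
      ∫ x, Real.exp (∑ i, w i * a i x fun j => u (Fin.castLE i.isLt.le j)) ∂D ≤
        Real.exp (τ ^ 2 * ∑ i, w i ^ 2)

lemma HasSubGaussianIncrements.increment {k : ℕ} {τ : ℝ}
    (h : HasSubGaussianIncrements D a k τ) {l : ℕ} (hl : l < k) (u : Fin l → ℝ) (t : ℝ) :
    Integrable (fun x => Real.exp (t * a l x u)) D ∧
      ∫ x, Real.exp (t * a l x u) ∂D ≤ Real.exp (t ^ 2 * τ ^ 2) := by
  -- A history of `l` responses is padded with zeros; the query with index `l` does not see the
  -- padding.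
  obtain ⟨u', rfl⟩ : ∃ u' : Fin k → ℝ, u = fun j => u' (Fin.castLE hl.le j) :=
    ⟨fun j => if h : (j : ℕ) < l then u ⟨j, h⟩ else 0, by ext j; simp⟩
  have h1 := h u' (Pi.single ⟨l, hl⟩ t)
  have h2 : ∀ x, ∑ i : Fin k, (Pi.single ⟨l, hl⟩ t : Fin k → ℝ) i *
      a i x (fun j => u' (Fin.castLE i.isLt.le j)) =
        t * a l x (fun j => u' (Fin.castLE hl.le j)) := by
    intro x
    rw [Finset.sum_eq_single (⟨l, hl⟩ : Fin k)]
    · simp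
    · intro i _ hi
      simp [hi]
    · simp
  have h3 : ∑ i : Fin k, (Pi.single ⟨l, hl⟩ t : Fin k → ℝ) i ^ 2 = t ^ 2 := by
    rw [Finset.sum_eq_single (⟨l, hl⟩ : Fin k)]
    · simp
    · intro i _ hi
      simp [hi]
    · simp
  simp only [h2, h3] at h1
  rwa [mul_comm (τ ^ 2)] at h1

lemma HasSubGaussianIncrements.memLp {k : ℕ} {τ : ℝ} (h : HasSubGaussianIncrements D a k τ)
    (ha : ∀ l, Measurable fun p : X × (Fin l → ℝ) => a l p.1 p.2) :
    ∀ l < k, ∀ u, MemLp (fun x => a l x u) 2 D := fun l hl u =>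
  memLp_of_integrable_exp ((ha l).comp measurable_prodMk_right) fun t => (h.increment hl u t).1

lemma HasSubGaussianIncrements.integral_eq_zero [IsProbabilityMeasure D] {k : ℕ} {τ : ℝ}
    (h : HasSubGaussianIncrements D a k τ)
    (ha : ∀ l, Measurable fun p : X × (Fin l → ℝ) => a l p.1 p.2) :
    ∀ l < k, ∀ u, ∫ x, a l x u ∂D = 0 := fun l hl u =>
  integral_eq_zero_of_exp_le ((h.memLp ha l hl u).integrable one_le_two)
    fun t => h.increment hl u t

lemma HasSubGaussianIncrements.integral_sq_le [IsProbabilityMeasure D] {k : ℕ} {τ : ℝ} (hτ : 0 < τ)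
    (h : HasSubGaussianIncrements D a k τ)
    (ha : ∀ l, Measurable fun p : X × (Fin l → ℝ) => a l p.1 p.2) :
    ∀ l < k, ∀ u, ∫ x, a l x u ^ 2 ∂D ≤ 4 * τ ^ 2 := fun l hl u =>
  integral_sq_le_of_exp_le (h.memLp ha l hl u) hτ fun t => h.increment hl u t

/-- The exponential moments of the stochastic integral plus a combination of the increments. -/
lemma HasSubGaussianIncrements.exp_noiseSum {k : ℕ} {τ : ℝ}
    (h : HasSubGaussianIncrements D a k τ) (v : ℝ≥0) (t : ℝ) (e : Fin k → ℝ) (ω : Fin k → ℝ) :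
    Integrable (fun x => Real.exp (t * (noiseSum b (fun l => a l x) k ω / v) +
      ∑ i, e i * a i x fun j => adaptiveRun b k ω (Fin.castLE i.isLt.le j))) D ∧
    ∫ x, Real.exp (t * (noiseSum b (fun l => a l x) k ω / v) +
      ∑ i, e i * a i x fun j => adaptiveRun b k ω (Fin.castLE i.isLt.le j)) ∂D ≤
        Real.exp (τ ^ 2 * ∑ i, (t * ω i / v + e i) ^ 2) := by
  have h1 := h (adaptiveRun b k ω) fun i => t * ω i / v + e i
  have h2 : ∀ x, t * (noiseSum b (fun l => a l x) k ω / v) +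
      ∑ i, e i * a i x (fun j => adaptiveRun b k ω (Fin.castLE i.isLt.le j)) =
      ∑ i, (t * ω i / v + e i) * a i x fun j => adaptiveRun b k ω (Fin.castLE i.isLt.le j) := by
    intro x
    rw [noiseSum_eq_sum, Finset.sum_div, Finset.mul_sum, ← Finset.sum_add_distrib]
    exact Finset.sum_congr rfl fun i _ => by ring
  simp only [h2]
  exact h1

/-- The stochastic integral and the combination share one sub-Gaussian vector with coefficients `ω i
/ v + e i`; separating the two parts by `(x + y) ^ 2 ≤ 2 * x ^ 2 + 2 * y ^ 2` costs the factor `2`.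
-/
lemma HasSubGaussianIncrements.lintegral_exp_noiseSum_le {k : ℕ} {τ : ℝ}
    (h : HasSubGaussianIncrements D a k τ) (v : ℝ≥0) {e : Fin k → ℝ} {e₀ : ℝ}
    (he : ∑ i, e i ^ 2 ≤ e₀) (ω : Fin k → ℝ) :
    ∫⁻ x, ENNReal.ofReal (Real.exp (noiseSum b (fun l => a l x) k ω / v +
      ∑ i, e i * a i x fun j => adaptiveRun b k ω (Fin.castLE i.isLt.le j))) ∂D ≤
        ENNReal.ofReal (Real.exp (2 * τ ^ 2 * e₀) *
          Real.exp (2 * τ ^ 2 / v ^ 2 * ∑ i, ω i ^ 2)) := by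
  have h1 := h.exp_noiseSum (b := b) v 1 e ω
  simp only [one_mul] at h1
  rw [← ofReal_integral_eq_lintegral_ofReal h1.1 (.of_forall fun x => (Real.exp_pos _).le)]
  refine ENNReal.ofReal_le_ofReal (h1.2.trans ?_)
  rw [← Real.exp_add, Real.exp_le_exp]
  have h2 : ∑ i, (ω i / v + e i) ^ 2 ≤ 2 / v ^ 2 * ∑ i, ω i ^ 2 + 2 * ∑ i, e i ^ 2 := by
    rw [Finset.mul_sum, Finset.mul_sum, ← Finset.sum_add_distrib]
    refine Finset.sum_le_sum fun i _ => ?_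
    have : 2 / (v : ℝ) ^ 2 * ω i ^ 2 = 2 * (ω i / v) ^ 2 := by rw [div_pow]; ring
    rw [this]
    nlinarith [sq_nonneg (ω i / v - e i)]
  calc τ ^ 2 * ∑ i, (ω i / v + e i) ^ 2
      ≤ τ ^ 2 * (2 / v ^ 2 * ∑ i, ω i ^ 2 + 2 * e₀) := by gcongr; linarith
    _ = _ := by ring

end SubGaussian

/-! ### Sub-Gaussian queries: mean of a later query. -/

section SubGaussian

variable {X : Type*} [MeasurableSpace X] {D : Measure X}
  {b : (l : ℕ) → (Fin l → ℝ) → ℝ} {a : (l : ℕ) → X → (Fin l → ℝ) → ℝ}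

/-- The linear combination with coefficients `e u` of the increments issued along `u`. -/
def combination {k : ℕ} (a : (l : ℕ) → X → (Fin l → ℝ) → ℝ) (e : (Fin k → ℝ) → Fin k → ℝ)
    (p : X × (Fin k → ℝ)) : ℝ :=
  ∑ i, e p.2 i * a i p.1 fun j => p.2 (Fin.castLE i.isLt.le j)

lemma measurable_combination {k : ℕ}
    (ha : ∀ l, Measurable fun p : X × (Fin l → ℝ) => a l p.1 p.2)
    {e : (Fin k → ℝ) → Fin k → ℝ} (he : Measurable e) : Measurable (combination a e) := by
  refine Finset.measurable_sum _ fun i _ => ?_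
  refine ((measurable_pi_apply i).comp (he.comp measurable_snd)).mul
    ((ha i).comp (measurable_fst.prodMk ?_))
  exact measurable_pi_iff.2 fun j => (measurable_pi_apply _).comp measurable_snd

lemma inv_sqrt_half_pow_le (k : ℕ) :
    (√((1 / 2 : ℝ≥0) : ℝ))⁻¹ ^ k ≤ Real.exp (k / 2) := by
  have h1 : (√((1 / 2 : ℝ≥0) : ℝ))⁻¹ ≤ Real.exp (1 / 2) := by
    rw [← Real.sqrt_inv, Real.sqrt_le_left (Real.exp_pos _).le, ← Real.exp_nat_mul]
    have := Real.exp_one_gt_d9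
    norm_num
    linarith
  calc _ ≤ Real.exp (1 / 2) ^ k := pow_le_pow_left₀ (by positivity) h1 k
    _ = _ := by rw [← Real.exp_nat_mul]; congr 1; ring

/-- At the coefficient `1 / (4 * v)` each round contributes `√2`, which is at most `exp (1 / 2)`. -/
lemma lintegral_exp_quarter_sum_sq {v : ℝ≥0} (hv : v ≠ 0) {s : ℝ} (hs : s ≤ 1 / (4 * v))
    (k : ℕ) : ∫⁻ ω, ENNReal.ofReal (Real.exp (s * ∑ i, ω i ^ 2)) ∂(noiseLaw v k) ≤
      ENNReal.ofReal (Real.exp (k / 2)) := by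
  have hv' : (0 : ℝ) < v := by positivity
  have h := lintegral_exp_sum_sq hv (s := 1 / (4 * v)) (d := 1 / 2)
    (by push_cast; field_simp; norm_num) (by norm_num) k
  refine le_trans (lintegral_mono fun ω => ENNReal.ofReal_le_ofReal (Real.exp_le_exp.2 ?_))
    (h.trans (ENNReal.ofReal_le_ofReal (inv_sqrt_half_pow_le k)))
  have : 0 ≤ ∑ i, ω i ^ 2 := Finset.sum_nonneg fun i _ => sq_nonneg _
  gcongr

variable {k : ℕ} {τ : ℝ} {v : ℝ≥0}

lemma likelihood_le_exp (v : ℝ≥0) (b a : (l : ℕ) → (Fin l → ℝ) → ℝ) (k : ℕ) (ω : Fin k → ℝ) :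
    likelihood v b a k ω ≤ Real.exp (noiseSum b a k ω / v) := by
  rw [likelihood_eq, Real.exp_le_exp]
  have := div_nonneg (energy_nonneg b a k ω) v.coe_nonneg
  linarith

/-- The likelihood is at most the exponential of the normalised stochastic integral, and `|y| ≤ exp
y + exp (-y)`. This crude bound serves for integrability only. -/
lemma HasSubGaussianIncrements.lintegral_likelihood_mul_le (h : HasSubGaussianIncrements D a k τ)
    {e : (Fin k → ℝ) → Fin k → ℝ} {e₀ : ℝ} (he : ∀ u, ∑ i, e u i ^ 2 ≤ e₀) (ω : Fin k → ℝ) :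
    ∫⁻ x, ENNReal.ofReal (likelihood v b (fun l => a l x) k ω *
        |combination a e (x, adaptiveRun b k ω)|) ∂D ≤
      ENNReal.ofReal (2 * (Real.exp (2 * τ ^ 2 * e₀) *
        Real.exp (2 * τ ^ 2 / v ^ 2 * ∑ i, ω i ^ 2))) := by
  set u := adaptiveRun b k ω
  have h1 := h.lintegral_exp_noiseSum_le (b := b) v (he u) ω
  have h2 := h.lintegral_exp_noiseSum_le (b := b) v (e := fun i => -e u i) (e₀ := e₀)
    (by simpa using he u) ω
  have hi := (h.exp_noiseSum (b := b) v 1 (e u) ω).1.aestronglyMeasurable.aemeasurable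
  simp only [one_mul] at hi
  calc _ ≤ ∫⁻ x, (ENNReal.ofReal (Real.exp (noiseSum b (fun l => a l x) k ω / v +
        ∑ i, e u i * a i x fun j => u (Fin.castLE i.isLt.le j))) +
        ENNReal.ofReal (Real.exp (noiseSum b (fun l => a l x) k ω / v +
        ∑ i, -e u i * a i x fun j => u (Fin.castLE i.isLt.le j)))) ∂D := by
        refine lintegral_mono fun x => ?_
        rw [← ENNReal.ofReal_add (Real.exp_pos _).le (Real.exp_pos _).le]
        refine ENNReal.ofReal_le_ofReal ?_
        have h3 := abs_le_exp_add_exp_neg (combination a e (x, u))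
        simp only [combination] at h3
        simp only [neg_mul, Finset.sum_neg_distrib, Real.exp_add, ← mul_add]
        exact mul_le_mul (likelihood_le_exp _ _ _ _ _) h3 (abs_nonneg _) (Real.exp_pos _).le
    _ ≤ _ := by
        rw [lintegral_add_left' hi.ennreal_ofReal, two_mul, ENNReal.ofReal_add (by positivity)
          (by positivity)]
        exact add_le_add h1 h2

/-- The first absolute moment of a combination of the increments, under the true law. -/
lemma HasSubGaussianIncrements.lintegral_combination_le [IsProbabilityMeasure D] (hv : v ≠ 0) (hb : ∀ l, Measurable (b l))
    (ha : ∀ l, Measurable fun p : X × (Fin l → ℝ) => a l p.1 p.2)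
    (h : HasSubGaussianIncrements D a k τ) (hτv : τ ^ 2 / v ≤ 1 / 8)
    {e : (Fin k → ℝ) → Fin k → ℝ} (hem : Measurable e) {e₀ : ℝ}
    (he : ∀ u, ∑ i, e u i ^ 2 ≤ e₀) :
    ∫⁻ p, ENNReal.ofReal (likelihood v b (fun l => a l p.1) k p.2 *
        |combination a e (p.1, adaptiveRun b k p.2)|) ∂(D.prod (noiseLaw v k)) ≤
      ENNReal.ofReal (2 * Real.exp (2 * τ ^ 2 * e₀) * Real.exp (k / 2)) := by
  have hv' : (0 : ℝ) < v := by positivity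
  have hcm := measurable_combination ha hem
  have hmeas : Measurable fun p : X × (Fin k → ℝ) =>
      ENNReal.ofReal (likelihood v b (fun l => a l p.1) k p.2 *
        |combination a e (p.1, adaptiveRun b k p.2)|) :=
    ((measurable_likelihood_joint v hb ha k).mul
      (hcm.comp (measurable_run_base hb k)).norm).ennreal_ofReal
  rw [lintegral_prod_symm' _ hmeas]
  calc _ ≤ ∫⁻ ω, ENNReal.ofReal (2 * Real.exp (2 * τ ^ 2 * e₀)) *
        ENNReal.ofReal (Real.exp (2 * τ ^ 2 / v ^ 2 * ∑ i, ω i ^ 2)) ∂(noiseLaw v k) := by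
        refine lintegral_mono fun ω => (h.lintegral_likelihood_mul_le he ω).trans (le_of_eq ?_)
        rw [← ENNReal.ofReal_mul (by positivity)]
        congr 1
        ring
    _ ≤ _ := by
        rw [lintegral_const_mul' _ _ ENNReal.ofReal_ne_top,
          ENNReal.ofReal_mul (p := 2 * Real.exp (2 * τ ^ 2 * e₀)) (by positivity)]
        gcongr
        refine lintegral_exp_quarter_sum_sq hv ?_ k
        have : 2 * τ ^ 2 / (v : ℝ) ^ 2 = 2 * (τ ^ 2 / v) / v := by field_simp
        rw [this, show 1 / (4 * (v : ℝ)) = 2 * (1 / 8) / v by field_simp; norm_num]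
        gcongr

/-- `le_add_exp_sub` for the squared length of the noise, weighted by the mean likelihood. That
weight is itself at most an exponential of the squared length, and `τ ^ 2 / v ≤ 1 / 16` keeps the
total coefficient within `1 / (4 * v)`. -/
lemma HasSubGaussianIncrements.setLIntegral_sum_sq_le [IsProbabilityMeasure D] (hv : v ≠ 0) (hb : ∀ l, Measurable (b l))
    (ha : ∀ l, Measurable fun p : X × (Fin l → ℝ) => a l p.1 p.2)
    (h : HasSubGaussianIncrements D a k τ) (hτv : τ ^ 2 / v ≤ 1 / 16)
    {A : ℝ} (hA : 0 ≤ A) (S : Set (Fin k → ℝ)) :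
    ∫⁻ ω in S, ENNReal.ofReal ((∑ i, ω i ^ 2) / (8 * v)) *
        ∫⁻ x, ENNReal.ofReal (likelihood v b (fun l => a l x) k ω) ∂D ∂(noiseLaw v k) ≤
      ENNReal.ofReal A * (∫⁻ ω in S, ∫⁻ x, ENNReal.ofReal (likelihood v b (fun l => a l x) k ω) ∂D
        ∂(noiseLaw v k)) + ENNReal.ofReal (Real.exp (-A - 1 + k / 2)) := by
  have hv' : (0 : ℝ) < v := by positivity
  have hm : Measurable fun ω => ∫⁻ x, ENNReal.ofReal (likelihood v b (fun l => a l x) k ω) ∂D :=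
    Measurable.lintegral_prod_left' (f := fun p : X × (Fin k → ℝ) =>
      ENNReal.ofReal (likelihood v b (fun l => a l p.1) k p.2))
      (measurable_likelihood_joint v hb ha k).ennreal_ofReal
  have hZ : ∀ ω, ∫⁻ x, ENNReal.ofReal (likelihood v b (fun l => a l x) k ω) ∂D ≤
      ENNReal.ofReal (Real.exp (2 * τ ^ 2 / v ^ 2 * ∑ i, ω i ^ 2)) := by
    intro ω
    have h1 := h.lintegral_exp_noiseSum_le (b := b) v (e := fun _ => 0) (e₀ := 0) (by simp) ω
    simp only [zero_mul, Finset.sum_const_zero, add_zero, mul_zero, Real.exp_zero, one_mul] at h1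
    exact (lintegral_mono fun x => ENNReal.ofReal_le_ofReal (likelihood_le_exp _ _ _ _ _)).trans h1
  calc _ ≤ ∫⁻ ω in S, (ENNReal.ofReal A *
          ∫⁻ x, ENNReal.ofReal (likelihood v b (fun l => a l x) k ω) ∂D +
        ENNReal.ofReal (Real.exp (-A - 1)) * ENNReal.ofReal
          (Real.exp ((1 / (8 * v) + 2 * τ ^ 2 / v ^ 2) * ∑ i, ω i ^ 2))) ∂(noiseLaw v k) := by
        refine lintegral_mono fun ω => ?_
        have hy : ENNReal.ofReal ((∑ i, ω i ^ 2) / (8 * v)) ≤ ENNReal.ofReal A +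
            ENNReal.ofReal (Real.exp (-A - 1)) *
              ENNReal.ofReal (Real.exp ((∑ i, ω i ^ 2) / (8 * v))) := by
          rw [← ENNReal.ofReal_mul (by positivity),
            ← ENNReal.ofReal_add (by positivity) (by positivity)]
          exact ENNReal.ofReal_le_ofReal (le_add_exp_sub _ A)
        refine (mul_le_mul_left hy _).trans ?_
        rw [add_mul]
        refine add_le_add le_rfl ?_
        refine (mul_le_mul_right (hZ ω) _).trans (le_of_eq ?_)
        rw [mul_assoc, ← ENNReal.ofReal_mul (p := Real.exp _) (by positivity), ← Real.exp_add]
        congr 3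
        ring
    _ = ENNReal.ofReal A * (∫⁻ ω in S, ∫⁻ x,
          ENNReal.ofReal (likelihood v b (fun l => a l x) k ω) ∂D ∂(noiseLaw v k)) +
        ENNReal.ofReal (Real.exp (-A - 1)) * ∫⁻ ω in S, ENNReal.ofReal
          (Real.exp ((1 / (8 * v) + 2 * τ ^ 2 / v ^ 2) * ∑ i, ω i ^ 2)) ∂(noiseLaw v k) := by
        rw [lintegral_add_left (hm.const_mul _), lintegral_const_mul' _ _ ENNReal.ofReal_ne_top,
          lintegral_const_mul' _ _ ENNReal.ofReal_ne_top]
    _ ≤ _ := by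
        gcongr
        rw [Real.exp_add, ENNReal.ofReal_mul (by positivity)]
        gcongr
        refine (setLIntegral_le_lintegral _ _).trans (lintegral_exp_quarter_sum_sq hv ?_ k)
        have : 2 * τ ^ 2 / (v : ℝ) ^ 2 = 2 * (τ ^ 2 / v) / v := by field_simp
        rw [this, show 1 / (4 * (v : ℝ)) = 1 / (8 * v) + 2 * (1 / 16) / v by field_simp; norm_num]
        gcongr

/-- The conditional mean of a combination of the increments, given the responses. -/
lemma HasSubGaussianIncrements.integral_likelihood_mul_le [IsProbabilityMeasure D] (hv : v ≠ 0)
    (hb : ∀ l, Measurable (b l))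
    (ha : ∀ l, Measurable fun p : X × (Fin l → ℝ) => a l p.1 p.2) (hτ : 0 < τ)
    (h : HasSubGaussianIncrements D a k τ)
    {e : (Fin k → ℝ) → Fin k → ℝ} (hem : Measurable e) {e₀ : ℝ}
    (he : ∀ u, ∑ i, e u i ^ 2 ≤ e₀) {r : ℝ} (hr : 0 < r) (ω : Fin k → ℝ) :
    ∫ x, likelihood v b (fun l => a l x) k ω * combination a e (x, adaptiveRun b k ω) ∂D ≤
      ((r * τ ^ 2 * e₀ + 4 * k * (τ ^ 2 / v) / r) +
        32 * (τ ^ 2 / v) / r * ((∑ i, ω i ^ 2) / (8 * v))) *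
          ∫ x, likelihood v b (fun l => a l x) k ω ∂D := by
  have hv' : (0 : ℝ) < v := by positivity
  set u := adaptiveRun b k ω with hu
  set z : X → ℝ := fun x => likelihood v b (fun l => a l x) k ω
  set g : X → ℝ := fun x => noiseSum b (fun l => a l x) k ω / v with hg
  set f : X → ℝ := fun x => combination a e (x, u) with hf
  have hL := h.memLp ha
  have hzm : Measurable z := (measurable_likelihood_joint v hb ha k).comp measurable_prodMk_right
  have hgm : Measurable g := ((measurable_noiseSum_joint hb ha k).comp
    measurable_prodMk_right).div_const _
  have hfm : Measurable f := (measurable_combination ha hem).comp measurable_prodMk_right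
  have hzle : ∀ x, z x ≤ Real.exp (g x) := fun x => likelihood_le_exp _ _ _ _ _
  have hz0 : ∀ x, 0 < z x := fun x => likelihood_pos _ _ _
  have hG : ∀ t : ℝ, Integrable (fun x => Real.exp (t * g x)) D := fun t => by
    have := (h.exp_noiseSum (b := b) v t (fun _ => 0) ω).1
    simpa using this
  have hG2 : ∫ x, Real.exp (2 * g x) ∂D ≤ Real.exp (4 * τ ^ 2 / v ^ 2 * ∑ i, ω i ^ 2) := by
    have := (h.exp_noiseSum (b := b) v 2 (fun _ => 0) ω).2
    simp only [zero_mul, Finset.sum_const_zero, add_zero] at this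
    refine this.trans (le_of_eq ?_)
    congr 1
    rw [Finset.mul_sum, Finset.mul_sum]
    refine Finset.sum_congr rfl fun i _ => ?_
    ring
  have hF : ∀ r : ℝ, Integrable (fun x => Real.exp (r * f x)) D ∧
      ∫ x, Real.exp (r * f x) ∂D ≤ Real.exp (τ ^ 2 * ∑ i, (r * e u i) ^ 2) := fun r => by
    have := h.exp_noiseSum (b := b) v 0 (fun i => r * e u i) ω
    simp only [zero_mul, zero_add, zero_div, mul_assoc, ← Finset.mul_sum] at this
    exact this
  have hFr : ∫ x, Real.exp (r * f x) ∂D ≤ Real.exp (r ^ 2 * τ ^ 2 * e₀) := by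
    refine (hF r).2.trans (Real.exp_le_exp.2 ?_)
    have h1 : τ ^ 2 * ∑ i, (r * e u i) ^ 2 = r ^ 2 * τ ^ 2 * ∑ i, e u i ^ 2 := by
      rw [Finset.mul_sum, Finset.mul_sum]
      exact Finset.sum_congr rfl fun i _ => by ring
    rw [h1]
    gcongr
    exact he u
  have hz : Integrable z D := by
    refine Integrable.mono' (hG 1) hzm.aestronglyMeasurable (.of_forall fun x => ?_)
    rw [Real.norm_eq_abs, abs_of_pos (hz0 x), one_mul]
    exact hzle x
  have hzg : Integrable (fun x => z x * g x) D := by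
    refine Integrable.mono' ((hG 2).add (hG 0)) (hzm.mul hgm).aestronglyMeasurable
      (.of_forall fun x => ?_)
    rw [Real.norm_eq_abs, abs_mul, abs_of_pos (hz0 x)]
    calc z x * |g x| ≤ Real.exp (g x) * (Real.exp (g x) + Real.exp (-g x)) :=
          mul_le_mul (hzle x) (abs_le_exp_add_exp_neg _) (abs_nonneg _) (Real.exp_pos _).le
      _ = _ := by
          simp only [Pi.add_apply]
          rw [mul_add, ← Real.exp_add, ← Real.exp_add]
          congr 2 <;> ring
  have hzf : Integrable (fun x => z x * f x) D := by
    refine ⟨(hzm.mul hfm).aestronglyMeasurable, ?_⟩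
    rw [hasFiniteIntegral_iff_norm]
    refine lt_of_le_of_lt ?_ ((h.lintegral_likelihood_mul_le (v := v) (b := b) he ω).trans_lt
      ENNReal.ofReal_lt_top)
    refine lintegral_mono fun x => ENNReal.ofReal_le_ofReal ?_
    rw [Real.norm_eq_abs, abs_mul, abs_of_pos (hz0 x)]
  -- The second moments of the increments are at most `4 * τ ^ 2`.
  have hZ : Real.exp (-(k * (4 * τ ^ 2) / v / 2)) ≤ ∫ x, z x ∂D := by
    have h1 := le_lintegral_likelihood (v := v) hb ha hL (h.integral_eq_zero ha)
      (h.integral_sq_le hτ ha) ω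
    rw [← ofReal_integral_eq_lintegral_ofReal hz (.of_forall fun x => (hz0 x).le),
      ENNReal.ofReal_le_ofReal_iff (integral_nonneg fun x => (hz0 x).le)] at h1
    rwa [neg_div] at h1
  have hlog : ∀ x, Real.log (z x) ≤ g x := fun x =>
    (Real.log_le_iff_le_exp (hz0 x)).2 (hzle x)
  -- Given the responses, `x` has the law `D` tilted by the likelihood `z`. The entropy bound
  -- involves the noise through its squared length.
  have key := integral_tilted_le hz0 hlog hz hZ hzg hzf (hG 2) hG2 (hF r).1 hFr
  have hdiv : ∫ x, z x * f x ∂D ≤ ((r ^ 2 * τ ^ 2 * e₀ + 4 * τ ^ 2 / v ^ 2 * ∑ i, ω i ^ 2 +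
      2 * (k * (4 * τ ^ 2) / v / 2)) * ∫ x, z x ∂D) / r := by
    rw [le_div_iff₀ hr]
    linarith
  refine hdiv.trans (le_of_eq ?_)
  field_simp
  ring

/-- The mean of a combination of sub-Gaussian queries issued after an event of the responses, on an
element of the dataset. -/
lemma HasSubGaussianIncrements.integral_le [IsProbabilityMeasure D] (hv : v ≠ 0) (hb : ∀ l, Measurable (b l))
    (ha : ∀ l, Measurable fun p : X × (Fin l → ℝ) => a l p.1 p.2) (hτ : 0 < τ)
    (h : HasSubGaussianIncrements D a k τ) (hτv : τ ^ 2 / v ≤ 1 / 16)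
    {e : (Fin k → ℝ) → Fin k → ℝ} (hem : Measurable e) {e₀ : ℝ} (he₀ : 0 ≤ e₀)
    (he : ∀ u, ∑ i, e u i ^ 2 ≤ e₀) {E : Set (Fin k → ℝ)} (hE : MeasurableSet E)
    (heE : ∀ u ∉ E, e u = 0) {r A : ℝ} (hr : 0 < r) (hA : 0 ≤ A) :
    Integrable (fun p : X × (Fin k → ℝ) => combination a e
      (p.1, adaptiveRun (fun l u => b l u + a l p.1 u) k p.2)) (D.prod (noiseLaw v k)) ∧
    ∫ p, |combination a e (p.1, adaptiveRun (fun l u => b l u + a l p.1 u) k p.2)|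
      ∂(D.prod (noiseLaw v k)) ≤ 2 * Real.exp (2 * τ ^ 2 * e₀) * Real.exp (k / 2) ∧
    ∫ p, combination a e (p.1, adaptiveRun (fun l u => b l u + a l p.1 u) k p.2)
      ∂(D.prod (noiseLaw v k)) ≤
      (r * τ ^ 2 * e₀ + 4 * k * (τ ^ 2 / v) / r + 32 * (τ ^ 2 / v) / r * A) *
        (D.prod (noiseLaw v k)).real
          {p | adaptiveRun (fun l u => b l u + a l p.1 u) k p.2 ∈ E} +
        32 * (τ ^ 2 / v) / r * Real.exp (-A - 1 + k / 2) := by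
  have hv' : (0 : ℝ) < v := by positivity
  set ρ := D.prod (noiseLaw v k)
  have hcm := measurable_combination ha hem
  have habs := h.lintegral_combination_le hv hb ha (hτv.trans (by norm_num)) hem he
  have hrunm := measurable_run_joint hb ha k
  have hlint : ∫⁻ p, ENNReal.ofReal |combination a e
      (p.1, adaptiveRun (fun l u => b l u + a l p.1 u) k p.2)| ∂ρ ≤
        ENNReal.ofReal (2 * Real.exp (2 * τ ^ 2 * e₀) * Real.exp (k / 2)) := by
    refine le_trans (le_of_eq ?_) habs
    rw [lintegral_run_joint hv hb ha k (F := fun q => ENNReal.ofReal |combination a e q|)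
      hcm.norm.ennreal_ofReal]
    refine lintegral_congr fun p => ?_
    rw [mul_comm, ← ENNReal.ofReal_mul (likelihood_pos v k _).le]
  have hint : Integrable (fun p : X × (Fin k → ℝ) => combination a e
      (p.1, adaptiveRun (fun l u => b l u + a l p.1 u) k p.2)) ρ := by
    refine ⟨(hcm.comp hrunm).aestronglyMeasurable, ?_⟩
    rw [hasFiniteIntegral_iff_norm]
    exact hlint.trans_lt ENNReal.ofReal_lt_top
  refine ⟨hint, ?_, ?_⟩
  · rw [integral_eq_lintegral_of_nonneg_ae (.of_forall fun p => abs_nonneg _)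
      hint.abs.aestronglyMeasurable]
    exact ENNReal.toReal_le_of_le_ofReal (by positivity) hlint
  set S := adaptiveRun b k ⁻¹' E with hS
  have hSm : MeasurableSet S := measurable_adaptiveRun' hb k hE
  set Z : (Fin k → ℝ) → ℝ := fun ω => ∫ x, likelihood v b (fun l => a l x) k ω ∂D with hZ
  have hZe : ∀ ω, ENNReal.ofReal (Z ω) =
      ∫⁻ x, ENNReal.ofReal (likelihood v b (fun l => a l x) k ω) ∂D := by
    intro ω
    refine ofReal_integral_eq_lintegral_ofReal ?_ (.of_forall fun x => (likelihood_pos v k _).le)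
    have h1 := (h.exp_noiseSum (b := b) v 1 (fun _ => 0) ω).1
    simp only [one_mul, zero_mul, Finset.sum_const_zero, add_zero] at h1
    refine Integrable.mono' h1 ((measurable_likelihood_joint v hb ha k).comp
      measurable_prodMk_right).aestronglyMeasurable (.of_forall fun x => ?_)
    rw [Real.norm_eq_abs, abs_of_pos (likelihood_pos v k _)]
    exact likelihood_le_exp _ _ _ _ _
  have hZ0 : ∀ ω, 0 ≤ Z ω := fun ω => integral_nonneg fun x => (likelihood_pos v k _).le
  have hZm : Measurable Z := (StronglyMeasurable.integral_prod_left' (μ := D)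
    (f := fun p : X × (Fin k → ℝ) => likelihood v b (fun l => a l p.1) k p.2)
    (measurable_likelihood_joint v hb ha k).stronglyMeasurable).measurable
  set c₁ := r * τ ^ 2 * e₀ + 4 * k * (τ ^ 2 / v) / r with hc₁
  set c₂ := 32 * (τ ^ 2 / v) / r with hc₂
  have hc₁0 : 0 ≤ c₁ := by positivity
  have hc₂0 : 0 ≤ c₂ := by positivity
  have hq0 : ∀ ω : Fin k → ℝ, 0 ≤ (∑ i, ω i ^ 2) / (8 * (v : ℝ)) := fun ω =>
    div_nonneg (Finset.sum_nonneg fun i _ => sq_nonneg _) (by positivity)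
  -- Weighting by the mean likelihood `Z` turns integrals over `S` into probabilities in the true
  -- channel, so that, unlike for bounded queries, no comparison with the base channel is needed.
  set H : (Fin k → ℝ) → ℝ := S.indicator fun ω => (c₁ + c₂ * ((∑ i, ω i ^ 2) / (8 * v))) * Z ω
    with hH
  have hH0 : ∀ ω, 0 ≤ H ω := fun ω => Set.indicator_nonneg (fun ω _ =>
    mul_nonneg (add_nonneg hc₁0 (mul_nonneg hc₂0 (hq0 ω))) (hZ0 ω)) ω
  have hHm : Measurable H := by
    refine Measurable.indicator ?_ hSm
    fun_prop
  have hp := measure_run_joint (D := D) hv hb ha k hE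
  have hHl : ∫⁻ ω, ENNReal.ofReal (H ω) ∂(noiseLaw v k) ≤
      ENNReal.ofReal (c₁ + c₂ * A) *
        ρ {p | adaptiveRun (fun l u => b l u + a l p.1 u) k p.2 ∈ E} +
        ENNReal.ofReal (c₂ * Real.exp (-A - 1 + k / 2)) := by
    have hHe : (fun ω => ENNReal.ofReal (H ω)) = S.indicator fun ω =>
        ENNReal.ofReal c₁ * (∫⁻ x, ENNReal.ofReal (likelihood v b (fun l => a l x) k ω) ∂D) +
        ENNReal.ofReal c₂ * (ENNReal.ofReal ((∑ i, ω i ^ 2) / (8 * v)) *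
          ∫⁻ x, ENNReal.ofReal (likelihood v b (fun l => a l x) k ω) ∂D) := by
      ext ω
      by_cases hω : ω ∈ S
      · simp only [hH, Set.indicator_of_mem hω]
        rw [← hZe, ← ENNReal.ofReal_mul (hq0 ω), ← ENNReal.ofReal_mul hc₁0,
          ← ENNReal.ofReal_mul hc₂0, ← ENNReal.ofReal_add (mul_nonneg hc₁0 (hZ0 ω))
            (mul_nonneg hc₂0 (mul_nonneg (hq0 ω) (hZ0 ω)))]
        congr 1
        ring
      · simp [hH, Set.indicator_of_notMem hω]
    rw [hHe, lintegral_indicator hSm, lintegral_add_left, lintegral_const_mul' _ _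
      ENNReal.ofReal_ne_top, lintegral_const_mul' _ _ ENNReal.ofReal_ne_top, ← hp]
    · refine (add_le_add_right (mul_le_mul_right
        (h.setLIntegral_sum_sq_le hv hb ha hτv hA S) _) _).trans (le_of_eq ?_)
      rw [← hp, ENNReal.ofReal_add hc₁0 (by positivity), ENNReal.ofReal_mul hc₂0,
        ENNReal.ofReal_mul hc₂0]
      ring
    · simp_rw [← hZe]
      fun_prop
  have hfin : ENNReal.ofReal (c₁ + c₂ * A) *
        ρ {p | adaptiveRun (fun l u => b l u + a l p.1 u) k p.2 ∈ E} +
        ENNReal.ofReal (c₂ * Real.exp (-A - 1 + k / 2)) ≠ ∞ :=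
    ENNReal.add_ne_top.2 ⟨ENNReal.mul_ne_top ENNReal.ofReal_ne_top (measure_ne_top _ _),
      ENNReal.ofReal_ne_top⟩
  have hHi : Integrable H (noiseLaw v k) := by
    refine ⟨hHm.aestronglyMeasurable, ?_⟩
    rw [hasFiniteIntegral_iff_ofReal (.of_forall hH0)]
    exact hHl.trans_lt (lt_top_iff_ne_top.2 hfin)
  have hWint : Integrable (fun p : X × (Fin k → ℝ) => likelihood v b (fun l => a l p.1) k p.2 *
      combination a e (p.1, adaptiveRun b k p.2)) ρ := by
    refine ⟨((measurable_likelihood_joint v hb ha k).mul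
      (hcm.comp (measurable_run_base hb k))).aestronglyMeasurable, ?_⟩
    rw [hasFiniteIntegral_iff_norm]
    refine lt_of_le_of_lt (lintegral_mono fun p => ENNReal.ofReal_le_ofReal ?_)
      (habs.trans_lt ENNReal.ofReal_lt_top)
    rw [Real.norm_eq_abs, abs_mul, abs_of_pos (likelihood_pos v k _)]
  rw [integral_run_joint hv hb ha k hcm, integral_prod_symm _ hWint]
  calc _ ≤ ∫ ω, H ω ∂(noiseLaw v k) := by
        refine integral_mono hWint.integral_prod_right hHi fun ω => ?_
        simp only
        by_cases hω : ω ∈ S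
        · rw [hH, Set.indicator_of_mem hω]
          exact h.integral_likelihood_mul_le hv hb ha hτ hem he hr ω
        · have h0 : e (adaptiveRun b k ω) = 0 := heE _ hω
          rw [hH, Set.indicator_of_notMem hω]
          simp [combination, h0]
    _ = ENNReal.toReal (∫⁻ ω, ENNReal.ofReal (H ω) ∂(noiseLaw v k)) :=
        integral_eq_lintegral_of_nonneg_ae (.of_forall hH0) hHm.aestronglyMeasurable
    _ ≤ _ := (ENNReal.toReal_mono hfin hHl)
    _ = _ := by
        rw [ENNReal.toReal_add (ENNReal.mul_ne_top ENNReal.ofReal_ne_top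
          (measure_ne_top _ _)) ENNReal.ofReal_ne_top, ENNReal.toReal_mul,
          ENNReal.toReal_ofReal (by positivity), ENNReal.toReal_ofReal (by positivity),
          Measure.real]

end SubGaussian

/-! ### Resampling one element of the dataset. -/

section Resampling

variable {X C Ω : Type*} [MeasurableSpace X] [MeasurableSpace C] [MeasurableSpace Ω]

lemma measurable_update_prod {n : ℕ} (j : Fin n) :
    Measurable fun q : (Fin n → X) × X => Function.update q.1 j q.2 := by
  refine measurable_pi_iff.2 fun i => ?_
  by_cases h : i = j
  · subst h
    simpa using measurable_snd
  · simpa [Function.update_of_ne h, Function.comp_def] using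
      (measurable_pi_apply i).comp measurable_fst

/-- Replacing one element of an iid dataset by an independent copy preserves the law. -/
lemma measurePreserving_update (D : Measure X) [IsProbabilityMeasure D] {n : ℕ} (j : Fin n) :
    MeasurePreserving (fun q : (Fin n → X) × X => Function.update q.1 j q.2)
      ((datasetLaw D n).prod D) (datasetLaw D n) := by
  refine ⟨measurable_update_prod j, (Measure.pi_eq fun A hA => ?_).symm⟩
  rw [Measure.map_apply (measurable_update_prod j) (MeasurableSet.univ_pi hA)]
  have h : (fun q : (Fin n → X) × X => Function.update q.1 j q.2) ⁻¹' Set.univ.pi A =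
      (Set.univ.pi (Function.update A j Set.univ)) ×ˢ A j := by
    ext ⟨s, x⟩
    simp only [Set.mem_preimage, Set.mem_univ_pi, Set.mem_prod]
    constructor
    · intro h
      refine ⟨fun i => ?_, by simpa using h j⟩
      by_cases hi : i = j
      · subst hi; simp
      · simpa [Function.update_of_ne hi] using h i
    · rintro ⟨h1, h2⟩ i
      by_cases hi : i = j
      · subst hi; simpa using h2
      · simpa [Function.update_of_ne hi] using h1 i
  rw [h, Measure.prod_prod, datasetLaw, Measure.pi_pi,
    ← Finset.mul_prod_erase _ _ (Finset.mem_univ j),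
    ← Finset.mul_prod_erase _ (fun i => D (A i)) (Finset.mem_univ j)]
  have h2 : ∏ i ∈ Finset.univ.erase j, D (Function.update A j Set.univ i) =
      ∏ i ∈ Finset.univ.erase j, D (A i) :=
    Finset.prod_congr rfl fun i hi => by rw [Function.update_of_ne (Finset.ne_of_mem_erase hi)]
  rw [h2]
  simp [mul_comm]

/-- The randomness of an interaction, after the element `j` of the dataset is replaced. -/
def resample {n : ℕ} (j : Fin n) (p : ((Fin n → X) × C) × (X × Ω)) : (Fin n → X) × C × Ω :=
  (Function.update p.1.1 j p.2.1, p.1.2, p.2.2)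

lemma measurable_resample {n : ℕ} (j : Fin n) : Measurable (resample (X := X) (C := C) (Ω := Ω) j) :=
  ((measurable_update_prod j).comp ((measurable_fst.comp measurable_fst).prodMk
    (measurable_fst.comp measurable_snd))).prodMk
      ((measurable_snd.comp measurable_fst).prodMk (measurable_snd.comp measurable_snd))

/-- The variables are grouped so that Fubini freezes the other data and the coins and leaves the
pair of the fresh data point and the noise, the setting of the Girsanov argument. -/
lemma measurePreserving_resample (D : Measure X) [IsProbabilityMeasure D] (κ : Measure C)
    [IsProbabilityMeasure κ] (γ : Measure Ω) [IsProbabilityMeasure γ] {n : ℕ} (j : Fin n) :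
    MeasurePreserving (resample (X := X) (C := C) (Ω := Ω) j)
      (((datasetLaw D n).prod κ).prod (D.prod γ)) ((datasetLaw D n).prod (κ.prod γ)) := by
  refine ⟨measurable_resample j, Measure.ext_of_lintegral _ fun F hF => ?_⟩
  have : IsProbabilityMeasure (datasetLaw D n) := by unfold datasetLaw; infer_instance
  have hFr := hF.comp (measurable_resample j)
  rw [lintegral_map hF (measurable_resample j), lintegral_prod _ hF.aemeasurable,
    ← (measurePreserving_update D j).lintegral_comp (Measurable.lintegral_prod_right' hF)]
  rw [lintegral_prod (fun p => F (resample j p)) hFr.aemeasurable]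
  have hm1 : Measurable fun q : (Fin n → X) × C =>
      ∫⁻ y, F (resample j (q, y)) ∂(D.prod γ) := Measurable.lintegral_prod_right' hFr
  have hm2 : Measurable fun q : (Fin n → X) × X =>
      ∫⁻ y, F (Function.update q.1 j q.2, y) ∂(κ.prod γ) :=
    (Measurable.lintegral_prod_right' hF).comp (measurable_update_prod j)
  rw [lintegral_prod _ hm1.aemeasurable, lintegral_prod _ hm2.aemeasurable]
  refine lintegral_congr fun s => ?_
  have e1 : ∀ c, ∫⁻ y, F (resample j ((s, c), y)) ∂(D.prod γ) =
      ∫⁻ x, ∫⁻ ω, F (Function.update s j x, c, ω) ∂γ ∂D := fun c =>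
    lintegral_prod (fun y => F (resample j ((s, c), y)))
      (hFr.comp measurable_prodMk_left).aemeasurable
  have e2 : ∀ x, ∫⁻ y, F (Function.update s j x, y) ∂(κ.prod γ) =
      ∫⁻ c, ∫⁻ ω, F (Function.update s j x, c, ω) ∂γ ∂κ := fun x =>
    lintegral_prod (fun y => F (Function.update s j x, y))
      (hF.comp measurable_prodMk_left).aemeasurable
  simp_rw [e1, e2]
  refine lintegral_lintegral_swap ?_
  have h3 : Measurable fun q : (C × X) × Ω => F (Function.update s j q.1.2, q.1.1, q.2) := by
    refine hF.comp (((measurable_update_prod j).comp (measurable_const.prodMk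
      (measurable_snd.comp measurable_fst))).prodMk ((measurable_fst.comp measurable_fst).prodMk
        measurable_snd))
  exact (Measurable.lintegral_prod_right' h3).aemeasurable

/-- A bound on the mean of `F` given all the randomness but one element of the dataset and the
noise gives a bound on the mean of `F`. -/
lemma integral_le_of_forall_resample {D : Measure X} [IsProbabilityMeasure D] {κ : Measure C}
    [IsProbabilityMeasure κ] {γ : Measure Ω} [IsProbabilityMeasure γ] {n : ℕ} (j : Fin n)
    {F : (Fin n → X) × C × Ω → ℝ} (hF : Measurable F) {B : Set ((Fin n → X) × C × Ω)}
    (hB : MeasurableSet B) {K c₁ c₂ : ℝ}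
    (h : ∀ q : (Fin n → X) × C, Integrable (fun y => F (resample j (q, y))) (D.prod γ) ∧
      ∫ y, |F (resample j (q, y))| ∂(D.prod γ) ≤ K ∧
      ∫ y, F (resample j (q, y)) ∂(D.prod γ) ≤
        c₁ * (D.prod γ).real {y | resample j (q, y) ∈ B} + c₂) :
    Integrable F ((datasetLaw D n).prod (κ.prod γ)) ∧
      ∫ p, F p ∂((datasetLaw D n).prod (κ.prod γ)) ≤
        c₁ * ((datasetLaw D n).prod (κ.prod γ)).real B + c₂ := by
  have : IsProbabilityMeasure (datasetLaw D n) := by unfold datasetLaw; infer_instance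
  have hmp := measurePreserving_resample D κ γ j
  have hFr : Measurable fun p => F (resample j p) := hF.comp (measurable_resample j)
  have hBr : MeasurableSet (resample j ⁻¹' B : Set (((Fin n → X) × C) × (X × Ω))) :=
    measurable_resample j hB
  have hint : Integrable (fun p => F (resample j p))
      (((datasetLaw D n).prod κ).prod (D.prod γ)) := by
    rw [integrable_prod_iff hFr.aestronglyMeasurable]
    -- The bound `K` on the conditional first absolute moments, uniform in the frozen variables,
    -- gives integrability on the product.
    refine ⟨.of_forall fun q => (h q).1, ?_⟩
    refine Integrable.of_bound (hFr.norm.stronglyMeasurable.integral_prod_right'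
      ).aestronglyMeasurable K (.of_forall fun q => ?_)
    rw [Real.norm_eq_abs, abs_of_nonneg (integral_nonneg fun _ => norm_nonneg _)]
    exact (h q).2.1
  have hFint : Integrable F ((datasetLaw D n).prod (κ.prod γ)) := by
    rw [← hmp.map_eq]
    exact (integrable_map_measure hF.aestronglyMeasurable (measurable_resample j).aemeasurable).2
      hint
  refine ⟨hFint, ?_⟩
  have hind : Integrable ((resample j ⁻¹' B).indicator fun _ => (1 : ℝ))
      (((datasetLaw D n).prod κ).prod (D.prod γ)) := (integrable_const 1).indicator hBr
  have hsec : ∀ q : (Fin n → X) × C, (D.prod γ).real {y | resample j (q, y) ∈ B} =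
      ∫ y, (resample j ⁻¹' B).indicator (fun _ => (1 : ℝ)) (q, y) ∂(D.prod γ) := by
    intro q
    have h1 : MeasurableSet {y : X × Ω | resample j (q, y) ∈ B} := measurable_prodMk_left hBr
    rw [← integral_indicator_one h1]
    rfl
  have hreal : ((datasetLaw D n).prod (κ.prod γ)).real B =
      ∫ q, (D.prod γ).real {y | resample j (q, y) ∈ B} ∂((datasetLaw D n).prod κ) := by
    simp_rw [hsec]
    rw [← integral_prod _ hind]
    have h1 : (fun p => (resample j ⁻¹' B).indicator (fun _ => (1 : ℝ)) p) =
        (resample j ⁻¹' B).indicator (1 : ((Fin n → X) × C) × (X × Ω) → ℝ) := rfl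
    rw [h1, integral_indicator_one hBr, measureReal_def, measureReal_def,
      hmp.measure_preimage hB.nullMeasurableSet]
  have hsi : Integrable (fun q => (D.prod γ).real {y | resample j (q, y) ∈ B})
      ((datasetLaw D n).prod κ) := by
    simp_rw [hsec]
    exact hind.integral_prod_left
  calc ∫ p, F p ∂((datasetLaw D n).prod (κ.prod γ)) =
        ∫ p, F (resample j p) ∂(((datasetLaw D n).prod κ).prod (D.prod γ)) := by
        rw [← hmp.map_eq, integral_map (measurable_resample j).aemeasurable
          hF.aestronglyMeasurable]
    _ = ∫ q, ∫ y, F (resample j (q, y)) ∂(D.prod γ) ∂((datasetLaw D n).prod κ) :=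
        integral_prod _ hint
    _ ≤ ∫ q, (c₁ * (D.prod γ).real {y | resample j (q, y) ∈ B} + c₂)
          ∂((datasetLaw D n).prod κ) :=
        integral_mono hint.integral_prod_left ((hsi.const_mul _).add (integrable_const _))
          fun q => (h q).2.2
    _ = _ := by
        rw [integral_add (hsi.const_mul _) (integrable_const _), integral_const_mul, ← hreal]
        simp

end Resampling

/-! ### The interaction as an adaptive channel; the first large deviation. -/

section Interaction

variable {X C : Type*} [MeasurableSpace X] [MeasurableSpace C]

/-- The mean of the query with index `i` on an element of law `D`. -/
def meanQuery (D : Measure X) (A : Analyst X C) (i : ℕ) (c : C) (u : Fin i → ℝ) : ℝ :=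
  ∫ x, A.query i c u x ∂D

/-- The centred contribution of a single element of the dataset to the queries. -/
def increment (D : Measure X) (A : Analyst X C) (n : ℕ) (c : C) (l : ℕ) (x : X) (u : Fin l → ℝ) :
    ℝ :=
  (1 / (n : ℝ)) * (A.query l c u x - meanQuery D A l c u)

/-- The queries on the dataset `s` with the contribution of `s j` replaced by its mean. -/
def baseDrift (D : Measure X) (A : Analyst X C) {n : ℕ} (j : Fin n) (s : Fin n → X) (c : C) (l : ℕ)
    (u : Fin l → ℝ) : ℝ :=
  (1 / (n : ℝ)) * (∑ i ∈ Finset.univ.erase j, A.query l c u (s i) + meanQuery D A l c u)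

/-- The deviation of the response with index `i` from the mean of the query. -/
def deviation (D : Measure X) (A : Analyst X C) {k : ℕ} (p : C × (Fin k → ℝ)) (i : Fin k) : ℝ :=
  p.2 i - meanQuery D A i p.1 fun j => p.2 (Fin.castLE i.isLt.le j)

/-- The sign of the first deviation that exceeds `α`, as a vector. -/
def firstExceedance (D : Measure X) (A : Analyst X C) {k : ℕ} (α : ℝ) (p : C × (Fin k → ℝ))
    (i : Fin k) : ℝ :=
  {p : C × (Fin k → ℝ) | α < |deviation D A p i| ∧ ∀ i' < i, |deviation D A p i'| ≤ α}.indicator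
    (fun p => deviation D A p i / |deviation D A p i|) p

section Measurability

variable (D : Measure X) [IsProbabilityMeasure D] (A : Analyst X C)

lemma measurable_meanQuery (i : ℕ) :
    Measurable fun p : C × (Fin i → ℝ) => meanQuery D A i p.1 p.2 := by
  have h : Measurable fun q : (C × (Fin i → ℝ)) × X => A.query i q.1.1 q.1.2 q.2 :=
    (A.measurable_query i).comp ((measurable_fst.comp measurable_fst).prodMk
      ((measurable_snd.comp measurable_fst).prodMk measurable_snd))
  exact h.stronglyMeasurable.integral_prod_right'.measurable

lemma measurable_increment (n : ℕ) (c : C) (l : ℕ) :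
    Measurable fun p : X × (Fin l → ℝ) => increment D A n c l p.1 p.2 :=
  (((A.measurable_query l).comp (measurable_const.prodMk (measurable_snd.prodMk
    measurable_fst))).sub ((measurable_meanQuery D A l).comp
      (measurable_const.prodMk measurable_snd))).const_mul _

lemma measurable_baseDrift {n : ℕ} (j : Fin n) (s : Fin n → X) (c : C) (l : ℕ) :
    Measurable (baseDrift D A j s c l) := by
  refine (Measurable.add (Finset.measurable_sum _ fun i _ => ?_)
    ((measurable_meanQuery D A l).comp measurable_prodMk_left)).const_mul _
  exact (A.measurable_query l).comp (measurable_const.prodMk (measurable_id.prodMk measurable_const))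

lemma measurable_deviation {k : ℕ} (i : Fin k) :
    Measurable fun p : C × (Fin k → ℝ) => deviation D A p i := by
  refine ((measurable_pi_apply i).comp measurable_snd).sub
    ((measurable_meanQuery D A i).comp (measurable_fst.prodMk ?_))
  exact measurable_pi_iff.2 fun j => (measurable_pi_apply _).comp measurable_snd

lemma measurable_firstExceedance {k : ℕ} (α : ℝ) :
    Measurable (firstExceedance D A α : C × (Fin k → ℝ) → Fin k → ℝ) := by
  have hd := fun i : Fin k => measurable_deviation D A i
  refine measurable_pi_iff.2 fun i => Measurable.indicator ((hd i).div (hd i).norm) ?_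
  have h : {p : C × (Fin k → ℝ) | α < |deviation D A p i| ∧ ∀ i' < i, |deviation D A p i'| ≤ α} =
      {p | α < |deviation D A p i|} ∩ ⋂ i', ⋂ (_ : i' < i), {p | |deviation D A p i'| ≤ α} := by
    ext p
    simp
  rw [h]
  exact (measurableSet_lt measurable_const (hd i).norm).inter (MeasurableSet.iInter fun i' =>
    MeasurableSet.iInter fun _ => measurableSet_le (hd i').norm measurable_const)

end Measurability

lemma firstExceedance_eq_zero {D : Measure X} {A : Analyst X C} {k : ℕ} {α : ℝ}
    {p : C × (Fin k → ℝ)} (h : ∀ i, |deviation D A p i| ≤ α) : firstExceedance D A α p = 0 := by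
  ext i
  refine Set.indicator_of_notMem (fun hi => ?_) _
  exact absurd (h i) (not_le.2 hi.1)

lemma firstExceedance_eq_single {D : Measure X} {A : Analyst X C} {k : ℕ} {α : ℝ}
    {p : C × (Fin k → ℝ)} (h : ∃ i, α < |deviation D A p i|) :
    ∃ i, α < |deviation D A p i| ∧
      firstExceedance D A α p = Pi.single i (deviation D A p i / |deviation D A p i|) := by
  obtain ⟨i, hi, hmin⟩ := WellFounded.has_min (wellFounded_lt (α := Fin k))
    {i | α < |deviation D A p i|} h
  have hlt : ∀ i' < i, |deviation D A p i'| ≤ α := fun i' hi' => by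
    by_contra! hc
    exact hmin i' hc hi'
  refine ⟨i, hi, ?_⟩
  ext i'
  rw [Pi.single_apply]
  split_ifs with hii
  · subst hii
    rw [firstExceedance, Set.indicator_of_mem]
    exact ⟨hi, hlt⟩
  · refine Set.indicator_of_notMem (fun hm => ?_) _
    rcases lt_or_gt_of_ne hii with hl | hl
    · exact absurd (hlt i' hl) (not_le.2 hm.1)
    · exact absurd (hm.2 i hl) (not_le.2 hi)

lemma abs_div_abs_le_one (d : ℝ) : abs (d / abs d) ≤ 1 := by
  rw [abs_div, abs_abs]
  exact div_self_le_one _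

/-- A vector with at most one non-zero entry, of modulus at most one. -/
lemma firstExceedance_cases (D : Measure X) (A : Analyst X C) {k : ℕ} (α : ℝ)
    (p : C × (Fin k → ℝ)) : firstExceedance D A α p = 0 ∨
      ∃ i ε, |ε| ≤ 1 ∧ firstExceedance D A α p = Pi.single i ε := by
  by_cases h : ∃ i, α < |deviation D A p i|
  · obtain ⟨i, _, hi⟩ := firstExceedance_eq_single h
    exact .inr ⟨i, _, abs_div_abs_le_one _, hi⟩
  · push Not at h
    exact .inl (firstExceedance_eq_zero h)

lemma sum_firstExceedance_sq_le (D : Measure X) (A : Analyst X C) {k : ℕ} (α : ℝ)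
    (p : C × (Fin k → ℝ)) : ∑ i, firstExceedance D A α p i ^ 2 ≤ 1 := by
  rcases firstExceedance_cases D A α p with h | ⟨i', ε, hε, h⟩
  · simp [h]
  · rw [h, Finset.sum_eq_single i' (fun i _ hi => by simp [hi]) (by simp)]
    rw [Pi.single_eq_same, ← sq_abs]
    exact pow_le_one₀ (abs_nonneg _) hε

lemma responses_gaussianMechanism (A : Analyst X C) {n : ℕ} (η : ℝ) (s : Fin n → X) (c : C) (k : ℕ)
    (ω : Fin k → ℝ) : responses (gaussianMechanism X n η) A s c k ω =
      adaptiveRun (fun l u => linearQuery (A.query l c u) s) k ω := by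
  induction k with
  | zero => rfl
  | succ k ih =>
    rw [responses, adaptiveRun, ih]
    rfl

/-- Putting the mean contribution of `x` into the base drift is what makes the increment centred. -/
lemma linearQuery_update (D : Measure X) (A : Analyst X C) {n : ℕ} (j : Fin n) (s : Fin n → X)
    (x : X) (c : C) (l : ℕ) (u : Fin l → ℝ) :
    linearQuery (A.query l c u) (Function.update s j x) =
      baseDrift D A j s c l u + increment D A n c l x u := by
  simp only [linearQuery, baseDrift, increment]
  rw [← Finset.add_sum_erase _ _ (Finset.mem_univ j), Function.update_self,
    Finset.sum_congr rfl fun i hi => by rw [Function.update_of_ne (Finset.ne_of_mem_erase hi)]]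
  ring

lemma measurable_responses (A : Analyst X C) (n : ℕ) (η : ℝ) (k : ℕ) :
    Measurable fun p : (Fin n → X) × C × (Fin k → ℝ) =>
      responses (gaussianMechanism X n η) A p.1 p.2.1 k p.2.2 := by
  simp_rw [responses_gaussianMechanism]
  have h := measurable_adaptiveRun (Y := (Fin n → X) × C)
    (m := fun l q u => linearQuery (A.query l q.2 u) q.1) (fun l => ?_) k
  · exact h.comp ((measurable_fst.prodMk (measurable_fst.comp measurable_snd)).prodMk
      (measurable_snd.comp measurable_snd))
  · refine (Finset.measurable_sum _ fun i _ => ?_).const_mul _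
    exact (A.measurable_query l).comp ((measurable_snd.comp measurable_fst).prodMk
      (measurable_snd.prodMk ((measurable_pi_apply i).comp (measurable_fst.comp measurable_fst))))

lemma integral_linearQuery (D : Measure X) [IsProbabilityMeasure D] {n : ℕ} (hn : 0 < n) {q : X → ℝ}
    (hq : Integrable q D) : trueValue D n q = ∫ x, q x ∂D := by
  simp only [trueValue, linearQuery, datasetLaw]
  rw [integral_const_mul, integral_finsetSum]
  · simp_rw [integral_comp_eval (μ := fun _ : Fin n => D) hq.aestronglyMeasurable]
    have : (n : ℝ) ≠ 0 := by positivity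
    simp
    field_simp
  · intro j _
    exact integrable_comp_eval (μ := fun _ : Fin n => D) hq

/-- The positivity of `n` and integrability identify the true value with the mean over `D`; the
positivity of `k` makes the supremum one over a nonempty set. -/
lemma lt_distributionError_iff (D : Measure X) [IsProbabilityMeasure D] {n k : ℕ} (hn : 0 < n)
    (hk : 0 < k) (A : Analyst X C) (hA : ∀ i < k, ∀ c u, Integrable (A.query i c u) D) (α : ℝ) (c : C)
    (u : Fin k → ℝ) :
    α < distributionError D n A c u ↔ ∃ i, α < |deviation D A (c, u) i| := by
  have : Nonempty (Fin k) := ⟨⟨0, hk⟩⟩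
  have h : ∀ i : Fin k, |u i - trueValue D n (A.queryAt c u i)| = |deviation D A (c, u) i| :=
    fun i => by
      have := integral_linearQuery D hn (hA i i.isLt c fun j => u (Fin.castLE i.isLt.le j))
      change |u i - trueValue D n (A.query i c _)| = _
      rw [this]
      rfl
  rw [distributionError]
  simp_rw [h]
  constructor
  · exact fun h => exists_lt_of_lt_ciSup h
  · rintro ⟨i, hi⟩
    exact hi.trans_le (le_ciSup (f := fun i => |deviation D A (c, u) i|)
      (Set.finite_range _).bddAbove i)

end Interaction

/-! ### Exponential moments of the absolute noise in a single round. -/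

section Noise

lemma integrable_exp_abs_noise {v : ℝ≥0} (hv : v ≠ 0) (s : ℝ) {k : ℕ} (i : Fin k) :
    Integrable (fun ω => Real.exp (s * |ω i|)) (noiseLaw v k) := by
  refine ⟨(Real.measurable_exp.comp
    ((measurable_pi_apply i).norm.const_mul s)).aestronglyMeasurable, ?_⟩
  rw [hasFiniteIntegral_iff_ofReal (.of_forall fun ω => (Real.exp_pos _).le)]
  exact (lintegral_exp_abs_noise_le hv s i).trans_lt ENNReal.ofReal_lt_top

lemma integral_exp_abs_noise_le {v : ℝ≥0} (hv : v ≠ 0) (s : ℝ) {k : ℕ} (i : Fin k) :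
    ∫ ω, Real.exp (s * |ω i|) ∂(noiseLaw v k) ≤ 2 * Real.exp (s ^ 2 * v / 2) := by
  rw [integral_eq_lintegral_of_nonneg_ae (.of_forall fun ω => (Real.exp_pos _).le)
    (integrable_exp_abs_noise hv s i).aestronglyMeasurable]
  exact ENNReal.toReal_le_of_le_ofReal (by positivity) (lintegral_exp_abs_noise_le hv s i)

end Noise

/-! ### From one data point to accuracy. -/

section Accuracy

variable {X C : Type*} [MeasurableSpace X] [MeasurableSpace C]

/-- The centred query whose answer is the first to deviate by more than `α`, with the sign of the
deviation. -/
def selectedQuery (D : Measure X) (A : Analyst X C) {k : ℕ} (α : ℝ) (c : C)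
    (p : X × (Fin k → ℝ)) : ℝ :=
  ∑ i, firstExceedance D A α (c, p.2) i *
    (A.query i c (fun j => p.2 (Fin.castLE i.isLt.le j)) p.1 -
      meanQuery D A i c fun j => p.2 (Fin.castLE i.isLt.le j))

/-- The views in which some response deviates by more than `α`. -/
def exceedanceSet (D : Measure X) (A : Analyst X C) (k : ℕ) (α : ℝ) (c : C) : Set (Fin k → ℝ) :=
  {u | ∃ i, α < |deviation D A (c, u) i|}

/-- The responses when the element `j` of the dataset `s` is replaced. -/
def resampledRun (D : Measure X) (A : Analyst X C) {n : ℕ} (k : ℕ) (j : Fin n) (s : Fin n → X)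
    (c : C) (p : X × (Fin k → ℝ)) : Fin k → ℝ :=
  adaptiveRun (fun l u => baseDrift D A j s c l u + increment D A n c l p.1 u) k p.2

lemma responses_update (D : Measure X) (A : Analyst X C) {n : ℕ} (k : ℕ) (η : ℝ) (j : Fin n)
    (s : Fin n → X) (c : C) (x : X) (ω : Fin k → ℝ) :
    responses (gaussianMechanism X n η) A (Function.update s j x) c k ω =
      resampledRun D A k j s c (x, ω) := by
  rw [responses_gaussianMechanism, resampledRun]
  simp_rw [linearQuery_update D A j s x c]

lemma selectedQuery_eq_zero {D : Measure X} {A : Analyst X C} {k : ℕ} {α : ℝ} {c : C}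
    {u : Fin k → ℝ} (hu : u ∉ exceedanceSet D A k α c) (x : X) :
    selectedQuery D A α c (x, u) = 0 := by
  have h : firstExceedance D A α (c, u) = 0 := by
    refine firstExceedance_eq_zero fun i => ?_
    by_contra! hi
    exact hu ⟨i, hi⟩
  simp [selectedQuery, h]

/-- Every response is the empirical mean plus noise, so the selected deviation splits into the
average over the data of the selected query and the selected noise. Only the first is affected by
overfitting. -/
lemma sum_firstExceedance_mul_deviation (D : Measure X) (A : Analyst X C) {n k : ℕ} (hn : 0 < n) (α η : ℝ) (s : Fin n → X) (c : C)
    (ω : Fin k → ℝ) :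
    ∑ i, firstExceedance D A α (c, responses (gaussianMechanism X n η) A s c k ω) i *
        deviation D A (c, responses (gaussianMechanism X n η) A s c k ω) i =
      (1 / (n : ℝ)) * ∑ j, selectedQuery D A α c
          (s j, responses (gaussianMechanism X n η) A s c k ω) +
        ∑ i, firstExceedance D A α (c, responses (gaussianMechanism X n η) A s c k ω) i * ω i := by
  have hn' : (n : ℝ) ≠ 0 := by positivity
  rw [responses_gaussianMechanism]
  set u := adaptiveRun (fun l u => linearQuery (A.query l c u) s) k ω with hu
  simp only [selectedQuery]
  rw [Finset.sum_comm, Finset.mul_sum, ← Finset.sum_add_distrib]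
  refine Finset.sum_congr rfl fun i _ => ?_
  rw [← Finset.mul_sum, Finset.sum_sub_distrib]
  have h1 : u i = linearQuery (A.query i c fun j => u (Fin.castLE i.isLt.le j)) s + ω i := by
    rw [hu]
    exact adaptiveRun_apply ..
  simp only [deviation]
  rw [h1, linearQuery]
  simp only [Finset.sum_const, Finset.card_univ, Fintype.card_fin, nsmul_eq_mul]
  field_simp
  ring

lemma le_sum_firstExceedance_mul_deviation (D : Measure X) (A : Analyst X C) {k : ℕ} {α : ℝ} {p : C × (Fin k → ℝ)}
    (h : ∃ i, α < |deviation D A p i|) (hα : 0 < α) :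
    α ≤ ∑ i, firstExceedance D A α p i * deviation D A p i := by
  obtain ⟨i, hi, he⟩ := firstExceedance_eq_single h
  have hpos : 0 < |deviation D A p i| := hα.trans hi
  rw [he, Finset.sum_eq_single i (fun i' _ hi' => by simp [hi']) (by simp)]
  simp only [Pi.single_apply, if_true]
  rw [div_mul_eq_mul_div, ← abs_mul_abs_self, mul_div_assoc, div_self hpos.ne', mul_one]
  exact hi.le

/-- The selected round depends on the noise, so its exponential is bounded by the sum over all
rounds; `le_add_exp_sub` confines the main term to the bad event. -/
lemma sum_firstExceedance_mul_le (D : Measure X) (A : Analyst X C) {k : ℕ} (α : ℝ) (p : C × (Fin k → ℝ)) (ω : Fin k → ℝ)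
    {s : ℝ} (hs : 0 < s) (a : ℝ) :
    ∑ i, firstExceedance D A α p i * ω i ≤
      {p : C × (Fin k → ℝ) | ∃ i, α < |deviation D A p i|}.indicator (fun _ => a / s) p +
        (Real.exp (-a - 1) / s) * ∑ i, Real.exp (s * |ω i|) := by
  by_cases h : ∃ i, α < |deviation D A p i|
  · rw [Set.indicator_of_mem (show p ∈ {p : C × (Fin k → ℝ) | ∃ i, α < |deviation D A p i|} from h)]
    obtain ⟨i, -, he⟩ := firstExceedance_eq_single h
    rw [he, Finset.sum_eq_single i (fun i' _ hi' => by simp [hi']) (by simp)]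
    simp only [Pi.single_apply, if_true]
    have h1 : deviation D A p i / |deviation D A p i| * ω i ≤ |ω i| := by
      refine (le_abs_self _).trans ?_
      rw [abs_mul]
      exact mul_le_of_le_one_left (abs_nonneg _) (abs_div_abs_le_one _)
    have h2 := le_add_exp_sub (s * |ω i|) a
    have h3 : Real.exp (s * |ω i|) ≤ ∑ i, Real.exp (s * |ω i|) :=
      Finset.single_le_sum (f := fun i => Real.exp (s * |ω i|)) (fun _ _ => (Real.exp_pos _).le)
        (Finset.mem_univ i)
    have h4 := mul_le_mul_of_nonneg_left h3 (Real.exp_pos (-a - 1)).le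
    have h5 : |ω i| ≤ (a + Real.exp (-a - 1) * ∑ i, Real.exp (s * |ω i|)) / s := by
      rw [le_div_iff₀ hs]
      linarith
    calc _ ≤ _ := h1.trans h5
      _ = _ := by ring
  · rw [Set.indicator_of_notMem (show p ∉ {p : C × (Fin k → ℝ) | ∃ i, α < |deviation D A p i|} from h)]
    push Not at h
    rw [firstExceedance_eq_zero h]
    simp only [Pi.zero_apply, zero_mul, Finset.sum_const_zero, zero_add]
    positivity

variable (D : Measure X) [IsProbabilityMeasure D] (A : Analyst X C)

lemma measurable_selectedQuery {k : ℕ} (α : ℝ) :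
    Measurable fun p : C × X × (Fin k → ℝ) => selectedQuery D A α p.1 p.2 := by
  have hr : ∀ i : Fin k, Measurable fun p : C × X × (Fin k → ℝ) =>
      fun j : Fin i => p.2.2 (Fin.castLE i.isLt.le j) := fun i =>
    measurable_pi_iff.2 fun j =>
      (measurable_pi_apply _).comp (measurable_snd.comp measurable_snd)
  refine Finset.measurable_sum _ fun i _ => Measurable.mul ?_ (Measurable.sub ?_ ?_)
  · exact (measurable_pi_apply i).comp ((measurable_firstExceedance D A α).comp
      (measurable_fst.prodMk (measurable_snd.comp measurable_snd)))
  · exact (A.measurable_query i).comp (measurable_fst.prodMk ((hr i).prodMk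
      (measurable_fst.comp measurable_snd)))
  · exact (measurable_meanQuery D A i).comp (measurable_fst.prodMk (hr i))

lemma measurableSet_exists_deviation (k : ℕ) (α : ℝ) :
    MeasurableSet {p : C × (Fin k → ℝ) | ∃ i, α < |deviation D A p i|} := by
  have h : {p : C × (Fin k → ℝ) | ∃ i, α < |deviation D A p i|} =
      ⋃ i, {p | α < |deviation D A p i|} := by
    ext p
    simp
  rw [h]
  exact MeasurableSet.iUnion fun i => measurableSet_lt measurable_const
    (measurable_deviation D A i).norm

lemma measurableSet_exceedanceSet (k : ℕ) (α : ℝ) (c : C) :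
    MeasurableSet (exceedanceSet D A k α c) :=
  measurable_prodMk_left (measurableSet_exists_deviation D A k α)

/-- A criterion for accuracy in terms of the deviations from the means. -/
lemma isDistributionAccurate_of_real_le {n k : ℕ} (hn : 0 < n) (hk : 0 < k)
    (hA : ∀ i < k, ∀ c u, Integrable (A.query i c u) D) (η : ℝ) {α β : ℝ}
    (h : ((datasetLaw D n).prod (A.coins.prod (noiseLaw (η ^ 2).toNNReal k))).real
      {p | ∃ i, α < |deviation D A (p.2.1,
        responses (gaussianMechanism X n η) A p.1 p.2.1 k p.2.2) i|} ≤ β) :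
    IsDistributionAccurate D (gaussianMechanism X n η) A k α β := by
  have := A.isProbabilityMeasure_coins
  have : IsProbabilityMeasure (datasetLaw D n) := by unfold datasetLaw; infer_instance
  have h1 : {p : (Fin n → X) × C × (Fin k → ℝ) | α < distributionError D n A p.2.1
      (responses (gaussianMechanism X n η) A p.1 p.2.1 k p.2.2)} =
      {p | ∃ i, α < |deviation D A (p.2.1,
        responses (gaussianMechanism X n η) A p.1 p.2.1 k p.2.2) i|} := by
    ext p
    rw [Set.mem_ofPred_eq, Set.mem_ofPred_eq, lt_distributionError_iff D hn hk A hA]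
  have h2 : interactionLaw D (gaussianMechanism X n η) A k =
      (datasetLaw D n).prod (A.coins.prod (noiseLaw (η ^ 2).toNNReal k)) := rfl
  rw [IsDistributionAccurate, h1, h2, ← ENNReal.ofReal_toReal (measure_ne_top _ _)]
  exact ENNReal.ofReal_le_ofReal h

lemma integral_selectedQuery_responses_le {v : ℝ≥0} {n k : ℕ} {α c₁ c₂ K : ℝ} (j : Fin n)
    {R : (Fin n → X) × C × (Fin k → ℝ) → Fin k → ℝ} (hR : Measurable R)
    (hRj : ∀ s c y, R (Function.update s j y.1, c, y.2) = resampledRun D A k j s c y)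
    (h : ∀ (s : Fin n → X) (c : C),
      Integrable (fun p => selectedQuery D A α c (p.1, resampledRun D A k j s c p))
        (D.prod (noiseLaw v k)) ∧
      ∫ p, |selectedQuery D A α c (p.1, resampledRun D A k j s c p)| ∂(D.prod (noiseLaw v k)) ≤ K ∧
      ∫ p, selectedQuery D A α c (p.1, resampledRun D A k j s c p) ∂(D.prod (noiseLaw v k)) ≤
        c₁ * (D.prod (noiseLaw v k)).real
          {p | resampledRun D A k j s c p ∈ exceedanceSet D A k α c} + c₂) :
    Integrable (fun p : (Fin n → X) × C × (Fin k → ℝ) => selectedQuery D A α p.2.1 (p.1 j, R p))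
      ((datasetLaw D n).prod (A.coins.prod (noiseLaw v k))) ∧
    ∫ p, selectedQuery D A α p.2.1 (p.1 j, R p)
      ∂((datasetLaw D n).prod (A.coins.prod (noiseLaw v k))) ≤
      c₁ * ((datasetLaw D n).prod (A.coins.prod (noiseLaw v k))).real
        {p | ∃ i, α < |deviation D A (p.2.1, R p) i|} + c₂ := by
  have := A.isProbabilityMeasure_coins
  have hc : Measurable fun p : (Fin n → X) × C × (Fin k → ℝ) => p.2.1 :=
    measurable_fst.comp measurable_snd
  have hx : Measurable fun p : (Fin n → X) × C × (Fin k → ℝ) => p.1 j :=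
    (measurable_pi_apply j).comp measurable_fst
  have hF : Measurable fun p : (Fin n → X) × C × (Fin k → ℝ) =>
      selectedQuery D A α p.2.1 (p.1 j, R p) := by
    have h := (measurable_selectedQuery (k := k) D A α).comp (hc.prodMk (hx.prodMk hR))
    exact h
  have hB : MeasurableSet {p : (Fin n → X) × C × (Fin k → ℝ) |
      ∃ i, α < |deviation D A (p.2.1, R p) i|} :=
    (hc.prodMk hR) (measurableSet_exists_deviation D A k α)
  refine integral_le_of_forall_resample (K := K) j hF hB fun q => ?_
  · obtain ⟨s, c⟩ := q
    simp only [resample, Function.update_self, Set.mem_ofPred_eq, hRj]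
    exact h s c

lemma integral_comp_snd_snd {Y Z Ω : Type*} [MeasurableSpace Y] [MeasurableSpace Z]
    [MeasurableSpace Ω] {γ : Measure Ω} [SFinite γ] (μ : Measure Y) [IsProbabilityMeasure μ]
    (κ : Measure Z) [IsProbabilityMeasure κ] (f : Ω → ℝ) :
    ∫ p, f p.2.2 ∂(μ.prod (κ.prod γ)) = ∫ ω, f ω ∂γ := by
  rw [integral_fun_snd (fun q : Z × Ω => f q.2), integral_fun_snd f]
  simp

/-- A criterion for the accuracy of the Gaussian mechanism: it suffices to bound the mean of the
selected query on a single element of the dataset. -/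
theorem isDistributionAccurate_of_integral_selectedQuery_le {n k : ℕ} (hn : 0 < n) (hk : 0 < k)
    (hA : ∀ i < k, ∀ c u, Integrable (A.query i c u) D) {α β η L c₁ c₂ K : ℝ} (hα : 0 < α)
    (hβ : 0 < β) (hη : 0 < η) (hL : 0 < L) (hηL : η ^ 2 * (18 * L) = α ^ 2)
    (hlog : Real.log (2 * k / β) ≤ L - 1 / 2) (hc₁ : c₁ ≤ 2 / 3 * α)
    (hc : c₁ * β + c₂ < 2 / 3 * α * β)
    (h : ∀ (j : Fin n) (s : Fin n → X) (c : C),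
      Integrable (fun p => selectedQuery D A α c (p.1, resampledRun D A k j s c p))
        (D.prod (noiseLaw (η ^ 2).toNNReal k)) ∧
      ∫ p, |selectedQuery D A α c (p.1, resampledRun D A k j s c p)|
        ∂(D.prod (noiseLaw (η ^ 2).toNNReal k)) ≤ K ∧
      ∫ p, selectedQuery D A α c (p.1, resampledRun D A k j s c p)
        ∂(D.prod (noiseLaw (η ^ 2).toNNReal k)) ≤
        c₁ * (D.prod (noiseLaw (η ^ 2).toNNReal k)).real
          {p | resampledRun D A k j s c p ∈ exceedanceSet D A k α c} + c₂) :
    IsDistributionAccurate D (gaussianMechanism X n η) A k α β := by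
  have := A.isProbabilityMeasure_coins
  have : IsProbabilityMeasure (datasetLaw D n) := by unfold datasetLaw; infer_instance
  set v : ℝ≥0 := (η ^ 2).toNNReal with hvdef
  have hvη : (v : ℝ) = η ^ 2 := Real.coe_toNNReal _ (sq_nonneg _)
  have hv : v ≠ 0 := by
    intro h0
    rw [h0] at hvη
    have : 0 < η ^ 2 := by positivity
    simp at hvη
    linarith
  set P : Measure ((Fin n → X) × C × (Fin k → ℝ)) :=
    (datasetLaw D n).prod (A.coins.prod (noiseLaw v k)) with hP
  set R : (Fin n → X) × C × (Fin k → ℝ) → Fin k → ℝ := fun p =>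
    responses (gaussianMechanism X n η) A p.1 p.2.1 k p.2.2 with hR
  have hRm : Measurable R := measurable_responses A n η k
  have hRm' : Measurable fun p => (p.2.1, R p) :=
    (measurable_fst.comp measurable_snd).prodMk hRm
  set B : Set ((Fin n → X) × C × (Fin k → ℝ)) :=
    {p | ∃ i, α < |deviation D A (p.2.1, R p) i|} with hBdef
  have hB : MeasurableSet B := hRm' (measurableSet_exists_deviation D A k α)
  refine isDistributionAccurate_of_real_le D A hn hk hA η ?_
  -- A bad event of probability above `β` allows error terms proportional to `β` to be absorbed into
  -- its probability.
  by_contra! hp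
  set F : Fin n → (Fin n → X) × C × (Fin k → ℝ) → ℝ := fun j p =>
    selectedQuery D A α p.2.1 (p.1 j, R p) with hF
  have hFj : ∀ j, Integrable (F j) P ∧ ∫ p, F j p ∂P ≤ c₁ * P.real B + c₂ := by
    intro j
    exact integral_selectedQuery_responses_le D A j hRm
      (fun s c y => responses_update D A k η j s c y.1 y.2) (h j)
  -- Chosen so that the exponential moment of the noise in one round is at most `2 * exp L` and, by
  -- the value of `η`, `2 * L / t = α / 3`.
  set t : ℝ := √(2 * L) / η with ht
  have hsq : √(2 * L) ^ 2 = 2 * L := Real.sq_sqrt (by positivity)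
  have hsp : 0 < √(2 * L) := Real.sqrt_pos.2 (by positivity)
  have htp : 0 < t := by positivity
  have ht2 : t ^ 2 * v / 2 = L := by
    rw [hvη, ht, div_pow, hsq]
    field_simp
  have hαt : 2 * L / t = α / 3 := by
    have h1 : √(2 * L) * η = α / 3 := by
      have h2 : (√(2 * L) * η) ^ 2 = (α / 3) ^ 2 := by
        rw [mul_pow, hsq]
        nlinarith
      exact (pow_left_inj₀ (by positivity) (by positivity) two_ne_zero).1 h2
    rw [← h1, ht]
    field_simp
    exact hsq.symm
  -- Chosen so that `exp (-a - 1)` times the total exponential moment `2 * k * exp L` is `β / e`.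
  set a : ℝ := Real.log (2 * k / β) + L with ha
  have hexpa : Real.exp (-a - 1) * (2 * k * Real.exp L) = β * Real.exp (-1) := by
    have hk' : (0 : ℝ) < k := by exact_mod_cast hk
    rw [ha, show -(Real.log (2 * k / β) + L) - 1 = -Real.log (2 * k / β) + (-1) + (-L) by ring,
      Real.exp_add, Real.exp_add, Real.exp_neg, Real.exp_log (by positivity), Real.exp_neg L]
    field_simp
  have hnoise_int : ∀ i : Fin k, Integrable
      (fun p : (Fin n → X) × C × (Fin k → ℝ) => Real.exp (t * |p.2.2 i|)) P := fun i =>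
    ((integrable_exp_abs_noise hv t i).comp_snd A.coins).comp_snd (datasetLaw D n)
  have hnoise_le : ∀ i : Fin k, ∫ p, Real.exp (t * |p.2.2 i|) ∂P ≤ 2 * Real.exp L := by
    intro i
    rw [hP, integral_comp_snd_snd _ _ fun ω : Fin k → ℝ => Real.exp (t * |ω i|), ← ht2]
    exact integral_exp_abs_noise_le hv t i
  -- Integrating this gives `α * p` on the left, for `p` the probability of `B`, and on the right
  -- `c₁ * p + c₂` from the data plus the noise terms.
  have hpt : ∀ p, B.indicator (fun _ => α) p ≤ (1 / (n : ℝ)) * ∑ j, F j p +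
      (B.indicator (fun _ => a / t) p +
        (Real.exp (-a - 1) / t) * ∑ i, Real.exp (t * |p.2.2 i|)) := by
    intro p
    have h1 := sum_firstExceedance_mul_deviation D A hn α η p.1 p.2.1 p.2.2
    have h2 := sum_firstExceedance_mul_le D A α (p.2.1, R p) p.2.2 htp a
    have h3 : B.indicator (fun _ => α) p ≤ ∑ i, firstExceedance D A α (p.2.1, R p) i *
        deviation D A (p.2.1, R p) i := by
      by_cases hpB : p ∈ B
      · rw [Set.indicator_of_mem hpB]
        exact le_sum_firstExceedance_mul_deviation D A hpB hα
      · rw [Set.indicator_of_notMem hpB, firstExceedance_eq_zero]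
        · simp
        · intro i
          by_contra! hi
          exact hpB ⟨i, hi⟩
    calc _ ≤ _ := h3
      _ = _ := h1
      _ ≤ _ := add_le_add le_rfl h2
  have hi1 : Integrable (fun p => (1 / (n : ℝ)) * ∑ j, F j p) P :=
    (integrable_finsetSum _ fun j _ => (hFj j).1).const_mul _
  have hi2 : Integrable (B.indicator fun _ => a / t) P := (integrable_const _).indicator hB
  have hi3 : Integrable (fun p : (Fin n → X) × C × (Fin k → ℝ) =>
      (Real.exp (-a - 1) / t) * ∑ i, Real.exp (t * |p.2.2 i|)) P :=
    (integrable_finsetSum _ fun i _ => hnoise_int i).const_mul _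
  have hmain := integral_mono ((integrable_const α).indicator hB) (hi1.add (hi2.add hi3)) hpt
  have hadd := (integral_add hi1 (hi2.add hi3)).trans (congrArg _ (integral_add hi2 hi3))
  replace hmain := hmain.trans_eq hadd
  rw [integral_indicator_const _ hB, integral_indicator_const _ hB,
    integral_const_mul, integral_const_mul, integral_finsetSum _ fun j _ => (hFj j).1,
    integral_finsetSum _ fun i _ => hnoise_int i, smul_eq_mul, smul_eq_mul] at hmain
  have hn' : (0 : ℝ) < n := by exact_mod_cast hn
  have hs1 : (1 / (n : ℝ)) * ∑ j, ∫ p, F j p ∂P ≤ c₁ * P.real B + c₂ := by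
    have h1 : ∑ j, ∫ p, F j p ∂P ≤ ∑ _j : Fin n, (c₁ * P.real B + c₂) :=
      Finset.sum_le_sum fun j _ => (hFj j).2
    rw [Finset.sum_const, Finset.card_univ, Fintype.card_fin, nsmul_eq_mul] at h1
    rw [one_div, inv_mul_le_iff₀ hn']
    exact h1
  have hs2 : Real.exp (-a - 1) / t * ∑ i, ∫ p, Real.exp (t * |p.2.2 i|) ∂P ≤
      β * Real.exp (-1) / t := by
    have h1 : ∑ i : Fin k, ∫ p, Real.exp (t * |p.2.2 i|) ∂P ≤ ∑ _i : Fin k, 2 * Real.exp L :=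
      Finset.sum_le_sum fun i _ => hnoise_le i
    rw [Finset.sum_const, Finset.card_univ, Fintype.card_fin, nsmul_eq_mul] at h1
    calc _ ≤ Real.exp (-a - 1) / t * (k * (2 * Real.exp L)) :=
          mul_le_mul_of_nonneg_left h1 (by positivity)
      _ = Real.exp (-a - 1) * (2 * k * Real.exp L) / t := by ring
      _ = _ := by rw [hexpa]
  -- The noise costs at most `α / 3` times the probability of `B`: the slack `1 / 2` in `hlog`
  -- covers `exp (-1)`.
  have hs3 : P.real B * (a / t) + β * Real.exp (-1) / t ≤ P.real B * (α / 3) := by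
    rw [← hαt, ← mul_div_assoc, ← mul_div_assoc, ← add_div]
    refine div_le_div_of_nonneg_right ?_ htp.le
    have he : Real.exp (-1) ≤ 1 / 2 := by
      rw [Real.exp_neg, inv_le_comm₀ (Real.exp_pos 1) (by norm_num)]
      have := Real.add_one_le_exp 1
      norm_num at this ⊢
      linarith
    have hpB : 0 ≤ P.real B := measureReal_nonneg
    have h1 : β * Real.exp (-1) ≤ P.real B * (1 / 2) :=
      mul_le_mul hp.le he (Real.exp_pos _).le hpB
    have h2 : P.real B * a ≤ P.real B * (2 * L - 1 / 2) :=
      mul_le_mul_of_nonneg_left (by rw [ha]; linarith) hpB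
    linarith
  have h4 : 0 ≤ (2 / 3 * α - c₁) * (P.real B - β) :=
    mul_nonneg (by linarith) (by linarith)
  linarith

end Accuracy

/-! ### Numerical consequences of the choice of noise and sample size. -/

section Constants

/-- Consequences of the choice of the noise parameter. -/
lemma log_ratio_bounds {α σ β : ℝ} (hα : 0 < α) (hσ : 0 < σ) (hβ : 0 < β) (hβ8 : β ≤ 1 / 8) {k : ℕ}
    (hk : 0 < k) :
    4.8 ≤ Real.log ((k + 1) * σ / (min σ α * β ^ 2)) ∧
      Real.log (1 / β) ≤ Real.log ((k + 1) * σ / (min σ α * β ^ 2)) / 2 ∧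
      Real.log (2 * k / β) ≤ Real.log ((k + 1) * σ / (min σ α * β ^ 2)) - 1 / 2 ∧
      σ * Real.exp (-Real.log ((k + 1) * σ / (min σ α * β ^ 2))) ≤ α * β ^ 2 / 2 := by
  have hk1 : (1 : ℝ) ≤ k := by exact_mod_cast hk
  have hm : 0 < min σ α := lt_min hσ hα
  set N : ℝ := (k + 1) * σ / (min σ α * β ^ 2) with hN
  have hN0 : 0 < N := by positivity
  have hN1 : (k + 1) / β ^ 2 ≤ N := by
    rw [hN, div_le_div_iff₀ (by positivity) (by positivity)]
    have h1 : min σ α ≤ σ := min_le_left _ _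
    have h2 := mul_le_mul_of_nonneg_left h1 (show 0 ≤ ((k : ℝ) + 1) * β ^ 2 by positivity)
    linarith
  have hN2 : 2 / β ^ 2 ≤ N := (div_le_div_of_nonneg_right (by linarith) (by positivity)).trans hN1
  have hlog2 := Real.log_two_gt_d9
  refine ⟨?_, ?_, ?_, ?_⟩
  · have h1 : (2 : ℝ) ^ 7 ≤ N := by
      refine le_trans ?_ hN2
      rw [le_div_iff₀ (by positivity)]
      nlinarith
    have h2 := Real.log_le_log (by norm_num) h1
    rw [Real.log_pow] at h2
    norm_num at h2 ⊢
    linarith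
  · have h1 : (1 / β) ^ 2 ≤ N := by
      refine le_trans ?_ hN2
      rw [div_pow, one_pow]
      exact div_le_div_of_nonneg_right (by norm_num) (by positivity)
    have h2 := Real.log_le_log (by positivity) h1
    rw [Real.log_pow] at h2
    push_cast at h2
    linarith
  · have h1 : 2 * k / β * 2 ≤ N := by
      refine le_trans ?_ hN1
      rw [div_mul_eq_mul_div, div_le_div_iff₀ hβ (by positivity)]
      have h3 : β * β ≤ 1 / 8 * β := mul_le_mul_of_nonneg_right hβ8 hβ.le
      have h4 : 2 * (k : ℝ) * 2 * (β * β) ≤ 2 * (k : ℝ) * 2 * (1 / 8 * β) :=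
        mul_le_mul_of_nonneg_left h3 (by positivity)
      nlinarith
    have h2 := Real.log_le_log (by positivity) h1
    rw [Real.log_mul (by positivity) (by norm_num)] at h2
    linarith
  -- This bound needs `min σ α ≤ α`; the three others use `min σ α ≤ σ`.
  · rw [Real.exp_neg, Real.exp_log hN0, hN, inv_div]
    have h1 : min σ α ≤ α := min_le_right _ _
    rw [← mul_div_assoc, div_le_div_iff₀ (by positivity) (by norm_num)]
    have h2 := mul_le_mul_of_nonneg_left h1 (show 0 ≤ σ * β ^ 2 * 2 by positivity)
    have h3 : 0 ≤ α * β ^ 2 * σ * (k - 1) :=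
      mul_nonneg (by positivity) (by linarith)
    linarith

/-- The noise is calibrated with `k + 1`, the sample size for sub-Gaussian queries with `k`. As `k +
1 ≤ 2 * k`, the logarithms differ by at most `log 2`, which is below a fifth of the smaller one. -/
lemma log_ratio_le {α σ β : ℝ} (hα : 0 < α) (hσ : 0 < σ) (hβ : 0 < β) (hβ8 : β ≤ 1 / 8) {k : ℕ}
    (hk : 0 < k) :
    4 ≤ Real.log (k * σ / (min σ α * β ^ 2)) ∧
      Real.log ((k + 1) * σ / (min σ α * β ^ 2)) ≤
        1.2 * Real.log (k * σ / (min σ α * β ^ 2)) := by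
  have hk1 : (1 : ℝ) ≤ k := by exact_mod_cast hk
  have hm : 0 < min σ α := lt_min hσ hα
  have hlog2 := Real.log_two_gt_d9
  have hlog2' := Real.log_two_lt_d9
  set N : ℝ := k * σ / (min σ α * β ^ 2) with hN
  have hN0 : 0 < N := by positivity
  have h4 : 4 ≤ Real.log N := by
    have h1 : (2 : ℝ) ^ 6 ≤ N := by
      rw [hN, le_div_iff₀ (by positivity)]
      have h1 : min σ α ≤ σ := min_le_left _ _
      have h2 : β ^ 2 ≤ 1 / 64 := by nlinarith
      have h3 : min σ α * β ^ 2 ≤ σ * (1 / 64) :=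
        mul_le_mul h1 h2 (by positivity) hσ.le
      have h4 : 0 ≤ (k - 1) * σ := mul_nonneg (by linarith) hσ.le
      linarith
    have h2 := Real.log_le_log (by norm_num) h1
    rw [Real.log_pow] at h2
    norm_num at h2
    linarith
  refine ⟨h4, ?_⟩
  have h1 : (k + 1) * σ / (min σ α * β ^ 2) ≤ 2 * N := by
    rw [hN, ← mul_div_assoc]
    refine div_le_div_of_nonneg_right ?_ (by positivity)
    nlinarith
  have h2 := Real.log_le_log (by positivity) h1
  rw [Real.log_mul (by norm_num) hN0.ne'] at h2
  linarith

/-- The parameters are `θ = α / (4 * σ ^ 2)`, whose variance term is `α / 8`, `a = log (1 / β)` and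
`q = 2 * L`. `V` and `W` stand for `k / v` times the squares of `σ / n` and `Δ / n`. -/
lemma constants_le_of_bounded {α σ β L V W a : ℝ} (hα : 0 < α) (hσ : 0 < σ) (hβ : 0 < β)
    (hβ8 : β ≤ 1 / 8) (hL : 4.8 ≤ L) (hW0 : 0 ≤ W) (hW : W ≤ 9 / (4 * L ^ 2)) (hV0 : 0 ≤ V)
    (hV : V ≤ α ^ 2 / (384 * L ^ 2 * σ ^ 2)) (ha : a ≤ L / 2)
    (hexp : Real.exp (-a) = β) (hσL : σ * Real.exp (-L) ≤ α * β ^ 2 / 2) :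
    (α / (4 * σ ^ 2) * σ ^ 2 / 2 + (124 * V * a + W * V) / (2 * (α / (4 * σ ^ 2)))) *
        Real.exp (W / 2) ≤ α / 4 ∧
      (124 * V * (Real.exp (-a - 1) * √2) +
          3 * Real.exp (-2 * (2 * L) + (2 * L + 2) ^ 2 * W / 2)) / (2 * (α / (4 * σ ^ 2))) ≤
        α * β / 20 := by
  have hL0 : 0 < L := by linarith
  set z : ℝ := V * (2 * σ ^ 2 / α) with hz
  have hz0 : 0 ≤ z := by positivity
  have hzL : z * L ^ 2 ≤ α / 192 := by
    have h1 : z ≤ α ^ 2 / (384 * L ^ 2 * σ ^ 2) * (2 * σ ^ 2 / α) :=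
      mul_le_mul_of_nonneg_right hV (by positivity)
    calc z * L ^ 2 ≤ α ^ 2 / (384 * L ^ 2 * σ ^ 2) * (2 * σ ^ 2 / α) * L ^ 2 :=
          mul_le_mul_of_nonneg_right h1 (by positivity)
      _ = α / 192 := by field_simp; norm_num
  have hzL1 : z * L ≤ α / 921 := by
    have h1 : 0 ≤ z * L * (L - 4.8) := mul_nonneg (by positivity) (by linarith)
    nlinarith
  have hzL2 : z ≤ α / 4400 := by
    have h1 : 0 ≤ z * (L - 4.8) := mul_nonneg (by positivity) (by linarith)
    linarith
  have hWL : W * L ^ 2 ≤ 9 / 4 := by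
    rw [le_div_iff₀ (by positivity)] at hW
    linarith
  have hW1 : W ≤ 0.1 := by
    have h1 : 0 ≤ W * (L ^ 2 - 4.8 ^ 2) := mul_nonneg hW0 (by nlinarith)
    linarith
  have hdiv : ∀ y : ℝ, y / (2 * (α / (4 * σ ^ 2))) = y * (2 * σ ^ 2 / α) := fun y => by
    field_simp
    norm_num
  rw [hdiv, hdiv]
  constructor
  · have h1 : α / (4 * σ ^ 2) * σ ^ 2 / 2 + (124 * V * a + W * V) * (2 * σ ^ 2 / α) =
        α / 8 + (124 * a + W) * z := by
      rw [hz]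
      field_simp
      ring
    have h2 : (124 * a + W) * z ≤ 63 * (z * L) := by
      have : (124 * a + W) * z ≤ (63 * L) * z := mul_le_mul_of_nonneg_right (by linarith) hz0
      linarith
    have h3 : Real.exp (W / 2) ≤ 1.1 := by
      have h4 := Real.add_one_le_exp (-(W / 2))
      rw [Real.exp_neg] at h4
      have h5 : (0.95 : ℝ) ≤ (Real.exp (W / 2))⁻¹ := by linarith
      rw [le_inv_comm₀ (by norm_num) (Real.exp_pos _)] at h5
      refine h5.trans (by norm_num)
    rw [h1]
    calc _ ≤ (α / 8 + 63 * (α / 921)) * 1.1 :=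
          mul_le_mul (by linarith) h3 (Real.exp_pos _).le (by positivity)
      _ ≤ _ := by linarith
  · have h1 : (124 * V * (Real.exp (-a - 1) * √2) +
          3 * Real.exp (-2 * (2 * L) + (2 * L + 2) ^ 2 * W / 2)) * (2 * σ ^ 2 / α) =
        124 * z * (Real.exp (-a - 1) * √2) +
          6 * σ ^ 2 / α * Real.exp (-2 * (2 * L) + (2 * L + 2) ^ 2 * W / 2) := by
      rw [hz]
      ring
    have h2 : Real.exp (-a - 1) * √2 ≤ β * (3 / 4) := by
      have h3 : √2 ≤ 3 / 2 := Real.sqrt_le_iff.2 ⟨by norm_num, by norm_num⟩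
      have h4 : Real.exp (-1) ≤ 1 / 2 := by
        rw [Real.exp_neg, inv_le_comm₀ (Real.exp_pos 1) (by norm_num)]
        have := Real.add_one_le_exp 1
        norm_num at this ⊢
        linarith
      rw [sub_eq_add_neg, Real.exp_add, hexp, mul_assoc]
      refine mul_le_mul_of_nonneg_left ?_ hβ.le
      calc _ ≤ 1 / 2 * (3 / 2 : ℝ) := mul_le_mul h4 h3 (Real.sqrt_nonneg _) (by norm_num)
        _ = _ := by norm_num
    -- With `W * L ^ 2 ≤ 9 / 4` the quadratic correction is bounded by a constant below `2 * L`, so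
    -- the exponent is at most `-2 * L`. The two factors `exp (-L)` then absorb `σ ^ 2` through
    -- `hσL`.
    have h3 : Real.exp (-2 * (2 * L) + (2 * L + 2) ^ 2 * W / 2) ≤ Real.exp (-L) ^ 2 := by
      rw [← Real.exp_nat_mul]
      refine Real.exp_le_exp.2 ?_
      have h4 : (2 * L + 2) ^ 2 ≤ 6 * L ^ 2 := by nlinarith
      have h5 : (2 * L + 2) ^ 2 * W ≤ 6 * L ^ 2 * W := mul_le_mul_of_nonneg_right h4 hW0
      push_cast
      linarith
    have h4 : 6 * σ ^ 2 / α * Real.exp (-2 * (2 * L) + (2 * L + 2) ^ 2 * W / 2) ≤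
        α * β / 300 := by
      calc _ ≤ 6 * σ ^ 2 / α * Real.exp (-L) ^ 2 := mul_le_mul_of_nonneg_left h3 (by positivity)
        _ = 6 / α * (σ * Real.exp (-L)) ^ 2 := by ring
        _ ≤ 6 / α * (α * β ^ 2 / 2) ^ 2 := by gcongr
        _ = 3 / 2 * (α * β) * β ^ 3 := by field_simp; norm_num
        _ ≤ 3 / 2 * (α * β) * (1 / 8) ^ 3 := by gcongr
        _ ≤ _ := by nlinarith [mul_pos hα hβ]
    rw [h1]
    have h5 : 124 * z * (Real.exp (-a - 1) * √2) ≤ 124 * (α / 4400) * (β * (3 / 4)) := by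
      gcongr
    nlinarith [mul_pos hα hβ]

/-- Here `r = α / (2 * σ ^ 2)`, which makes the term `r * τ ^ 2 * e₀` equal to `α / 2` for `τ = σ /
n` and `e₀ = n ^ 2`. The sample size makes all other terms, multiples of `w`, small against `α`. -/
lemma constants_le_of_subGaussian {α σ β L L' a n k : ℝ} (hα : 0 < α) (hσ : 0 < σ) (hβ : 0 < β)
    (hβ8 : β ≤ 1 / 8) (hk : 1 ≤ k) (hn : 1 ≤ n) (hL : 4.8 ≤ L) (hL' : 4 ≤ L') (hLL' : L ≤ 1.2 * L')
    (ha : a ≤ L / 2) (hnk : 696 * L' ^ (3 / 2 : ℝ) * √k * (σ / α) ^ 2 ≤ n) {v : ℝ}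
    (hv : v * (18 * L) = α ^ 2) :
    (σ / n) ^ 2 / v ≤ 1 / 16 ∧
      α / (2 * σ ^ 2) * (σ / n) ^ 2 * n ^ 2 + 4 * k * ((σ / n) ^ 2 / v) / (α / (2 * σ ^ 2)) +
        32 * ((σ / n) ^ 2 / v) / (α / (2 * σ ^ 2)) * (a + k / 2) ≤ 0.6 * α ∧
      32 * ((σ / n) ^ 2 / v) / (α / (2 * σ ^ 2)) * β ≤ 0.01 * (α * β) := by
  have hL0 : 0 < L := by linarith
  have hL0' : 0 < L' := by linarith
  have hn0 : 0 < n := by linarith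
  have hk0 : 0 < k := by linarith
  have hve : v = α ^ 2 / (18 * L) := by rw [← hv]; field_simp
  have hv0 : 0 < v := by rw [hve]; positivity
  set g : ℝ := (σ / α) ^ 2 with hg
  have hg0 : 0 < g := by positivity
  set y : ℝ := L' ^ (3 / 2 : ℝ) with hy
  have hy2 : y ^ 2 = L' ^ 3 := by
    rw [hy, ← Real.rpow_natCast, ← Real.rpow_mul hL0'.le, ← Real.rpow_natCast]
    norm_num
  have hy1 : L' ≤ y := by
    have := Real.rpow_le_rpow_of_exponent_le (show 1 ≤ L' by linarith)
      (show (1 : ℝ) ≤ 3 / 2 by norm_num)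
    rwa [Real.rpow_one] at this
  have hsk : 1 ≤ √k := Real.one_le_sqrt.2 hk
  have h1 : 696 * L' * g ≤ n := by
    refine le_trans ?_ hnk
    have : 696 * L' * 1 * g ≤ 696 * y * √k * g := by gcongr
    linarith
  have h2 : 484416 * L' ^ 3 * k * g ^ 2 ≤ n ^ 2 := by
    calc _ = (696 * y * √k * g) ^ 2 := by
          rw [mul_pow, mul_pow, mul_pow, hy2, Real.sq_sqrt hk0.le]
          norm_num
      _ ≤ n ^ 2 := by gcongr
  have hτ : (σ / n) ^ 2 / v = 18 * L * g / n ^ 2 := by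
    rw [hve, hg]
    field_simp
  set w : ℝ := (σ / n) ^ 2 / v / (α / (2 * σ ^ 2)) with hw
  have hw0 : 0 ≤ w := by positivity
  have hwe : w = α * (36 * L * g ^ 2 / n ^ 2) := by
    rw [hw, hτ, hg]
    field_simp
    norm_num
  have hwk : w * (11000 * L' ^ 2 * k) ≤ α := by
    rw [hwe, mul_assoc]
    refine mul_le_of_le_one_right hα.le ?_
    rw [div_mul_eq_mul_div, div_le_one (by positivity)]
    refine le_trans ?_ h2
    have h3 : 36 * L * g ^ 2 * (11000 * L' ^ 2 * k) ≤
        36 * (1.2 * L') * g ^ 2 * (11000 * L' ^ 2 * k) := by gcongr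
    have h4 : 0 ≤ L' ^ 3 * k * g ^ 2 := by positivity
    linarith
  have hwk1 : w * L' * k ≤ α / 44000 := by
    have h3 : 0 ≤ w * L' * k * (L' - 4) := mul_nonneg (by positivity) (by linarith)
    linarith
  have hwL : w * L' ≤ α / 44000 := by
    have h3 : 0 ≤ w * L' * (k - 1) := mul_nonneg (by positivity) (by linarith)
    linarith
  have hwk2 : w * k ≤ α / 44000 := by
    have h3 : 0 ≤ w * k * (L' - 1) := mul_nonneg (by positivity) (by linarith)
    linarith
  have hw1 : w ≤ α / 44000 := by
    have h3 : 0 ≤ w * (k - 1) := mul_nonneg (by positivity) (by linarith)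
    linarith
  refine ⟨?_, ?_, ?_⟩
  · rw [hτ, div_le_div_iff₀ (by positivity) (by norm_num)]
    have h3 : L * g ≤ 1.2 * L' * g := by gcongr
    nlinarith
  · have h3 : α / (2 * σ ^ 2) * (σ / n) ^ 2 * n ^ 2 = α / 2 := by field_simp
    have h4 : 4 * k * ((σ / n) ^ 2 / v) / (α / (2 * σ ^ 2)) = 4 * (w * k) := by
      rw [hw]; ring
    have h5 : 32 * ((σ / n) ^ 2 / v) / (α / (2 * σ ^ 2)) * (a + k / 2) =
        32 * (w * a) + 16 * (w * k) := by
      rw [hw]; ring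
    have h6 : w * a ≤ w * L' := mul_le_mul_of_nonneg_left (by linarith) hw0
    rw [h3, h4, h5]
    linarith
  · have h3 : 32 * ((σ / n) ^ 2 / v) / (α / (2 * σ ^ 2)) * β = 32 * w * β := by
      rw [hw]; ring
    have h4 : 32 * w * β ≤ 32 * (α / 44000) * β := by gcongr
    rw [h3]
    nlinarith [mul_pos hα hβ]

end Constants

/-! ### First claim: bounded queries. -/

section BoundedQueries

variable {X C : Type*} [MeasurableSpace X] [MeasurableSpace C] (D : Measure X)

lemma integral_sq_sub_integral_le {σ : ℝ} {q : X → ℝ} (hσ : 0 ≤ σ) (hq : Measurable q)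
    (h : stdDev D q ≤ σ) : ∫ x, (q x - ∫ y, q y ∂D) ^ 2 ∂D ≤ σ ^ 2 := by
  rw [← variance_eq_integral hq.aemeasurable]
  exact (Real.sqrt_le_left hσ).1 h

/-- The selected query is zero or a multiple of a centred query. -/
lemma selectedQuery_cases (A : Analyst X C) {k : ℕ} (α : ℝ) (c : C) (u : Fin k → ℝ) :
    (∀ x, selectedQuery D A α c (x, u) = 0) ∨
      ∃ (i : Fin k) (ε : ℝ), |ε| ≤ 1 ∧ ∀ x, selectedQuery D A α c (x, u) =
        ε * (A.query i c (fun j => u (Fin.castLE i.isLt.le j)) x -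
          ∫ y, A.query i c (fun j => u (Fin.castLE i.isLt.le j)) y ∂D) := by
  rcases firstExceedance_cases D A α (c, u) with h | ⟨i, ε, hε, h⟩
  · exact .inl fun x => by simp [selectedQuery, h]
  · refine .inr ⟨i, ε, hε, fun x => ?_⟩
    simp only [selectedQuery]
    rw [h, Finset.sum_eq_single i (fun i' _ hi' => by simp [hi']) (by simp)]
    simp [meanQuery]

variable [IsProbabilityMeasure D]

lemma IsBoundedQuery.integrable {Δ : ℝ} {q : X → ℝ} (h : IsBoundedQuery Δ q) (hq : Measurable q) :
    Integrable q D := by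
  obtain ⟨x₀⟩ := nonempty_of_isProbabilityMeasure D
  refine Integrable.of_bound hq.aestronglyMeasurable (Δ + |q x₀|) (.of_forall fun x => ?_)
  have h1 := h x x₀
  have h2 := abs_sub_abs_le_abs_sub (q x) (q x₀)
  rw [Real.norm_eq_abs]
  linarith

lemma IsBoundedQuery.abs_sub_integral_le {Δ : ℝ} {q : X → ℝ} (h : IsBoundedQuery Δ q)
    (hq : Measurable q) (x : X) : |q x - ∫ y, q y ∂D| ≤ Δ := by
  have h1 : q x - ∫ y, q y ∂D = ∫ y, (q x - q y) ∂D := by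
    rw [integral_sub (integrable_const _) (h.integrable D hq)]
    simp
  rw [h1]
  have h2 := norm_integral_le_of_norm_le_const (μ := D) (f := fun y => q x - q y) (C := Δ)
    (.of_forall fun y => h x y)
  simpa using h2

variable (A : Analyst X C)

lemma Analyst.measurable_query_apply (i : ℕ) (c : C) (u : Fin i → ℝ) : Measurable (A.query i c u) :=
  (A.measurable_query i).comp (measurable_const.prodMk (measurable_const.prodMk measurable_id))

lemma measurable_selectedQuery_apply (k : ℕ) (α : ℝ) (c : C) :
    Measurable (selectedQuery (k := k) D A α c) := by
  have h := (measurable_selectedQuery (k := k) D A α).comp (measurable_prodMk_left (x := c))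
  exact h

lemma measurable_selectedQuery_resampledRun {n : ℕ} (k : ℕ) (α : ℝ) (j : Fin n) (s : Fin n → X)
    (c : C) :
    Measurable fun p => selectedQuery D A α c (p.1, resampledRun D A k j s c p) := by
  have h := (measurable_selectedQuery_apply D A k α c).comp (measurable_run_joint
    (measurable_baseDrift D A j s c) (measurable_increment D A n c) k)
  exact h

variable {n k : ℕ} {Δ σ : ℝ}
  (h : ∀ i : ℕ, i < k → ∀ (c : C) (u : Fin i → ℝ),
    IsBoundedQuery Δ (A.query i c u) ∧ stdDev D (A.query i c u) ≤ σ)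

include h

lemma abs_selectedQuery_le (hΔ : 0 ≤ Δ) (α : ℝ) (c : C) (p : X × (Fin k → ℝ)) :
    |selectedQuery D A α c p| ≤ Δ := by
  obtain ⟨x, u⟩ := p
  rcases selectedQuery_cases D A α c u with h0 | ⟨i, ε, hε, h0⟩
  · simpa [h0 x] using hΔ
  · rw [h0 x, abs_mul]
    have h1 := (h i i.isLt c fun j => u (Fin.castLE i.isLt.le j)).1.abs_sub_integral_le D
      (A.measurable_query_apply i c _) x
    calc _ ≤ 1 * Δ := mul_le_mul hε h1 (abs_nonneg _) zero_le_one
      _ = Δ := one_mul _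

lemma integral_selectedQuery_eq_zero (α : ℝ) (c : C) (u : Fin k → ℝ) :
    ∫ x, selectedQuery D A α c (x, u) ∂D = 0 := by
  rcases selectedQuery_cases D A α c u with h0 | ⟨i, ε, -, h0⟩
  · simp [h0]
  · simp_rw [h0]
    rw [integral_const_mul, integral_sub _ (integrable_const _)]
    · simp
    · exact (h i i.isLt c _).1.integrable D (A.measurable_query_apply i c _)

lemma integral_selectedQuery_sq_le (hσ : 0 ≤ σ) (α : ℝ) (c : C) (u : Fin k → ℝ) :
    ∫ x, selectedQuery D A α c (x, u) ^ 2 ∂D ≤ σ ^ 2 := by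
  rcases selectedQuery_cases D A α c u with h0 | ⟨i, ε, hε, h0⟩
  · simpa [h0] using sq_nonneg σ
  · simp_rw [h0, mul_pow]
    rw [integral_const_mul]
    have h1 := integral_sq_sub_integral_le D hσ (A.measurable_query_apply i c _)
      (h i i.isLt c fun j => u (Fin.castLE i.isLt.le j)).2
    have h2 : ε ^ 2 ≤ 1 := by
      rw [← sq_abs]
      exact pow_le_one₀ (abs_nonneg _) hε
    exact (mul_le_of_le_one_left (integral_nonneg fun _ => sq_nonneg _) h2).trans h1

lemma abs_increment_le (n : ℕ) (c : C) (l : ℕ) (hl : l < k) (u : Fin l → ℝ) (x : X) :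
    |increment D A n c l x u| ≤ Δ / n := by
  rw [increment, abs_mul, abs_of_nonneg (by positivity), one_div, div_eq_inv_mul]
  exact mul_le_mul_of_nonneg_left ((h l hl c u).1.abs_sub_integral_le D
    (A.measurable_query_apply l c u) x) (by positivity)

lemma integral_increment_eq_zero (n : ℕ) (c : C) (l : ℕ) (hl : l < k) (u : Fin l → ℝ) :
    ∫ x, increment D A n c l x u ∂D = 0 := by
  simp only [increment]
  rw [integral_const_mul, integral_sub ((h l hl c u).1.integrable D (A.measurable_query_apply l c u))
    (integrable_const _)]
  simp [meanQuery]

lemma integral_increment_sq_le (hσ : 0 ≤ σ) (n : ℕ) (c : C) (l : ℕ) (hl : l < k) (u : Fin l → ℝ) :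
    ∫ x, increment D A n c l x u ^ 2 ∂D ≤ (σ / n) ^ 2 := by
  simp only [increment, mul_pow]
  rw [integral_const_mul, div_pow, div_pow, one_pow, one_div, div_eq_inv_mul (σ ^ 2)]
  exact mul_le_mul_of_nonneg_left (integral_sq_sub_integral_le D hσ
    (A.measurable_query_apply l c u) (h l hl c u).2) (by positivity)

/-- The crude second moment `(Δ / n) ^ 2` suffices here: the sample size keeps the exponent small.
-/
lemma real_base_le {v : ℝ≥0} (hv : v ≠ 0) (j : Fin n) (s : Fin n → X) (c : C)
    {E : Set (Fin k → ℝ)} (hE : MeasurableSet E) :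
    (noiseLaw v k).real (adaptiveRun (baseDrift D A j s c) k ⁻¹' E) ≤
      Real.exp (k * (Δ / n) ^ 2 / v / 2) *
        (D.prod (noiseLaw v k)).real {p | resampledRun D A k j s c p ∈ E} := by
  have hm : ∀ l < k, ∀ u, Measurable fun x => increment D A n c l x u := fun l _ u =>
    (measurable_increment D A n c l).comp measurable_prodMk_right
  have hb : ∀ l (hl : l < k) (u : Fin l → ℝ) x, |increment D A n c l x u| ≤ Δ / n :=
    fun l hl u x => abs_increment_le D A h n c l hl u x
  have h1 := measure_base_le (D := D) hv (measurable_baseDrift D A j s c)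
    (measurable_increment D A n c) (k := k)
    (fun l hl u => MemLp.of_bound (hm l hl u).aestronglyMeasurable (Δ / n)
      (.of_forall fun x => hb l hl u x))
    (fun l hl u => integral_increment_eq_zero D A h n c l hl u) (c₀ := (Δ / n) ^ 2)
    (fun l hl u => ?_) hE
  · have h2 := ENNReal.toReal_mono (measure_ne_top _ _) h1
    rw [ENNReal.toReal_mul, ENNReal.toReal_ofReal (Real.exp_pos _).le, neg_div, Real.exp_neg,
      inv_mul_le_iff₀ (Real.exp_pos _)] at h2
    exact h2
  · have h3 : ∫ x, increment D A n c l x u ^ 2 ∂D ≤ ∫ _, (Δ / n) ^ 2 ∂D := by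
      refine integral_mono_of_nonneg (.of_forall fun x => sq_nonneg _) (integrable_const _)
        (.of_forall fun x => ?_)
      beta_reduce
      rw [← sq_abs]
      exact pow_le_pow_left₀ (abs_nonneg _) (hb l hl u x) 2
    simpa using h3

lemma integral_selectedQuery_le (hk : 0 < k) (hΔ : 0 ≤ Δ) (hσ : 0 < σ) {v : ℝ≥0} (hv : v ≠ 0)
    (α : ℝ) (j : Fin n) (s : Fin n → X) (c : C) {a q θ : ℝ} (ha : 0 ≤ a) (hq : 0 ≤ q) (hθ : 0 < θ) :
    ∫ p, selectedQuery D A α c (p.1, resampledRun D A k j s c p) ∂(D.prod (noiseLaw v k)) ≤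
      (θ * σ ^ 2 / 2 + (124 * (k * (σ / n) ^ 2 / v) * a + k * (Δ / n) ^ 2 / v *
          (k * (σ / n) ^ 2 / v)) / (2 * θ)) *
          (noiseLaw v k).real (adaptiveRun (baseDrift D A j s c) k ⁻¹' exceedanceSet D A k α c) +
        (124 * (k * (σ / n) ^ 2 / v) * (Real.exp (-a - 1) * √2) +
          3 * Real.exp (-2 * q + (q + 2) ^ 2 * (k * (Δ / n) ^ 2 / v) / 2)) / (2 * θ) := by
  have hn : (0 : ℝ) < n := by exact_mod_cast j.pos
  exact integral_le_of_bounded hv (measurable_baseDrift D A j s c)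
    (measurable_increment D A n c) hk (abs_increment_le D A h n c)
    (by positivity) (integral_increment_sq_le D A h hσ.le n c)
    (measurableSet_exceedanceSet D A k α c) (measurable_selectedQuery_apply D A k α c)
    (abs_selectedQuery_le D A h hΔ α c)
    (integral_selectedQuery_eq_zero D A h α c) (integral_selectedQuery_sq_le D A h hσ.le α c)
    (fun u hu x => selectedQuery_eq_zero hu x) ha hq hθ

theorem isDistributionAccurate_of_isBoundedQuery {α β η : ℝ} (hn : 0 < n) (hk : 0 < k) (hα : 0 < α)
    (hΔ : 0 < Δ) (hσ : 0 < σ) (hβ : 0 < β) (hβ8 : β ≤ 1 / 8)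
    (hη : η = α / (3 * √(2 * Real.log ((k + 1) * σ / (min σ α * β ^ 2)))))
    (hnk : 2 * √2 * Real.log ((k + 1) * σ / (min σ α * β ^ 2)) ^ (3 / 2 : ℝ) * √k *
      max (Δ / α) (12 * √6 * (σ / α) ^ 2) ≤ n) :
    IsDistributionAccurate D (gaussianMechanism X n η) A k α β := by
  obtain ⟨hL, hβL, hkL, hσL⟩ := log_ratio_bounds hα hσ hβ hβ8 hk
  set L := Real.log ((k + 1) * σ / (min σ α * β ^ 2)) with hLdef
  have hL0 : 0 < L := by linarith
  have hn' : (0 : ℝ) < n := by exact_mod_cast hn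
  have hk' : (0 : ℝ) < k := by exact_mod_cast hk
  have hs : √(2 * L) ^ 2 = 2 * L := Real.sq_sqrt (by positivity)
  have hs0 : 0 < √(2 * L) := Real.sqrt_pos.2 (by positivity)
  have hη0 : 0 < η := by rw [hη]; positivity
  have hηL : η ^ 2 * (18 * L) = α ^ 2 := by
    rw [hη, div_pow, mul_pow, hs]
    field_simp
    norm_num
  set v : ℝ≥0 := (η ^ 2).toNNReal with hvdef
  have hvη : (v : ℝ) = η ^ 2 := Real.coe_toNNReal _ (sq_nonneg _)
  have hv0 : (0 : ℝ) < v := by rw [hvη]; positivity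
  have hv : v ≠ 0 := by
    rintro h0
    rw [h0] at hv0
    exact lt_irrefl _ hv0
  have hve : (v : ℝ) = α ^ 2 / (18 * L) := by rw [hvη, ← hηL]; field_simp
  have hy2 : (L ^ (3 / 2 : ℝ)) ^ 2 = L ^ 3 := by
    rw [← Real.rpow_natCast, ← Real.rpow_mul hL0.le, ← Real.rpow_natCast]
    norm_num
  -- The sample-size condition squared, with `8 = (2 * √2) ^ 2`; it is used for each of the two
  -- entries of the maximum.
  have hsq : ∀ z, 0 ≤ z → z ≤ max (Δ / α) (12 * √6 * (σ / α) ^ 2) →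
      8 * L ^ 3 * k * z ^ 2 ≤ (n : ℝ) ^ 2 := by
    intro z hz hzm
    have h2 : 2 * √2 * L ^ (3 / 2 : ℝ) * √k * z ≤ n :=
      (mul_le_mul_of_nonneg_left hzm (by positivity)).trans hnk
    calc 8 * L ^ 3 * k * z ^ 2 = (2 * √2 * L ^ (3 / 2 : ℝ) * √k * z) ^ 2 := by
          rw [mul_pow, mul_pow, mul_pow, mul_pow, hy2, Real.sq_sqrt hk'.le,
            Real.sq_sqrt (by norm_num)]
          norm_num
      _ ≤ _ := pow_le_pow_left₀ (by positivity) h2 2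
  have hW : k * (Δ / n) ^ 2 / (v : ℝ) ≤ 9 / (4 * L ^ 2) := by
    have h2 := hsq (Δ / α) (by positivity) (le_max_left _ _)
    have h3 : k * (Δ / n) ^ 2 / (v : ℝ) = 18 * L * k * (Δ / α) ^ 2 / n ^ 2 := by
      rw [hve]
      field_simp
    rw [h3, div_le_div_iff₀ (by positivity) (by positivity)]
    linarith
  have hV : k * (σ / n) ^ 2 / (v : ℝ) ≤ α ^ 2 / (384 * L ^ 2 * σ ^ 2) := by
    have h2 := hsq (12 * √6 * (σ / α) ^ 2) (by positivity) (le_max_right _ _)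
    rw [mul_pow, mul_pow, Real.sq_sqrt (by norm_num)] at h2
    have h3 : k * (σ / n) ^ 2 / (v : ℝ) = 18 * L * k * σ ^ 2 / (α ^ 2 * n ^ 2) := by
      rw [hve]
      field_simp
    rw [h3, div_le_div_iff₀ (by positivity) (by positivity)]
    have h4 := mul_le_mul_of_nonneg_left h2 (show 0 ≤ α ^ 4 by positivity)
    have h5 : α ^ 4 * (8 * L ^ 3 * k * (12 ^ 2 * 6 * ((σ / α) ^ 2) ^ 2)) =
        6912 * L ^ 3 * k * σ ^ 4 := by
      field_simp
      norm_num
    rw [h5] at h4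
    linarith
  have ha0 : 0 ≤ Real.log (1 / β) := Real.log_nonneg (by rw [le_div_iff₀ hβ]; linarith)
  obtain ⟨hc₁, hc₂⟩ := constants_le_of_bounded (W := k * (Δ / n) ^ 2 / v)
    (V := k * (σ / n) ^ 2 / v) hα hσ hβ hβ8 hL (by positivity) hW (by positivity) hV hβL
    (by rw [one_div, Real.log_inv, neg_neg, Real.exp_log hβ]) hσL
  refine isDistributionAccurate_of_integral_selectedQuery_le D A hn hk
    (fun i hi c u => (h i hi c u).1.integrable D (A.measurable_query_apply i c u)) hα hβ hη0 hL0 hηL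
    hkL (c₁ := α / 4) (c₂ := α * β / 20) (K := Δ) (by linarith) ?_ fun j s c => ?_
  · nlinarith [mul_pos hα hβ]
  have hbd := abs_selectedQuery_le D A h hΔ.le α c
  have hint : Integrable (fun p => selectedQuery D A α c (p.1, resampledRun D A k j s c p))
      (D.prod (noiseLaw v k)) :=
    Integrable.of_bound (measurable_selectedQuery_resampledRun D A k α j s c).aestronglyMeasurable
      Δ (.of_forall fun p => hbd _)
  refine ⟨hint, ?_, ?_⟩
  · calc _ ≤ ∫ _, Δ ∂(D.prod (noiseLaw v k)) :=
          integral_mono hint.abs (integrable_const _) fun p => hbd _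
      _ = Δ := by simp
  · have h2 := integral_selectedQuery_le D A h hk hΔ.le hσ hv α j s c ha0 (q := 2 * L)
      (by positivity) (θ := α / (4 * σ ^ 2)) (by positivity)
    refine h2.trans (add_le_add ?_ hc₂)
    -- The probability in the base channel is replaced by the true one at the cost of the factor
    -- `exp (W / 2)` included in `hc₁`.
    refine (mul_le_mul_of_nonneg_left (real_base_le D A h hv j s c
      (measurableSet_exceedanceSet D A k α c)) (by positivity)).trans ?_
    rw [← mul_assoc]
    exact mul_le_mul_of_nonneg_right hc₁ measureReal_nonneg

end BoundedQueries

/-! ### Second claim: sub-Gaussian queries. -/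

section SubGaussianQueries

variable {X C : Type*} [MeasurableSpace X] [MeasurableSpace C] {D : Measure X}
  [IsProbabilityMeasure D] {k : ℕ} {σ : ℝ}

/-- Every nonzero `w` is a positive multiple of a unit vector, so the condition for unit vectors and
`t > 0` already covers all directions and both signs. -/
lemma IsSubGaussianVector.integral_exp_sum_le {f : X → EuclideanSpace ℝ (Fin k)}
    (h : IsSubGaussianVector D f σ) (w : Fin k → ℝ) :
    Integrable (fun x => Real.exp (∑ i, w i * f x i)) D ∧
      ∫ x, Real.exp (∑ i, w i * f x i) ∂D ≤ Real.exp (σ ^ 2 * ∑ i, w i ^ 2) := by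
  by_cases hw : w = 0
  · simp [hw]
  · set w' : EuclideanSpace ℝ (Fin k) := WithLp.toLp 2 w with hw'
    have hne : w' ≠ 0 := fun h0 => hw (by
      have := congrArg WithLp.ofLp h0
      simpa [hw'] using this)
    have hpos : 0 < ‖w'‖ := norm_pos_iff.2 hne
    have hnorm : ‖w'‖ ^ 2 = ∑ i, w i ^ 2 := by
      rw [EuclideanSpace.norm_sq_eq]
      simp [hw']
    have h1 := h (‖w'‖⁻¹ • w') (by
      rw [norm_smul, norm_inv, norm_norm, inv_mul_cancel₀ hpos.ne']) ‖w'‖ hpos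
    have h2 : ∀ x, ‖w'‖ * inner ℝ (‖w'‖⁻¹ • w') (f x) = ∑ i, w i * f x i := by
      intro x
      rw [real_inner_smul_left, mul_inv_cancel_left₀ hpos.ne', PiLp.inner_apply]
      refine Finset.sum_congr rfl fun i _ => ?_
      simp [hw', mul_comm]
    simp only [h2, hnorm] at h1
    rwa [mul_comm (∑ i, w i ^ 2)] at h1

lemma hasSubGaussianIncrements_query {A : Analyst X C}
    (h : ∀ (c : C) (u : Fin k → ℝ),
      IsSubGaussianVector D (fun x => WithLp.toLp 2 fun i => A.queryAt c u i x) σ) (c : C) :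
    HasSubGaussianIncrements D (fun l x u => A.query l c u x) k σ := fun u w =>
  (h c u).integral_exp_sum_le w

variable (D)
variable {A : Analyst X C} (h : ∀ c : C,
    HasSubGaussianIncrements D (fun l x u => A.query l c u x) k σ)

include h

lemma integrable_query_of_subGaussian (i : ℕ) (hi : i < k) (c : C) (u : Fin i → ℝ) :
    Integrable (A.query i c u) D :=
  (memLp_of_integrable_exp (A.measurable_query_apply i c u) fun t =>
    ((h c).increment hi u t).1).integrable one_le_two

lemma meanQuery_eq_zero_of_subGaussian (i : ℕ) (hi : i < k) (c : C) (u : Fin i → ℝ) :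
    meanQuery D A i c u = 0 :=
  integral_eq_zero_of_exp_le (integrable_query_of_subGaussian D h i hi c u)
    fun t => (h c).increment hi u t

lemma hasSubGaussianIncrements_increment (n : ℕ) (c : C) :
    HasSubGaussianIncrements D (increment D A n c) k (σ / n) := by
  intro u w
  have h1 := h c u fun i => w i * (1 / n)
  have h2 : ∀ x, ∑ i : Fin k, w i * increment D A n c i x (fun j => u (Fin.castLE i.isLt.le j)) =
      ∑ i : Fin k, w i * (1 / n) * A.query i c (fun j => u (Fin.castLE i.isLt.le j)) x := by
    intro x
    refine Finset.sum_congr rfl fun i _ => ?_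
    rw [increment, meanQuery_eq_zero_of_subGaussian D h i i.isLt]
    ring
  have h3 : (σ / n) ^ 2 * ∑ i, w i ^ 2 = σ ^ 2 * ∑ i, (w i * (1 / (n : ℝ))) ^ 2 := by
    simp_rw [mul_pow, ← Finset.sum_mul]
    ring
  simp only [h2, h3]
  exact h1

theorem isDistributionAccurate_of_hasSubGaussianIncrements {n : ℕ} {α β η : ℝ} (hn : 0 < n)
    (hk : 0 < k) (hα : 0 < α) (hσ : 0 < σ) (hβ : 0 < β) (hβ8 : β ≤ 1 / 8)
    (hη : η = α / (3 * √(2 * Real.log ((k + 1) * σ / (min σ α * β ^ 2)))))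
    (hnk : 696 * Real.log (k * σ / (min σ α * β ^ 2)) ^ (3 / 2 : ℝ) * √k * (σ / α) ^ 2 ≤ n) :
    IsDistributionAccurate D (gaussianMechanism X n η) A k α β := by
  obtain ⟨hL, hβL, hkL, -⟩ := log_ratio_bounds hα hσ hβ hβ8 hk
  obtain ⟨hL', hLL'⟩ := log_ratio_le hα hσ hβ hβ8 hk
  set L := Real.log ((k + 1) * σ / (min σ α * β ^ 2)) with hLdef
  have hL0 : 0 < L := by linarith
  have hn1 : (1 : ℝ) ≤ n := by exact_mod_cast hn
  have hk1 : (1 : ℝ) ≤ k := by exact_mod_cast hk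
  have hs : √(2 * L) ^ 2 = 2 * L := Real.sq_sqrt (by positivity)
  have hs0 : 0 < √(2 * L) := Real.sqrt_pos.2 (by positivity)
  have hη0 : 0 < η := by rw [hη]; positivity
  have hηL : η ^ 2 * (18 * L) = α ^ 2 := by
    rw [hη, div_pow, mul_pow, hs]
    field_simp
    norm_num
  set v : ℝ≥0 := (η ^ 2).toNNReal with hvdef
  have hvη : (v : ℝ) = η ^ 2 := Real.coe_toNNReal _ (sq_nonneg _)
  have hv0 : (0 : ℝ) < v := by rw [hvη]; positivity
  have hv : v ≠ 0 := by
    rintro h0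
    rw [h0] at hv0
    exact lt_irrefl _ hv0
  obtain ⟨hτ, hc₁, hc₂⟩ := constants_le_of_subGaussian (v := v) hα hσ hβ hβ8 hk1 hn1 hL hL' hLL'
    hβL hnk (by rw [hvη]; exact hηL)
  have ha0 : 0 ≤ Real.log (1 / β) := Real.log_nonneg (by rw [le_div_iff₀ hβ]; linarith)
  refine isDistributionAccurate_of_integral_selectedQuery_le D A hn hk
    (fun i hi c u => integrable_query_of_subGaussian D h i hi c u) hα hβ hη0 hL0 hηL hkL
    (c₁ := 0.6 * α) (c₂ := 0.01 * (α * β))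
    (K := 2 * Real.exp (2 * (σ / n) ^ 2 * n ^ 2) * Real.exp (k / 2)) (by linarith) ?_
    fun j s c => ?_
  · nlinarith [mul_pos hα hβ]
  -- The factor `n` undoes the `1 / n` in the increments.
  set e : (Fin k → ℝ) → Fin k → ℝ := fun u => (n : ℝ) • firstExceedance D A α (c, u) with he
  have hem : Measurable e :=
    ((measurable_firstExceedance D A α).comp (measurable_prodMk_left (x := c))).const_smul (n : ℝ)
  have hcomb : selectedQuery (k := k) D A α c = combination (increment D A n c) e := by
    ext p
    refine Finset.sum_congr rfl fun i _ => ?_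
    simp only [he, increment, Pi.smul_apply, smul_eq_mul]
    field_simp
  have he2 : ∀ u, ∑ i, e u i ^ 2 ≤ (n : ℝ) ^ 2 := by
    intro u
    simp only [he, Pi.smul_apply, smul_eq_mul, mul_pow]
    rw [← Finset.mul_sum]
    exact mul_le_of_le_one_right (sq_nonneg _) (sum_firstExceedance_sq_le D A α (c, u))
  have heE : ∀ u ∉ exceedanceSet D A k α c, e u = 0 := by
    intro u hu
    have h1 : firstExceedance D A α (c, u) = 0 := by
      refine firstExceedance_eq_zero fun i => ?_
      by_contra! hi
      exact hu ⟨i, hi⟩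
    simp [he, h1]
  -- The summand `k / 2` of `A` cancels the factor `exp (k / 2)` from the moment of the squared
  -- noise; the summand `log (1 / β)` leaves a term of order `β`.
  obtain ⟨h1, h2, h3⟩ := (hasSubGaussianIncrements_increment D h n c).integral_le hv
    (measurable_baseDrift D A j s c) (measurable_increment D A n c) (by positivity) hτ hem
    (sq_nonneg (n : ℝ)) he2 (measurableSet_exceedanceSet D A k α c) heE
    (r := α / (2 * σ ^ 2)) (A := Real.log (1 / β) + k / 2) (by positivity) (by positivity)
  rw [hcomb]
  refine ⟨h1, h2, h3.trans (add_le_add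
    (mul_le_mul_of_nonneg_right hc₁ measureReal_nonneg) (le_trans ?_ hc₂))⟩
  refine mul_le_mul_of_nonneg_left ?_ (by positivity)
  have h4 : -(Real.log (1 / β) + k / 2) - 1 + k / 2 = Real.log β - 1 := by
    rw [one_div, Real.log_inv]
    ring
  rw [h4]
  calc _ ≤ Real.exp (Real.log β) := Real.exp_le_exp.2 (by linarith)
    _ = β := Real.exp_log hβ

end SubGaussianQueries

/-- The supremum over the empty index set is `0` by convention, which does not exceed `α`. -/
lemma isDistributionAccurate_zero {X Ω C : Type*} [MeasurableSpace X] [MeasurableSpace Ω]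
    [MeasurableSpace C] {n : ℕ} (D : Measure X) (M : Mechanism X Ω n) (A : Analyst X C) {α : ℝ}
    (hα : 0 < α) (β : ℝ) : IsDistributionAccurate D M A 0 α β := by
  have h : {p : (Fin n → X) × C × (Fin 0 → Ω) |
      α < distributionError D n A p.2.1 (responses M A p.1 p.2.1 0 p.2.2)} = ∅ := by
    ext p
    simp [distributionError, hα.le]
  rw [IsDistributionAccurate, h]
  simp

end AdaptiveData

end

theorem mainTheorem12 {X C : Type*} [MeasurableSpace X] [MeasurableSpace C]
    (D : MeasureTheory.Measure X) [MeasureTheory.IsProbabilityMeasure D]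
    (A : AdaptiveData.Analyst X C) (n k : ℕ) (α Δ σ β η : ℝ)
    (hα : 0 < α) (hΔ : 0 < Δ) (hσ : 0 < σ) (hβ : 0 < β) (hβ8 : β ≤ 1 / 8)
    (hη : η = α / (3 * √(2 * Real.log ((k + 1) * σ / (min σ α * β ^ 2))))) :
    ((∀ i : ℕ, i < k → ∀ (c : C) (v : Fin i → ℝ),
        AdaptiveData.IsBoundedQuery Δ (A.query i c v) ∧
          AdaptiveData.stdDev D (A.query i c v) ≤ σ) →
      2 * √2 * Real.log ((k + 1) * σ / (min σ α * β ^ 2)) ^ (3 / 2 : ℝ) * √k *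
          max (Δ / α) (12 * √6 * (σ / α) ^ 2) ≤ n →
      AdaptiveData.IsDistributionAccurate D (AdaptiveData.gaussianMechanism X n η) A k α β) ∧
    ((∀ (c : C) (v : Fin k → ℝ),
        AdaptiveData.IsSubGaussianVector D
          (fun x => WithLp.toLp 2 fun i => A.queryAt c v i x) σ) →
      696 * Real.log (k * σ / (min σ α * β ^ 2)) ^ (3 / 2 : ℝ) * √k * (σ / α) ^ 2 ≤ n →
      AdaptiveData.IsDistributionAccurate D (AdaptiveData.gaussianMechanism X n η) A k α β) := by
  rcases Nat.eq_zero_or_pos k with rfl | hk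
  · exact ⟨fun _ _ => AdaptiveData.isDistributionAccurate_zero D _ A hα β,
      fun _ _ => AdaptiveData.isDistributionAccurate_zero D _ A hα β⟩
  have hk' : (0 : ℝ) < k := by exact_mod_cast hk
  refine ⟨fun h hnk => ?_, fun h hnk => ?_⟩
  · have hL := (AdaptiveData.log_ratio_bounds hα hσ hβ hβ8 hk).1
    have hL0 : 0 < Real.log ((k + 1) * σ / (min σ α * β ^ 2)) := by linarith
    -- For `k > 0` the lower bound on `n` is positive, so the dataset is nonempty.
    have hn : (0 : ℝ) < n := lt_of_lt_of_le (by positivity) hnk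
    exact AdaptiveData.isDistributionAccurate_of_isBoundedQuery D A h (by exact_mod_cast hn) hk hα
      hΔ hσ hβ hβ8 hη hnk
  · have hL := (AdaptiveData.log_ratio_le hα hσ hβ hβ8 hk).1
    have hL0 : 0 < Real.log (k * σ / (min σ α * β ^ 2)) := by linarith
    have hn : (0 : ℝ) < n := lt_of_lt_of_le (by positivity) hnk
    exact AdaptiveData.isDistributionAccurate_of_hasSubGaussianIncrements D
      (AdaptiveData.hasSubGaussianIncrements_query h) (by exact_mod_cast hn) hk hα hσ hβ hβ8 hη hnk
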